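/- Let $r\ge 1$. For a bounded domain $\Omega\subset\mathbb R^3$ with a conforming triangulation $\mathcal T_h$ of $\overline\Omega$ into finitely many closed tetrahedra, of maximum meshwidth $h$, let $V_h\subset H^1(\Omega)$ be the Lagrange finite element space of continuous functions that are polynomials of degree at most $r$ on each tetrahedron. It is understood that $\Omega$ is the interior of its closure and that every boundary point has arbitrarily small neighbourhoods $U$ with $U\cap\Omega$ connected (for example, $\Omega$ is a Lipschitz domain). Let $(\cdot,\cdot)$ be the $L^2$ inner product over $\Omega$. For $m\in W^{1,\infty}(\Omega)^3$ with $|m|=1$ almost everywhere, let $$T_h(m)=\{\varphi_h\in V_h^3:\ (m\cdot\varphi_h,v_h)=0\ \text{ for all } v_h\in V_h\}$$ be the discrete tangent space and let $P_h(m)\colon V_h^3\to T_h(m)$ be the $L^2(\Omega)$-orthogonal projection. The norms are $\|u\|_{W^{0,p}}=\|u\|_{L^p}$, $\|u\|_{W^{1,p}}=\|u\|_{L^p}+\|\nabla u\|_{L^p}$ and $$\|u\|_{W^{-1,p}}=\sup_{w\in W^{1,q}(\Omega)^3}\frac{(u,w)}{\|w\|_{W^{1,q}}},\qquad \frac1p+\frac1q=1.$$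 The triangulation is assumed shape-regular with constant $\sigma$ (each $T\in\mathcal T_h$ contains a ball of some radius $\rho_T>0$ with $\operatorname{diam}T\le\sigma\rho_T$) and quasi-uniform with constant $\tau$ ($h\le\tau\operatorname{diam}T$ for all $T\in\mathcal T_h$). **Lemma.** For every $p\in[1,\infty]$ there is a constant $C$ that depends only on $p$, $r$, $\sigma$ and $\tau$, and for every $R$ there is $h_R>0$ that depends only on $R$, $r$, $\sigma$ and $\tau$, such that, whenever $h\le h_R$, for all $m\in W^{1,\infty}(\Omega)^3$ with $|m|=1$ almost everywhere and $\|m\|_{W^{1,\infty}(\Omega)^3}\le R$, all $v_h\in V_h^3$ and all $s\in\{-1,0,1\}$, $$\|P_h(m)v_h\|_{W^{s,p}(\Omega)^3}\le C\,\|m\|_{W^{1,\infty}(\Omega)^3}^2\,\|v_h\|_{W^{s,p}(\Omega)^3}.$$ -/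

import Mathlib

open MeasureTheory Topology
open scoped ENNReal NNReal ContDiff

noncomputable section

namespace FEM

/-- The Euclidean space `ℝ³`. -/
abbrev E3 : Type := EuclideanSpace ℝ (Fin 3)

/-- Bounded domains in `ℝ³` that lie nowhere on both sides of their boundary and do not touch
themselves: every boundary point has arbitrarily small neighbourhoods that meet `Ω` in a connected
set. Every bounded Lipschitz domain satisfies this. -/
structure BoundedDomain (Ω : Set E3) : Prop where
  isConnected : IsConnected Ω
  isBounded : Bornology.IsBounded Ω
  interior_closure : interior (closure Ω) = Ω
  connected_at_frontier : ∀ x ∈ frontier Ω, ∀ U ∈ 𝓝 x, ∃ V ∈ 𝓝 x, V ⊆ U ∧ IsConnected (V ∩ Ω)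

/-! ### Sobolev norms -/

/-- `g` is the weak derivative of `u` on `Ω`. -/
def HasWeakFDeriv (Ω : Set E3) (u : E3 → E3) (g : E3 → E3 →L[ℝ] E3) : Prop :=
  LocallyIntegrableOn u Ω ∧ LocallyIntegrableOn g Ω ∧
    ∀ φ : E3 → ℝ, ContDiff ℝ ∞ φ → HasCompactSupport φ → tsupport φ ⊆ Ω → ∀ e : E3,
      ∫ x in Ω, fderiv ℝ φ x e • u x = -∫ x in Ω, φ x • g x e

/-- The norm of `L^p(Ω)³`, with values in `[0, ∞]`. -/
def normLp (Ω : Set E3) (p : ℝ≥0∞) (u : E3 → E3) : ℝ≥0∞ :=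
  eLpNorm u p (volume.restrict Ω)

/-- The norm `‖u‖_{L^p} + ‖∇u‖_{L^p}` of `W^{1,p}(Ω)³`, with value `∞` if `u` is not in this
space. Weak derivatives are unique almost everywhere, so that the infimum runs over at most one
value, and it is `∞` if there is no weak derivative. -/
def normW1 (Ω : Set E3) (p : ℝ≥0∞) (u : E3 → E3) : ℝ≥0∞ :=
  ⨅ (g : E3 → E3 →L[ℝ] E3) (_ : HasWeakFDeriv Ω u g),
    eLpNorm u p (volume.restrict Ω) + eLpNorm g p (volume.restrict Ω)

/-- The dual norm `sup_w (u, w) / ‖w‖_{W^{1,q}}` of `W^{-1,p}(Ω)³`, where `1/p + 1/q = 1` and `w`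
runs over `W^{1,q}(Ω)³` (without boundary conditions). -/
def normWneg1 (Ω : Set E3) (p : ℝ≥0∞) (u : E3 → E3) : ℝ≥0∞ :=
  ⨆ (w : E3 → E3) (_ : normW1 Ω p.conjExponent w < ⊤),
    ‖∫ x in Ω, inner ℝ (u x) (w x)‖ₑ / normW1 Ω p.conjExponent w

/-- The norm of `W^{s,p}(Ω)³` for `s ∈ {-1, 0, 1}`. -/
def normW (Ω : Set E3) : SignType → ℝ≥0∞ → (E3 → E3) → ℝ≥0∞
  | .neg => normWneg1 Ω
  | .zero => normLp Ω
  | .pos => normW1 Ω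

/-! ### Triangulations -/

/-- A (regular, that is, conforming) triangulation of `Ω` into finitely many closed tetrahedra:
a finite simplicial complex, all of whose simplices are faces of tetrahedra, that covers the
closure of `Ω`. -/
structure Triangulation (Ω : Set E3) extends Geometry.SimplicialComplex ℝ E3 where
  finite_faces : faces.Finite
  pure : ∀ s ∈ faces, ∃ t ∈ faces, s ⊆ t ∧ t.card = 4
  space_eq : toSimplicialComplex.space = closure Ω

variable {Ω : Set E3}

/-- The vertex sets of the tetrahedra of a triangulation. -/
def Triangulation.elements (𝒯 : Triangulation Ω) : Set (Finset E3) :=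
  {t ∈ 𝒯.faces | t.card = 4}

/-- The closed tetrahedron with a given set of vertices. -/
def tet (t : Finset E3) : Set E3 := convexHull ℝ (t : Set E3)

/-- The maximum meshwidth. -/
def Triangulation.meshWidth (𝒯 : Triangulation Ω) : ℝ :=
  sSup ((fun t => Metric.diam (tet t)) '' 𝒯.elements)

/-- Shape regularity: each tetrahedron contains a ball whose radius is comparable with the
diameter of the tetrahedron. -/
def Triangulation.ShapeRegular (𝒯 : Triangulation Ω) (σ : ℝ) : Prop :=
  ∀ t ∈ 𝒯.elements, ∃ (c : E3) (ρ : ℝ), 0 < ρ ∧ Metric.closedBall c ρ ⊆ tet t ∧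
    Metric.diam (tet t) ≤ σ * ρ

/-- Quasi-uniformity: the diameters of all tetrahedra are comparable with the meshwidth. -/
def Triangulation.QuasiUniform (𝒯 : Triangulation Ω) (τ : ℝ) : Prop :=
  ∀ t ∈ 𝒯.elements, 𝒯.meshWidth ≤ τ * Metric.diam (tet t)

/-! ### Finite element spaces -/

/-- The Lagrange finite element space `V_h`: continuous functions on the closure of `Ω` that are
polynomials of degree at most `r` on each tetrahedron. (Values outside the closure of `Ω` are
never used.) -/
def feSpace (𝒯 : Triangulation Ω) (r : ℕ) : Submodule ℝ (E3 → ℝ) where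
  carrier := {v | ContinuousOn v (closure Ω) ∧ ∀ t ∈ 𝒯.elements,
    ∃ P : MvPolynomial (Fin 3) ℝ, P.totalDegree ≤ r ∧
      ∀ x ∈ tet t, v x = MvPolynomial.eval (fun i => x i) P}
  add_mem' := by
    rintro u v ⟨hu, hu'⟩ ⟨hv, hv'⟩
    refine ⟨hu.add hv, fun t ht => ?_⟩
    obtain ⟨P, hP, hP'⟩ := hu' t ht
    obtain ⟨Q, hQ, hQ'⟩ := hv' t ht
    refine ⟨P + Q, (MvPolynomial.totalDegree_add P Q).trans (max_le hP hQ), fun x hx => ?_⟩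
    simp [hP' x hx, hQ' x hx]
  zero_mem' := ⟨continuousOn_const, fun t _ => ⟨0, by simp, fun x _ => by simp⟩⟩
  smul_mem' := by
    rintro a u ⟨hu, hu'⟩
    refine ⟨hu.const_smul a, fun t ht => ?_⟩
    obtain ⟨P, hP, hP'⟩ := hu' t ht
    refine ⟨a • P, (MvPolynomial.totalDegree_smul_le a P).trans hP, fun x hx => ?_⟩
    simp [hP' x hx]

/-- The Hilbert space `L²(Ω)³`. -/
abbrev L2 (Ω : Set E3) : Type := Lp E3 2 (volume.restrict Ω)

/-- The space `V_h³` as a subspace of `L²(Ω)³`. -/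
def feSpace3 (𝒯 : Triangulation Ω) (r : ℕ) : Submodule ℝ (L2 Ω) where
  carrier := {f | ∀ i : Fin 3, ∃ v ∈ feSpace 𝒯 r, ∀ᵐ x ∂(volume.restrict Ω), f x i = v x}
  add_mem' := by
    intro f g hf hg i
    obtain ⟨u, hu, hu'⟩ := hf i
    obtain ⟨v, hv, hv'⟩ := hg i
    refine ⟨u + v, add_mem hu hv, ?_⟩
    filter_upwards [hu', hv', Lp.coeFn_add f g] with x h1 h2 h3
    rw [h3, Pi.add_apply, PiLp.add_apply, h1, h2, Pi.add_apply]
  zero_mem' := by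
    intro i
    refine ⟨0, zero_mem _, ?_⟩
    filter_upwards [Lp.coeFn_zero E3 2 (volume.restrict Ω)] with x h
    rw [h]
    rfl
  smul_mem' := by
    intro a f hf i
    obtain ⟨u, hu, hu'⟩ := hf i
    refine ⟨a • u, Submodule.smul_mem _ a hu, ?_⟩
    filter_upwards [hu', Lp.coeFn_smul a f] with x h1 h2
    simp [h2, h1]

/-- The discrete tangent space `T_h(m) = {φ ∈ V_h³ : (m · φ, v) = 0 for all v ∈ V_h}`. (The
integrability clause is automatic for bounded measurable `m`.) -/
def tangentSpace (𝒯 : Triangulation Ω) (r : ℕ) (m : E3 → E3) : Submodule ℝ (L2 Ω) where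
  carrier := {φ | φ ∈ feSpace3 𝒯 r ∧ ∀ v ∈ feSpace 𝒯 r,
    IntegrableOn (fun x => inner ℝ (m x) (φ x) * v x) Ω ∧
      ∫ x in Ω, inner ℝ (m x) (φ x) * v x = 0}
  add_mem' := by
    rintro f g ⟨hf, hf'⟩ ⟨hg, hg'⟩
    refine ⟨add_mem hf hg, fun v hv => ?_⟩
    obtain ⟨h1, h2⟩ := hf' v hv
    obtain ⟨h3, h4⟩ := hg' v hv
    have h : (fun x => inner ℝ (m x) (f x) * v x + inner ℝ (m x) (g x) * v x)
        =ᵐ[volume.restrict Ω] fun x => inner ℝ (m x) ((f + g : L2 Ω) x) * v x := by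
      filter_upwards [Lp.coeFn_add f g] with x hx
      rw [hx, Pi.add_apply, inner_add_right, add_mul]
    refine ⟨(h1.add h3).congr h, ?_⟩
    rw [← integral_congr_ae h, integral_add h1 h3, h2, h4, add_zero]
  zero_mem' := by
    refine ⟨zero_mem _, fun v _ => ?_⟩
    have h : (fun _ => (0 : ℝ)) =ᵐ[volume.restrict Ω]
        fun x => inner ℝ (m x) ((0 : L2 Ω) x) * v x := by
      filter_upwards [Lp.coeFn_zero E3 2 (volume.restrict Ω)] with x hx
      rw [hx, Pi.zero_apply, inner_zero_right, zero_mul]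
    refine ⟨(integrable_zero _ _ _).congr h, ?_⟩
    rw [← integral_congr_ae h, integral_zero]
  smul_mem' := by
    rintro a f ⟨hf, hf'⟩
    refine ⟨Submodule.smul_mem _ a hf, fun v hv => ?_⟩
    obtain ⟨h1, h2⟩ := hf' v hv
    have h : (fun x => a * (inner ℝ (m x) (f x) * v x))
        =ᵐ[volume.restrict Ω] fun x => inner ℝ (m x) ((a • f : L2 Ω) x) * v x := by
      filter_upwards [Lp.coeFn_smul a f] with x hx
      rw [hx, Pi.smul_apply, inner_smul_right, mul_assoc]
    refine ⟨(h1.const_mul a).congr h, ?_⟩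
    rw [← integral_congr_ae h, integral_const_mul, h2, mul_zero]

theorem finite_elements (𝒯 : Triangulation Ω) : Finite 𝒯.elements :=
  (𝒯.finite_faces.subset fun _ h => h.1).to_subtype

theorem exists_mem_tet (𝒯 : Triangulation Ω) {x : E3} (hx : x ∈ closure Ω) :
    ∃ t : 𝒯.elements, x ∈ tet t := by
  rw [← 𝒯.space_eq, Geometry.SimplicialComplex.mem_space_iff] at hx
  obtain ⟨s, hs, hxs⟩ := hx
  obtain ⟨t, ht, hst, hc⟩ := 𝒯.pure s hs
  exact ⟨⟨t, ht, hc⟩, convexHull_mono (by exact_mod_cast hst) hxs⟩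

open Classical in
/-- Evaluation of a family of polynomials, one for each tetrahedron and each component. -/
def evalPieces (𝒯 : Triangulation Ω) (r : ℕ) :
    (Fin 3 → 𝒯.elements → MvPolynomial.restrictTotalDegree (Fin 3) ℝ r) →ₗ[ℝ]
      (E3 → Fin 3 → ℝ) where
  toFun P x i := if hx : x ∈ closure Ω then
    MvPolynomial.eval (fun j => x j) (P i (exists_mem_tet 𝒯 hx).choose : MvPolynomial (Fin 3) ℝ)
    else 0
  map_add' P Q := by
    ext x i
    by_cases hx : x ∈ closure Ω <;> simp [hx]
  map_smul' a P := by
    ext x i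
    by_cases hx : x ∈ closure Ω <;> simp [hx]

instance finiteDimensional_feSpace3 (𝒯 : Triangulation Ω) (r : ℕ) :
    FiniteDimensional ℝ (feSpace3 𝒯 r) := by
  have := finite_elements 𝒯
  let A := Fin 3 → 𝒯.elements → MvPolynomial.restrictTotalDegree (Fin 3) ℝ r
  let G : Submodule ℝ (A × L2 Ω) :=
    { carrier := {z | ∀ᵐ x ∂(volume.restrict Ω), ∀ i, z.2 x i = evalPieces 𝒯 r z.1 x i}
      add_mem' := by
        intro y z hy hz
        filter_upwards [hy, hz, Lp.coeFn_add y.2 z.2] with x h1 h2 h3 i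
        rw [Prod.snd_add, h3, Pi.add_apply, PiLp.add_apply, h1 i, h2 i, Prod.fst_add, map_add]
        rfl
      zero_mem' := by
        filter_upwards [Lp.coeFn_zero E3 2 (volume.restrict Ω)] with x h i
        rw [Prod.snd_zero, h, Prod.fst_zero, map_zero]
        rfl
      smul_mem' := by
        intro a z hz
        filter_upwards [hz, Lp.coeFn_smul a z.2] with x h1 h2 i
        simp [h2, h1 i] }
  have hG : FiniteDimensional ℝ G := by
    refine FiniteDimensional.of_injective ((LinearMap.fst ℝ A (L2 Ω)).comp G.subtype) ?_
    rintro ⟨⟨a, f⟩, hf⟩ ⟨⟨b, g⟩, hg⟩ hab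
    have hab' : a = b := hab
    subst hab'
    have : f = g := by
      apply Lp.ext
      filter_upwards [hf, hg] with x h1 h2
      ext i
      exact (h1 i).trans (h2 i).symm
    subst this
    rfl
  have hle : feSpace3 𝒯 r ≤ G.map (LinearMap.snd ℝ A (L2 Ω)) := by
    intro f hf
    choose v hv hfv using hf
    choose P hP hPv using fun i (t : 𝒯.elements) => (hv i).2 t t.2
    let Q : A := fun i t => ⟨P i t, (MvPolynomial.mem_restrictTotalDegree _ _ _).2 (hP i t)⟩
    have h0 : ∀ᵐ x ∂(volume.restrict Ω), x ∈ closure Ω :=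
      (ae_mono (Measure.restrict_mono subset_closure le_rfl))
        (ae_restrict_mem isClosed_closure.measurableSet)
    refine ⟨(Q, f), ?_, rfl⟩
    change ∀ᵐ x ∂(volume.restrict Ω), ∀ i, f x i = evalPieces 𝒯 r Q x i
    filter_upwards [h0, ae_all_iff.2 hfv] with x hx h i
    rw [h i, hPv i _ x (exists_mem_tet 𝒯 hx).choose_spec]
    simp [evalPieces, hx, Q]
  have hfin : FiniteDimensional ℝ (G.map (LinearMap.snd ℝ A (L2 Ω))) := inferInstance
  exact Submodule.finiteDimensional_of_le hle

instance finiteDimensional_tangentSpace (𝒯 : Triangulation Ω) (r : ℕ) (m : E3 → E3) :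
    FiniteDimensional ℝ (tangentSpace 𝒯 r m) :=
  Submodule.finiteDimensional_of_le (S₂ := feSpace3 𝒯 r) fun _ h => h.1

/-- The `L²(Ω)`-orthogonal projection `P_h(m) : V_h³ → T_h(m)` (here extended to `L²(Ω)³`). -/
def tangentProj (𝒯 : Triangulation Ω) (r : ℕ) (m : E3 → E3) : L2 Ω →L[ℝ] L2 Ω :=
  (tangentSpace 𝒯 r m).starProjection

end FEM

end

/-!
The proof bounds every operator that occurs by one fixed averaging operator, so that all exponents
`p ∈ [1, ∞]` are treated at once. This is `avgOp`, the integral operator on `Ω` with kernel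
`h⁻³ (1 + |x - y| / h)⁻⁴`; the kernel is integrable over `ℝ³` uniformly in `h`, and by Schur's test
(`eLpNorm_avgOp_le`) the operator is bounded in every `L^p` by a constant independent of `p`, `h`
and `Ω`. Throughout, `𝒯.IsUniform K h` encodes shape regularity and quasi-uniformity in one
constant `K`.

Finite element functions are expanded in the Bernstein basis, the monomials in the hat functions
(`exists_coeff_of_mem_feSpace`). The coefficients on one tetrahedron are bounded by local means of
the function, by equivalence of norms on a reference simplex (`volume_mul_enorm_coeff_le`). This
gives the inverse estimate (`enorm_fderiv_feFun_le`) and uniform two-sided bounds of the mass matrix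
in units of `h³`. An energy argument with slowly varying weights (`abs_le_of_mulVec_eq_single`) then
shows that the entries of the inverse mass matrix decay like the kernel above
(`exists_abs_inv_massMatrix_le`), whence the `L²` projection `Π` onto the finite element space is
bounded pointwise by the averaging operator (`exists_enorm_feFun_proj_le`).

The field `m` is compared with its mean values over the tetrahedra. On a single tetrahedron this is
the Poincaré inequality on a convex set. The means over two tetrahedra with a common vertex are
compared along a chain of tetrahedra around the vertex in which successive ones share a face
(`reflTransGen_of_vertex`, `average_sub_average_le_of_vertex`); such a chain exists because `Ω` is
locally connected at its boundary. Hence the product of `m` with a finite element function differs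
from its projection only by `O(h ‖∇m‖_∞)` (`exists_product_estimates`). The same comparison of means
produces a quasi-interpolant, and with it the stability of `Π` in `W^{1,p}`
(`exists_eLpNorm_fderiv_proj_le`), which works on a general domain since no extension operator or
trace is involved.

The tangential projection is `P_h(m) v = v - Π (l m)`, where the scalar multiplier `l` solves
`Π (m · Π (l m)) = Π (m · v)` (`tangentProj_eq`). As `m · m = 1`, the operator on the left is the
identity up to `O(h ‖∇m‖_∞)` in every `L^p` (`exists_eLpNorm_sub_schur_le`). For small `h` it is
therefore invertible with a bounded inverse, and together with the product estimates and the inverse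
estimate this proves the bounds for `s = 0` and `s = 1`, with a constant proportional to
`1 + ‖∇m‖_∞ = ‖m‖_{W^{1,∞}}` (`exists_tangentProj_estimates`). The case `s = -1` follows from
`s = 1` for the conjugate exponent, because the projection is self-adjoint and `Π` is bounded in
`W^{1,q}` (`exists_normW_tangentProj_le`). The first power of the norm of `m` is enough; it is at
most the square since the norm is at least `1`. -/

noncomputable section

namespace FEM

/-! ### Averaging operators -/

/-- Schur's test: an integral operator whose kernel has row and column integrals at most `A` is
bounded by `A` in every `L^p`. -/
theorem eLpNorm_lintegral_mul_le {α β : Type*} [MeasurableSpace α] [MeasurableSpace β]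
    {μ : Measure α} {ν : Measure β} [SFinite μ] [SFinite ν] {k : α → β → ℝ≥0∞}
    (hk : Measurable (Function.uncurry k)) {A : ℝ≥0∞}
    (h₁ : ∀ x, ∫⁻ y, k x y ∂ν ≤ A) (h₂ : ∀ y, ∫⁻ x, k x y ∂μ ≤ A)
    {p : ℝ≥0∞} (hp : 1 ≤ p) {f : β → ℝ≥0∞} (hf : AEMeasurable f ν) :
    eLpNorm (fun x => ∫⁻ y, k x y * f y ∂ν) p μ ≤ A * eLpNorm f p ν := by
  have hkx : ∀ x, Measurable (k x) := fun x => hk.comp measurable_prodMk_left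
  rcases eq_or_ne p ⊤ with rfl | hp'
  · rw [eLpNorm_exponent_top, eLpNorm_exponent_top]
    refine eLpNormEssSup_le_of_ae_enorm_bound (Filter.Eventually.of_forall fun x => ?_)
    rw [enorm_eq_self]
    calc ∫⁻ y, k x y * f y ∂ν ≤ ∫⁻ y, k x y * eLpNormEssSup f ν ∂ν := by
          refine lintegral_mono_ae ?_
          filter_upwards [ae_le_eLpNormEssSup (f := f) (μ := ν)] with y hy
          gcongr
          simpa using hy
      _ = (∫⁻ y, k x y ∂ν) * eLpNormEssSup f ν := lintegral_mul_const _ (hkx x)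
      _ ≤ A * eLpNormEssSup f ν := by gcongr; exact h₁ x
  have hp0 : p ≠ 0 := (zero_lt_one.trans_le hp).ne'
  set P := p.toReal with hP
  have hP1 : 1 ≤ P := by
    rw [hP, ← ENNReal.toReal_one]; exact ENNReal.toReal_mono hp' hp
  have hP0 : 0 < P := by linarith
  have key : ∀ x, (∫⁻ y, k x y * f y ∂ν) ^ P ≤ A ^ (P - 1) * ∫⁻ y, k x y * f y ^ P ∂ν := by
    intro x
    -- Jensen's inequality for the measure with density `k x`, whose mass is at most `A`
    set νx := ν.withDensity (k x)
    have hfx : AEMeasurable f νx := hf.mono_ac (withDensity_absolutelyContinuous _ _)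
    have e1 : ∫⁻ y, k x y * f y ∂ν = ∫⁻ y, f y ∂νx :=
      (lintegral_withDensity_eq_lintegral_mul₀ (hkx x).aemeasurable hf).symm
    have e2 : ∫⁻ y, k x y * f y ^ P ∂ν = ∫⁻ y, f y ^ P ∂νx :=
      (lintegral_withDensity_eq_lintegral_mul₀ (hkx x).aemeasurable (hf.pow_const P)).symm
    have e3 : νx Set.univ ≤ A := by
      rw [withDensity_apply _ MeasurableSet.univ, Measure.restrict_univ]
      exact h₁ x
    have := eLpNorm_le_eLpNorm_mul_rpow_measure_univ hp hfx.aestronglyMeasurable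
    rw [eLpNorm_one_eq_lintegral_enorm, eLpNorm_eq_lintegral_rpow_enorm_toReal hp0 hp'] at this
    simp only [enorm_eq_self, ENNReal.toReal_one, ← hP] at this
    rw [e1, e2]
    calc (∫⁻ y, f y ∂νx) ^ P
        ≤ ((∫⁻ y, f y ^ P ∂νx) ^ (1 / P) * νx Set.univ ^ (1 / 1 - 1 / P)) ^ P := by gcongr
      _ = νx Set.univ ^ (P - 1) * ∫⁻ y, f y ^ P ∂νx := by
          rw [ENNReal.mul_rpow_of_nonneg _ _ hP0.le, ← ENNReal.rpow_mul, ← ENNReal.rpow_mul,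
            one_div_mul_cancel hP0.ne', ENNReal.rpow_one, mul_comm]
          congr 2
          field_simp
      _ ≤ _ := by
          gcongr
  rw [eLpNorm_eq_lintegral_rpow_enorm_toReal hp0 hp',
    eLpNorm_eq_lintegral_rpow_enorm_toReal hp0 hp']
  simp only [enorm_eq_self, ← hP]
  have main : ∫⁻ x, (∫⁻ y, k x y * f y ∂ν) ^ P ∂μ ≤ A ^ P * ∫⁻ y, f y ^ P ∂ν := by
    calc ∫⁻ x, (∫⁻ y, k x y * f y ∂ν) ^ P ∂μ
        ≤ ∫⁻ x, A ^ (P - 1) * ∫⁻ y, k x y * f y ^ P ∂ν ∂μ := lintegral_mono key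
      _ = A ^ (P - 1) * ∫⁻ x, ∫⁻ y, k x y * f y ^ P ∂ν ∂μ := by
          refine lintegral_const_mul'' _ ?_
          refine AEMeasurable.lintegral_prod_right' (f := fun z : α × β => k z.1 z.2 * f z.2 ^ P) ?_
          refine hk.aemeasurable.mul ?_
          exact (hf.pow_const P).comp_quasiMeasurePreserving
            Measure.quasiMeasurePreserving_snd
      _ = A ^ (P - 1) * ∫⁻ y, ∫⁻ x, k x y * f y ^ P ∂μ ∂ν := by
          rw [lintegral_lintegral_swap]
          refine hk.aemeasurable.mul ?_
          exact (hf.pow_const P).comp_quasiMeasurePreserving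
            Measure.quasiMeasurePreserving_snd
      _ ≤ A ^ (P - 1) * ∫⁻ y, A * f y ^ P ∂ν := by
          gcongr with y
          have hky : Measurable fun x => k x y := hk.comp measurable_prodMk_right
          rw [lintegral_mul_const _ hky]
          gcongr
          exact h₂ y
      _ = A ^ P * ∫⁻ y, f y ^ P ∂ν := by
          rw [lintegral_const_mul'' _ (hf.pow_const P), ← mul_assoc]
          congr 1
          nth_rw 2 [← ENNReal.rpow_one A]
          rw [← ENNReal.rpow_add_of_nonneg _ _ (by linarith) zero_le_one, sub_add_cancel]
  calc (∫⁻ x, (∫⁻ y, k x y * f y ∂ν) ^ P ∂μ) ^ (1 / P)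
      ≤ (A ^ P * ∫⁻ y, f y ^ P ∂ν) ^ (1 / P) := by gcongr
    _ = A * (∫⁻ y, f y ^ P ∂ν) ^ (1 / P) := by
        rw [ENNReal.mul_rpow_of_nonneg _ _ (by positivity), ← ENNReal.rpow_mul,
          mul_one_div_cancel hP0.ne', ENNReal.rpow_one]

/-- The kernel `z ↦ h⁻³ (1 + |z| / h)⁻⁴`, which is integrable over `ℝ³` uniformly in `h`. -/
def decayKernel (h : ℝ) (z : E3) : ℝ≥0∞ := ENNReal.ofReal ((h⁻¹) ^ 3 * ((1 + ‖z‖ / h) ^ 4)⁻¹)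

/-- The integral of `(1 + |z|)⁻⁴` over `ℝ³`. -/
def decayMass : ℝ≥0∞ := ∫⁻ z : E3, ENNReal.ofReal ((1 + ‖z‖) ^ (-4 : ℝ))

theorem decayMass_lt_top : decayMass < ⊤ :=
  finite_integral_one_add_norm (by norm_num [finrank_euclideanSpace])

theorem measurable_decayKernel (h : ℝ) : Measurable (decayKernel h) := by
  unfold decayKernel; fun_prop

theorem lintegral_decayKernel {h : ℝ} (hh : 0 < h) : ∫⁻ z, decayKernel h z = decayMass := by
  have e : ∀ z, decayKernel h z =
      ENNReal.ofReal ((h⁻¹) ^ 3) * ENNReal.ofReal ((1 + ‖h⁻¹ • z‖) ^ (-4 : ℝ)) := by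
    intro z
    rw [decayKernel, ← ENNReal.ofReal_mul (by positivity), norm_smul, Real.norm_of_nonneg
      (by positivity), Real.rpow_neg (by positivity), inv_mul_eq_div]
    norm_cast
  simp_rw [e]
  have hm : Measurable fun z : E3 => ENNReal.ofReal ((1 + ‖z‖) ^ (-4 : ℝ)) := by fun_prop
  have hm' : Measurable fun z : E3 => ENNReal.ofReal ((1 + ‖h⁻¹ • z‖) ^ (-4 : ℝ)) := by fun_prop
  rw [lintegral_const_mul _ hm', decayMass]
  have := lintegral_map (μ := (volume : Measure E3)) hm (measurable_const_smul h⁻¹)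
  rw [← this, Measure.map_addHaar_smul _ (inv_ne_zero hh.ne'), lintegral_smul_measure,
    smul_eq_mul, ← mul_assoc, ← ENNReal.ofReal_mul (by positivity)]
  rw [finrank_euclideanSpace, Fintype.card_fin, abs_of_nonneg (by positivity),
    mul_inv_cancel₀ (by positivity), ENNReal.ofReal_one, one_mul]

/-- The averaging operator with kernel `decayKernel h (x - y)` over `Ω`. Pointwise bounds by this
operator give `L^p` bounds for all `p` at once. -/
def avgOp (Ω : Set E3) (h : ℝ) (f : E3 → ℝ≥0∞) (x : E3) : ℝ≥0∞ :=
  ∫⁻ y in Ω, decayKernel h (x - y) * f y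

theorem eLpNorm_avgOp_le {Ω : Set E3} {h : ℝ} (hh : 0 < h) {p : ℝ≥0∞} (hp : 1 ≤ p)
    {f : E3 → ℝ≥0∞} (hf : AEMeasurable f (volume.restrict Ω)) :
    eLpNorm (avgOp Ω h f) p (volume.restrict Ω) ≤
      decayMass * eLpNorm f p (volume.restrict Ω) := by
  refine eLpNorm_lintegral_mul_le (k := fun x y => decayKernel h (x - y))
    ((measurable_decayKernel h).comp measurable_sub) (fun x => ?_) (fun y => ?_) hp hf
  · refine (setLIntegral_le_lintegral _ _).trans ?_
    rw [lintegral_sub_left_eq_self (fun z => decayKernel h z) x, lintegral_decayKernel hh]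
  · refine (setLIntegral_le_lintegral _ _).trans ?_
    rw [lintegral_sub_right_eq_self (fun z => decayKernel h z) y, lintegral_decayKernel hh]

/-! ### Gluing Lipschitz maps -/

/-- A continuous map is `L`-Lipschitz if the space is covered by finitely many closed sets on each
of which it is `L`-Lipschitz. -/
theorem lipschitzOnWith_of_finite_closed_cover {E F ι : Type*} [NormedAddCommGroup E]
    [NormedSpace ℝ E] [NormedAddCommGroup F] [Finite ι] {f : E → F} {s : Set E} {T : ι → Set E}
    {L : ℝ≥0} (hs : Convex ℝ s) (hf : ContinuousOn f s) (hT : ∀ i, IsClosed (T i))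
    (hsT : s ⊆ ⋃ i, T i) (hL : ∀ i, LipschitzOnWith L f (T i ∩ s)) : LipschitzOnWith L f s := by
  rw [lipschitzOnWith_iff_norm_sub_le]
  intro y hy x hx
  set c : ℝ → E := fun t => x + t • (y - x) with hc
  have hcc : Continuous c := by fun_prop
  have hcs : ∀ t ∈ Set.Icc (0 : ℝ) 1, c t ∈ s := by
    intro t ht
    have := hs hx hy (sub_nonneg.2 ht.2) ht.1 (by ring)
    convert this using 1
    simp only [hc, smul_sub, sub_smul, one_smul]; abel
  have hcd : ∀ t t', ‖c t - c t'‖ = |t - t'| * ‖y - x‖ := by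
    intro t t'
    rw [← Real.norm_eq_abs, ← norm_smul]; congr 1
    simp only [hc, sub_smul]; abel
  set S : Set ℝ := {t | ‖f (c t) - f x‖ ≤ L * ‖y - x‖ * t} with hS
  have hfc : ContinuousOn (fun t => f (c t)) (Set.Icc 0 1) :=
    hf.comp hcc.continuousOn hcs
  have hclosed : IsClosed (S ∩ Set.Icc 0 1) := by
    have : S ∩ Set.Icc 0 1 = {t ∈ Set.Icc (0 : ℝ) 1 | ‖f (c t) - f x‖ ≤ L * ‖y - x‖ * t} := by
      ext t; simp only [hS, Set.mem_inter_iff, Set.mem_ofPred_eq]; tauto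
    rw [this]
    exact isClosed_Icc.isClosed_le (hfc.sub continuousOn_const).norm (by fun_prop)
  have h0 : (0 : ℝ) ∈ S := by simp [hS, hc]
  -- continuous induction along the segment
  have hgt : ∀ t ∈ S ∩ Set.Ico (0 : ℝ) 1, ∀ u ∈ Set.Ioi t, (S ∩ Set.Ioc t u).Nonempty := by
    rintro t ⟨htS, ht⟩ u hu
    -- one of the closed sets contains points of the segment that tend to `c t` from the right
    have hfreq : ∃ i, ∃ᶠ t' in 𝓝[>] t, c t' ∈ T i := by
      by_contra! hcon
      have : ∀ᶠ t' in 𝓝[>] t, ∀ i, c t' ∉ T i := by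
        rw [Filter.eventually_all]; exact fun i => by simpa using hcon i
      have h2 : ∀ᶠ t' in 𝓝[>] t, t' ∈ Set.Ioo t 1 := Ioo_mem_nhdsGT ht.2
      obtain ⟨t', h3, h4⟩ := (this.and h2).exists
      obtain ⟨i, hi⟩ := Set.mem_iUnion.1 (hsT (hcs t' ⟨ht.1.trans h4.1.le, h4.2.le⟩))
      exact h3 i hi
    obtain ⟨i, hi⟩ := hfreq
    have hti : c t ∈ T i := by
      refine (hT i).mem_of_frequently_of_tendsto hi ?_
      exact (hcc.tendsto t).mono_left nhdsWithin_le_nhds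
    have h2 : ∀ᶠ t' in 𝓝[>] t, t' ∈ Set.Ioo t (min u 1) := Ioo_mem_nhdsGT (lt_min hu ht.2)
    obtain ⟨t', h3, h4⟩ := (hi.and_eventually h2).exists
    have ht'1 : t' < 1 := h4.2.trans_le (min_le_right _ _)
    refine ⟨t', ?_, h4.1, (h4.2.trans_le (min_le_left _ _)).le⟩
    have h5 := (lipschitzOnWith_iff_norm_sub_le.1 (hL i))
      ⟨h3, hcs t' ⟨ht.1.trans h4.1.le, ht'1.le⟩⟩ ⟨hti, hcs t ⟨ht.1, ht.2.le⟩⟩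
    rw [hcd, abs_of_pos (sub_pos.2 h4.1)] at h5
    have htS' : ‖f (c t) - f x‖ ≤ L * ‖y - x‖ * t := htS
    change ‖f (c t') - f x‖ ≤ L * ‖y - x‖ * t'
    calc ‖f (c t') - f x‖ ≤ ‖f (c t') - f (c t)‖ + ‖f (c t) - f x‖ :=
          norm_sub_le_norm_sub_add_norm_sub _ _ _
      _ ≤ _ := by linarith
  have h1 := hclosed.Icc_subset_of_forall_exists_gt h0 hgt (Set.right_mem_Icc.2 zero_le_one)
  have h1' : ‖f (c 1) - f x‖ ≤ L * ‖y - x‖ * 1 := h1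
  simpa [hc] using h1'

/-! ### Decay of inverse matrices -/

/-- Decay of the inverse of a symmetric positive definite matrix with nonnegative entries, by the
energy method: conjugation with a weight `wt` that varies slowly along the nonzero entries
perturbs the quadratic form only slightly. -/
theorem abs_le_of_mulVec_eq_single {ι : Type*} [Fintype ι] [DecidableEq ι] {M : Matrix ι ι ℝ}
    (hsymm : ∀ i j, M i j = M j i) (hnn : ∀ i j, 0 ≤ M i j) {a b θ : ℝ} (ha : 0 < a)
    (hlow : ∀ c : ι → ℝ, a * ∑ i, c i ^ 2 ≤ ∑ i, ∑ j, M i j * c i * c j)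
    (hup : ∀ c : ι → ℝ, ∑ i, ∑ j, M i j * c i * c j ≤ b * ∑ i, c i ^ 2)
    (hθ : θ * b ≤ a) (hθ0 : 0 ≤ θ) {wt : ι → ℝ} (hwt : ∀ i, 0 < wt i)
    (hvar : ∀ i j, M i j ≠ 0 → (wt i - wt j) ^ 2 ≤ θ * (wt i * wt j))
    {i₀ : ι} (hi₀ : wt i₀ = 1) {c : ι → ℝ} (hc : M.mulVec c = Pi.single i₀ 1) (i : ι) :
    |c i| ≤ 2 / (a * wt i) := by
  set Q := ∑ i, (wt i * c i) ^ 2 with hQ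
  -- the conjugated form is `⟨wt² c, M c⟩` up to a commutator, quadratic in differences of weights
  have h1 : ∑ i, ∑ j, M i j * (wt i * c i) * (wt j * c j) =
      ∑ i, wt i ^ 2 * c i * (M.mulVec c) i +
        -(∑ i, ∑ j, M i j * (wt i - wt j) ^ 2 * c i * c j) / 2 := by
    have e1 : ∑ i, wt i ^ 2 * c i * (M.mulVec c) i = ∑ i, ∑ j, M i j * wt i ^ 2 * c i * c j := by
      refine Finset.sum_congr rfl fun i _ => ?_
      rw [Matrix.mulVec, dotProduct, Finset.mul_sum]
      exact Finset.sum_congr rfl fun j _ => by ring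
    have e2 : ∑ i, ∑ j, M i j * wt i ^ 2 * c i * c j = ∑ i, ∑ j, M i j * wt j ^ 2 * c i * c j := by
      rw [Finset.sum_comm]
      refine Finset.sum_congr rfl fun i _ => Finset.sum_congr rfl fun j _ => ?_
      rw [hsymm j i]; ring
    have e3 : ∑ i, ∑ j, M i j * (wt i - wt j) ^ 2 * c i * c j =
        ∑ i, ∑ j, M i j * wt i ^ 2 * c i * c j + ∑ i, ∑ j, M i j * wt j ^ 2 * c i * c j
          - 2 * ∑ i, ∑ j, M i j * (wt i * c i) * (wt j * c j) := by
      simp only [Finset.mul_sum, ← Finset.sum_add_distrib, ← Finset.sum_sub_distrib]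
      exact Finset.sum_congr rfl fun i _ => Finset.sum_congr rfl fun j _ => by ring
    rw [e1, e3, ← e2]; ring
  have h2 : -(∑ i, ∑ j, M i j * (wt i - wt j) ^ 2 * c i * c j) ≤ θ * (b * Q) := by
    calc -(∑ i, ∑ j, M i j * (wt i - wt j) ^ 2 * c i * c j)
        ≤ ∑ i, ∑ j, θ * (M i j * |wt i * c i| * |wt j * c j|) := by
          simp only [← Finset.sum_neg_distrib]
          refine Finset.sum_le_sum fun i _ => Finset.sum_le_sum fun j _ => ?_
          rcases eq_or_ne (M i j) 0 with h0 | h0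
          · simp [h0]
          have := hvar i j h0
          calc -(M i j * (wt i - wt j) ^ 2 * c i * c j) ≤ |M i j * (wt i - wt j) ^ 2 * c i * c j| :=
                neg_le_abs _
            _ = M i j * (wt i - wt j) ^ 2 * (|c i| * |c j|) := by
                rw [abs_mul, abs_mul, abs_of_nonneg (mul_nonneg (hnn i j) (sq_nonneg _))]; ring
            _ ≤ M i j * (θ * (wt i * wt j)) * (|c i| * |c j|) := by
                have := hnn i j
                gcongr
            _ = _ := by rw [abs_mul, abs_mul, abs_of_pos (hwt i), abs_of_pos (hwt j)]; ring
      _ = θ * ∑ i, ∑ j, M i j * |wt i * c i| * |wt j * c j| := by simp only [Finset.mul_sum]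
      _ ≤ θ * (b * ∑ i, |wt i * c i| ^ 2) := by
          gcongr
          exact hup fun i => |wt i * c i|
      _ = θ * (b * Q) := by simp only [sq_abs, hQ]
  have h3 : ∑ i, wt i ^ 2 * c i * (M.mulVec c) i = wt i₀ * c i₀ := by
    rw [hc]
    simp [Pi.single_apply, hi₀]
  have hQ0 : 0 ≤ Q := Finset.sum_nonneg fun i _ => sq_nonneg _
  have h4 : a * Q ≤ wt i₀ * c i₀ + a * Q / 2 := by
    have := hlow fun i => wt i * c i
    have h5 : θ * (b * Q) ≤ a * Q := by rw [← mul_assoc]; gcongr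
    linarith
  have hle : ∀ i, |wt i * c i| ≤ √Q := fun i => by
    rw [← Real.sqrt_sq_eq_abs]
    exact Real.sqrt_le_sqrt
      (Finset.single_le_sum (f := fun i => (wt i * c i) ^ 2) (fun i _ => sq_nonneg _)
        (Finset.mem_univ i))
  have h5 : a * Q ≤ 2 * √Q := by
    have := (le_abs_self _).trans (hle i₀)
    linarith
  have h6 : a * √Q ≤ 2 := by
    rcases (Real.sqrt_nonneg Q).eq_or_lt with h0 | h0
    · rw [← h0]; norm_num
    · rw [← Real.sq_sqrt hQ0] at h5
      have : √(√Q ^ 2) = √Q := Real.sqrt_sq h0.le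
      rw [this] at h5
      nlinarith
  have h7 := hle i
  rw [abs_mul, abs_of_pos (hwt i)] at h7
  rw [le_div_iff₀ (mul_pos ha (hwt i))]
  nlinarith [hwt i, abs_nonneg (c i)]

/-! ### Poincaré inequalities on convex sets -/

section Translation

variable {U : Set E3} {w : E3 → E3} {g : E3 → E3 →L[ℝ] E3}

/-- Integrated form of the weak derivative: increments of `w` along segments in a convex set. -/
theorem ae_sub_eq_integral_of_weak (hU : IsOpen U) (hUc : Convex ℝ U) (hw : Integrable w)
    (hg : Integrable g) (hgm : StronglyMeasurable g)
    (hweak : ∀ φ : E3 → ℝ, ContDiff ℝ ∞ φ → HasCompactSupport φ → tsupport φ ⊆ U → ∀ e : E3,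
      ∫ x, fderiv ℝ φ x e • w x = -∫ x, φ x • g x e) (v : E3) :
    ∀ᵐ x, x ∈ U → x + v ∈ U →
      w (x + v) - w x = ∫ t in Set.Icc (0 : ℝ) 1, g (x + t • v) v := by
  set ν : Measure ℝ := volume.restrict (Set.Icc (0 : ℝ) 1) with hν
  have : IsFiniteMeasure ν := ⟨by simp [hν]⟩
  have hgv : Integrable fun x => g x v := hg.apply_continuousLinearMap v
  have hprod : Integrable (fun z : E3 × ℝ => g (z.1 + z.2 • v) v) (volume.prod ν) := by
    have hm : AEStronglyMeasurable (fun z : E3 × ℝ => g (z.1 + z.2 • v) v) (volume.prod ν) := by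
      have h1 : StronglyMeasurable fun z : E3 × ℝ => g (z.1 + z.2 • v) :=
        hgm.comp_measurable (by fun_prop)
      exact ((ContinuousLinearMap.apply ℝ E3 v).continuous.comp_stronglyMeasurable
        h1).aestronglyMeasurable
    rw [integrable_prod_iff' hm]
    refine ⟨Filter.Eventually.of_forall fun t => hgv.comp_add_right (t • v), ?_⟩
    have : (fun t : ℝ => ∫ x, ‖g (x + t • v) v‖) = fun _ => ∫ x, ‖g x v‖ := by
      ext t
      exact integral_add_right_eq_self (fun x => ‖g x v‖) (t • v)
    simp only [this]
    exact integrable_const _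
  -- `f` vanishes, because it integrates to zero against all test functions
  set f : E3 → E3 := fun x => w (x + v) - w x - ∫ t, g (x + t • v) v ∂ν with hf
  have hwv : Integrable fun x => w (x + v) := hw.comp_add_right v
  have hI : Integrable fun x => ∫ t, g (x + t • v) v ∂ν := hprod.integral_prod_left
  have hfi : Integrable f := (hwv.sub hw).sub hI
  have hUv : IsOpen (U ∩ (fun x => x + v) ⁻¹' U) := hU.inter (hU.preimage (by fun_prop))
  have key := hUv.ae_eq_zero_of_integral_contDiff_smul_eq_zero
    (μ := volume) (hfi.locallyIntegrable.locallyIntegrableOn _) ?_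
  · filter_upwards [key] with x hx h1 h2
    exact sub_eq_zero.1 (hx ⟨h1, h2⟩)
  intro φ hφ hφc hφs
  obtain ⟨Cφ, hCφ⟩ := hφc.exists_bound_of_continuous hφ.continuous
  have hsm : ∀ {E : Type} [NormedAddCommGroup E] [NormedSpace ℝ E] {u : E3 → E}
      {ψ : E3 → ℝ} {C : ℝ}, Continuous ψ → (∀ x, ‖ψ x‖ ≤ C) → Integrable u →
      Integrable fun x => ψ x • u x := fun hψ hC hu =>
    hu.bdd_smul _ hψ.aestronglyMeasurable (Filter.Eventually.of_forall hC)
  have e0 : ∫ x, φ x • f x = (∫ x, φ x • w (x + v)) - (∫ x, φ x • w x)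
      - ∫ x, φ x • ∫ t, g (x + t • v) v ∂ν := by
    rw [← integral_sub, ← integral_sub]
    · simp only [hf, smul_sub]
    · exact (hsm hφ.continuous hCφ hwv).sub (hsm hφ.continuous hCφ hw)
    · exact hsm hφ.continuous hCφ hI
    · exact hsm hφ.continuous hCφ hwv
    · exact hsm hφ.continuous hCφ hw
  have e1 : ∫ x, φ x • w (x + v) = ∫ x, φ (x - v) • w x := by
    rw [← integral_add_right_eq_self (fun x => φ (x - v) • w x) v]
    simp
  have e2 : ∫ x, φ x • ∫ t, g (x + t • v) v ∂ν = ∫ t, (∫ x, φ x • g (x + t • v) v) ∂ν := by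
    simp_rw [← integral_smul]
    rw [integral_integral_swap]
    exact hprod.bdd_smul Cφ (hφ.continuous.comp continuous_fst).aestronglyMeasurable
      (Filter.Eventually.of_forall fun z => hCφ z.1)
  have hDφ : Continuous fun x => fderiv ℝ φ x v :=
    (hφ.continuous_fderiv (by simp)).clm_apply continuous_const
  obtain ⟨Dφ, hDφb⟩ : ∃ C, ∀ x, ‖fderiv ℝ φ x v‖ ≤ C :=
    (hφc.fderiv_apply ℝ v).exists_bound_of_continuous hDφ
  have e3 : ∀ᵐ t ∂ν, ∫ x, φ x • g (x + t • v) v = -∫ x, fderiv ℝ φ (x - t • v) v • w x := by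
    filter_upwards [ae_restrict_mem measurableSet_Icc] with t ht
    rw [← integral_add_right_eq_self (fun x => fderiv ℝ φ (x - t • v) v • w x) (t • v)]
    have h1 := hweak (fun x => φ (x - t • v)) (hφ.comp (contDiff_id.sub contDiff_const))
      (hφc.comp_homeomorph (Homeomorph.subRight (t • v))) ?_ v
    · have h2 : ∀ x, fderiv ℝ (fun x => φ (x - t • v)) x = fderiv ℝ φ (x - t • v) :=
        fun x => by simpa [sub_eq_add_neg] using fderiv_comp_add_right (f := φ) (x := x) (-(t • v))
      simp only [h2] at h1
      rw [← integral_add_right_eq_self (fun x => φ (x - t • v) • g x v) (t • v),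
        ← integral_add_right_eq_self (fun x => fderiv ℝ φ (x - t • v) v • w x) (t • v)] at h1
      rw [h1, neg_neg]
      simp
    · have h2 : tsupport (fun x => φ (x - t • v)) = (fun x => x - t • v) ⁻¹' tsupport φ :=
        tsupport_comp_eq_preimage φ (Homeomorph.subRight (t • v))
      rw [h2]
      intro x hx
      -- the translated test function is supported in `U` by convexity
      have h3 := hφs hx
      have h4 := hUc h3.1 h3.2 (sub_nonneg.2 ht.2) ht.1 (by ring)
      convert h4 using 1
      module
  have e4 : ∫ t, (-∫ x, fderiv ℝ φ (x - t • v) v • w x) ∂ν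
      = -∫ x, (φ x - φ (x - v)) • w x := by
    rw [integral_neg, integral_integral_swap]
    · congr 2 with x : 1
      rw [integral_smul_const]
      congr 1
      have h1 : ∀ t ∈ Set.uIcc (0 : ℝ) 1,
          HasDerivAt (fun t : ℝ => -φ (x - t • v)) (fderiv ℝ φ (x - t • v) v) t := by
        intro t _
        have h2 : HasDerivAt (fun t : ℝ => x - t • v) (-v) t := by
          simpa using ((hasDerivAt_id t).smul_const v).const_sub x
        have h3 := ((hφ.differentiable (by simp)) (x - t • v)).hasFDerivAt.comp_hasDerivAt t h2
        have h4 := h3.neg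
        simp only [map_neg, neg_neg] at h4
        exact h4
      have h2 := intervalIntegral.integral_eq_sub_of_hasDerivAt h1
        ((hDφ.comp (by fun_prop : Continuous fun t : ℝ => x - t • v)).intervalIntegrable 0 1)
      rw [intervalIntegral.integral_of_le zero_le_one, ← integral_Icc_eq_integral_Ioc] at h2
      rw [hν, h2]
      simp; ring
    · have h1 : Integrable (fun z : ℝ × E3 => w z.2) (ν.prod volume) := hw.comp_snd ν
      refine h1.bdd_smul Dφ (Continuous.aestronglyMeasurable ?_)
        (Filter.Eventually.of_forall fun z => hDφb _)
      exact hDφ.comp (by fun_prop)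
  have hbd : ∀ x, ‖φ (x - v)‖ ≤ Cφ := fun x => hCφ _
  have hφv : Continuous fun x => φ (x - v) := hφ.continuous.comp (by fun_prop)
  rw [e0, e1, e2, integral_congr_ae e3, e4]
  simp only [sub_smul]
  rw [integral_sub (hsm hφ.continuous hCφ hw) (hsm hφv hbd hw)]
  abel

/-- The change of variables `y = x + v` in a double integral. -/
theorem lintegral_lintegral_shear {Φ : E3 → E3 → ℝ≥0∞} (hΦ : Measurable (Function.uncurry Φ)) :
    ∫⁻ x, ∫⁻ y, Φ x y = ∫⁻ v, ∫⁻ x, Φ x (x + v) := by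
  have h1 : ∀ x, ∫⁻ y, Φ x y = ∫⁻ v, Φ x (x + v) := fun x =>
    (lintegral_add_left_eq_self (fun y => Φ x y) x).symm
  simp_rw [h1]
  refine lintegral_lintegral_swap (Measurable.aemeasurable ?_)
  exact hΦ.comp (measurable_fst.prodMk (measurable_fst.add measurable_snd))

theorem lintegral_comp_add_smul_le {Γ : E3 → ℝ≥0∞} (hΓ : Measurable Γ) (a : E3) {s : ℝ}
    (hs : 1 / 2 ≤ s) : ∫⁻ y, Γ (a + s • y) ≤ 8 * ∫⁻ y, Γ y := by
  have hs0 : 0 < s := by linarith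
  have hm : Measurable fun y => Γ (a + y) := hΓ.comp (measurable_const_add a)
  have h1 := lintegral_map (μ := (volume : Measure E3)) hm (measurable_const_smul s)
  rw [← h1, Measure.map_addHaar_smul _ hs0.ne', lintegral_smul_measure,
    lintegral_add_left_eq_self (fun y => Γ y) a, smul_eq_mul]
  gcongr
  rw [finrank_euclideanSpace, Fintype.card_fin, abs_of_nonneg (by positivity)]
  have : (s ^ 3)⁻¹ ≤ 8 := by
    rw [inv_le_comm₀ (by positivity) (by norm_num)]
    have := pow_le_pow_left₀ (by norm_num) hs 3
    norm_num at this ⊢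
    exact this
  calc ENNReal.ofReal (s ^ 3)⁻¹ ≤ ENNReal.ofReal 8 := ENNReal.ofReal_le_ofReal this
    _ = 8 := by norm_num

/-- The Poincaré inequality in `L¹`, in double integral form. The constant `8 = 2 ^ 3` is the
Jacobian of a dilation by a factor of at least one half. -/
theorem lintegral_lintegral_enorm_sub_le (hU : IsOpen U) (hUc : Convex ℝ U) (hw : Integrable w)
    (hwm : StronglyMeasurable w)
    (hg : Integrable g) (hgm : StronglyMeasurable g)
    (hweak : ∀ φ : E3 → ℝ, ContDiff ℝ ∞ φ → HasCompactSupport φ → tsupport φ ⊆ U → ∀ e : E3,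
      ∫ x, fderiv ℝ φ x e • w x = -∫ x, φ x • g x e) {d : ℝ}
    (hd : ∀ x ∈ U, ∀ y ∈ U, ‖x - y‖ ≤ d) :
    ∫⁻ x in U, ∫⁻ y in U, ‖w x - w y‖ₑ ≤
      8 * ENNReal.ofReal d * volume U * ∫⁻ x in U, ‖g x‖ₑ := by
  set Γ : E3 → ℝ≥0∞ := U.indicator fun x => ‖g x‖ₑ with hΓ
  have hΓm : Measurable Γ := hgm.enorm.indicator hU.measurableSet
  set χ : E3 → ℝ≥0∞ := U.indicator 1 with hχ
  have hχm : Measurable χ := measurable_one.indicator hU.measurableSet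
  set D := ENNReal.ofReal d
  have hwdm : Measurable fun z : E3 × E3 => ‖w z.1 - w z.2‖ₑ :=
    ((hwm.comp_measurable measurable_fst).sub (hwm.comp_measurable measurable_snd)).enorm
  have e0 : ∫⁻ x in U, ∫⁻ y in U, ‖w x - w y‖ₑ =
      ∫⁻ x, ∫⁻ y, χ x * (χ y * ‖w x - w y‖ₑ) := by
    rw [← lintegral_indicator hU.measurableSet]
    congr 1 with x
    by_cases hx : x ∈ U
    · rw [Set.indicator_of_mem hx, ← lintegral_indicator hU.measurableSet]
      congr 1 with y
      by_cases hy : y ∈ U <;> simp [hχ, hx, hy]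
    · simp [hχ, hx]
  have e1 : ∀ v, ∫⁻ x, χ x * (χ (x + v) * ‖w x - w (x + v)‖ₑ) ≤
      ∫⁻ x, ∫⁻ t in Set.Icc (0 : ℝ) 1, χ x * (χ (x + v) * (D * Γ (x + t • v))) := by
    intro v
    refine lintegral_mono_ae ?_
    filter_upwards [ae_sub_eq_integral_of_weak hU hUc hw hg hgm hweak v] with x hx
    by_cases h1 : x ∈ U
    swap
    · simp [hχ, h1]
    by_cases h2 : x + v ∈ U
    swap
    · simp [hχ, h2]
    have hv : ‖v‖ₑ ≤ D := by
      rw [← ofReal_norm]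
      refine ENNReal.ofReal_le_ofReal ?_
      simpa using hd (x + v) h2 x h1
    have h3 : χ x = 1 := by simp [hχ, h1]
    have h4 : χ (x + v) = 1 := by simp [hχ, h2]
    simp only [h3, h4, one_mul]
    rw [← enorm_neg, neg_sub, hx h1 h2]
    refine (enorm_integral_le_lintegral_enorm _).trans ?_
    refine setLIntegral_mono' measurableSet_Icc fun t ht => ?_
    have h5 : x + t • v ∈ U := by
      have := hUc h1 h2 (sub_nonneg.2 ht.2) ht.1 (by ring)
      convert this using 1
      module
    have h6 : Γ (x + t • v) = ‖g (x + t • v)‖ₑ := by simp [hΓ, h5]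
    rw [h6, mul_comm D]
    exact (ContinuousLinearMap.le_opENorm _ _).trans (by gcongr)
  have hm2 : Measurable fun z : E3 × E3 × ℝ =>
      χ z.1 * (χ z.2.1 * (D * Γ (z.1 + z.2.2 • (z.2.1 - z.1)))) := by
    have : Measurable fun z : E3 × E3 × ℝ => Γ (z.1 + z.2.2 • (z.2.1 - z.1)) :=
      hΓm.comp (by fun_prop)
    exact (hχm.comp measurable_fst).mul
      ((hχm.comp (measurable_fst.comp measurable_snd)).mul (this.const_mul D))
  -- integrate first over the endpoint whose coefficient is at least one half
  have e2 : ∀ t ∈ Set.Icc (0 : ℝ) 1, ∫⁻ x, ∫⁻ y, χ x * (χ y * (D * Γ (x + t • (y - x)))) ≤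
      8 * D * volume U * ∫⁻ x, Γ x := by
    intro t ht
    have hvol : ∫⁻ x, χ x = volume U := by
      rw [hχ, lintegral_indicator_one hU.measurableSet]
    rcases le_total (1 / 2) t with h | h
    · calc ∫⁻ x, ∫⁻ y, χ x * (χ y * (D * Γ (x + t • (y - x))))
          ≤ ∫⁻ x, χ x * (D * (8 * ∫⁻ y, Γ y)) := by
            refine lintegral_mono fun x => ?_
            have hmm : Measurable fun y => Γ (x - t • x + t • y) := hΓm.comp (by fun_prop)
            calc ∫⁻ y, χ x * (χ y * (D * Γ (x + t • (y - x))))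
                ≤ ∫⁻ y, χ x * (D * Γ (x - t • x + t • y)) := by
                  refine lintegral_mono fun y => ?_
                  have h1 : χ y ≤ 1 := Set.indicator_le_self' (by simp) y
                  have h2 : x + t • (y - x) = x - t • x + t • y := by module
                  rw [h2]
                  exact mul_le_mul' le_rfl (mul_le_of_le_one_left' h1)
              _ = χ x * (D * ∫⁻ y, Γ (x - t • x + t • y)) := by
                  rw [lintegral_const_mul _ (hmm.const_mul D), lintegral_const_mul _ hmm]
              _ ≤ _ := by
                  gcongr
                  exact lintegral_comp_add_smul_le hΓm _ h
        _ = _ := by rw [lintegral_mul_const _ hχm, hvol]; ring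
    · have hm3 : Measurable (Function.uncurry fun x y : E3 =>
          χ x * (χ y * (D * Γ (x + t • (y - x))))) :=
        hm2.comp (measurable_fst.prodMk (measurable_snd.prodMk measurable_const))
      rw [lintegral_lintegral_swap hm3.aemeasurable]
      calc ∫⁻ y, ∫⁻ x, χ x * (χ y * (D * Γ (x + t • (y - x))))
          ≤ ∫⁻ y, χ y * (D * (8 * ∫⁻ x, Γ x)) := by
            refine lintegral_mono fun y => ?_
            have hmm : Measurable fun x => Γ (t • y + (1 - t) • x) := hΓm.comp (by fun_prop)
            calc ∫⁻ x, χ x * (χ y * (D * Γ (x + t • (y - x))))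
                ≤ ∫⁻ x, χ y * (D * Γ (t • y + (1 - t) • x)) := by
                  refine lintegral_mono fun x => ?_
                  have h1 : χ x ≤ 1 := Set.indicator_le_self' (by simp) x
                  have h2 : x + t • (y - x) = t • y + (1 - t) • x := by module
                  rw [h2]
                  exact mul_le_of_le_one_left' h1
              _ = χ y * (D * ∫⁻ x, Γ (t • y + (1 - t) • x)) := by
                  rw [lintegral_const_mul _ (hmm.const_mul D), lintegral_const_mul _ hmm]
              _ ≤ _ := by
                  gcongr
                  exact lintegral_comp_add_smul_le hΓm _ (by linarith)
        _ = _ := by rw [lintegral_mul_const _ hχm, hvol]; ring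
  rw [e0, lintegral_lintegral_shear (Φ := fun x y => χ x * (χ y * ‖w x - w y‖ₑ))
    ((hχm.comp measurable_fst).mul ((hχm.comp measurable_snd).mul hwdm))]
  calc ∫⁻ v, ∫⁻ x, χ x * (χ (x + v) * ‖w x - w (x + v)‖ₑ)
      ≤ ∫⁻ v, ∫⁻ x, ∫⁻ t in Set.Icc (0 : ℝ) 1, χ x * (χ (x + v) * (D * Γ (x + t • v))) :=
        lintegral_mono e1
    _ = ∫⁻ x, ∫⁻ y, ∫⁻ t in Set.Icc (0 : ℝ) 1, χ x * (χ y * (D * Γ (x + t • (y - x)))) := by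
        rw [lintegral_lintegral_shear (Φ := fun x y => ∫⁻ t in Set.Icc (0 : ℝ) 1,
          χ x * (χ y * (D * Γ (x + t • (y - x)))))]
        · simp
        · exact Measurable.lintegral_prod_right' (ν := volume.restrict (Set.Icc (0 : ℝ) 1))
            (f := fun z : (E3 × E3) × ℝ =>
              χ z.1.1 * (χ z.1.2 * (D * Γ (z.1.1 + z.2 • (z.1.2 - z.1.1)))))
            (hm2.comp (measurable_fst.fst.prodMk (measurable_fst.snd.prodMk measurable_snd)))
    _ = ∫⁻ x, ∫⁻ t in Set.Icc (0 : ℝ) 1, ∫⁻ y, χ x * (χ y * (D * Γ (x + t • (y - x)))) := by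
        congr 1 with x
        exact lintegral_lintegral_swap (Measurable.aemeasurable
          (hm2.comp (measurable_const.prodMk (measurable_fst.prodMk measurable_snd))))
    _ = ∫⁻ t in Set.Icc (0 : ℝ) 1, ∫⁻ x, ∫⁻ y, χ x * (χ y * (D * Γ (x + t • (y - x)))) := by
        refine lintegral_lintegral_swap (Measurable.aemeasurable ?_)
        exact Measurable.lintegral_prod_right' (ν := (volume : Measure E3))
            (f := fun z : (E3 × ℝ) × E3 =>
              χ z.1.1 * (χ z.2 * (D * Γ (z.1.1 + z.1.2 • (z.2 - z.1.1)))))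
            (hm2.comp (measurable_fst.fst.prodMk (measurable_snd.prodMk measurable_fst.snd)))
    _ ≤ ∫⁻ t in Set.Icc (0 : ℝ) 1, 8 * D * volume U * ∫⁻ x, Γ x :=
        setLIntegral_mono' measurableSet_Icc e2
    _ = _ := by
        rw [hΓ, lintegral_indicator hU.measurableSet]
        simp

/-- On a convex set, a function with bounded weak gradient is Lipschitz up to null sets. -/
theorem ae_ae_norm_sub_le (hU : IsOpen U) (hUc : Convex ℝ U) (hw : Integrable w)
    (hwm : StronglyMeasurable w)
    (hg : Integrable g) (hgm : StronglyMeasurable g)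
    (hweak : ∀ φ : E3 → ℝ, ContDiff ℝ ∞ φ → HasCompactSupport φ → tsupport φ ⊆ U → ∀ e : E3,
      ∫ x, fderiv ℝ φ x e • w x = -∫ x, φ x • g x e) {d G : ℝ}
    (hd : ∀ x ∈ U, ∀ y ∈ U, ‖x - y‖ ≤ d) (hG : ∀ x, ‖g x‖ ≤ G) :
    ∀ᵐ x, x ∈ U → ∀ᵐ y, y ∈ U → ‖w x - w y‖ ≤ d * G := by
  set S : Set (E3 × E3) := {z | z.1 ∈ U ∧ z.2 ∈ U ∧ d * G < ‖w z.1 - w z.2‖} with hS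
  have hSm : MeasurableSet S := by
    have h1 : Measurable fun z : E3 × E3 => ‖w z.1 - w z.2‖ :=
      ((hwm.comp_measurable measurable_fst).sub
        (hwm.comp_measurable measurable_snd)).norm.measurable
    exact (measurable_fst hU.measurableSet).inter
      ((measurable_snd hU.measurableSet).inter (measurableSet_lt measurable_const h1))
  have hΦ : Measurable (Function.uncurry fun x y : E3 => S.indicator (1 : E3 × E3 → ℝ≥0∞) (x, y)) :=
    measurable_one.indicator hSm
  have h0 : ∫⁻ x, ∫⁻ y, S.indicator (1 : E3 × E3 → ℝ≥0∞) (x, y) = 0 := by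
    rw [lintegral_lintegral_shear hΦ]
    refine lintegral_eq_zero_of_ae_eq_zero (Filter.Eventually.of_forall fun v => ?_)
    refine lintegral_eq_zero_of_ae_eq_zero ?_
    filter_upwards [ae_sub_eq_integral_of_weak hU hUc hw hg hgm hweak v] with x hx
    have : (x, x + v) ∉ S := by
      rintro ⟨h1, h2, h3⟩
      refine h3.not_ge ?_
      simp only at h1 h2 ⊢
      rw [norm_sub_rev, hx h1 h2]
      have hv : ‖v‖ ≤ d := by simpa using hd (x + v) h2 x h1
      have h4 := norm_setIntegral_le_of_norm_le_const (μ := volume) (s := Set.Icc (0 : ℝ) 1)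
        (f := fun t => g (x + t • v) v) (C := d * G) (by simp) fun t _ =>
          ((g (x + t • v)).le_opNorm v).trans (by
            rw [mul_comm d]
            have := hG (x + t • v)
            have h0 := (norm_nonneg (g (x + t • v))).trans this
            gcongr)
      simpa using h4
    simp [this]
  have h1 : Measurable fun x => ∫⁻ y, S.indicator (1 : E3 × E3 → ℝ≥0∞) (x, y) :=
    hΦ.lintegral_prod_right
  rw [lintegral_eq_zero_iff h1] at h0
  filter_upwards [h0] with x hx hxU
  have h2 : Measurable fun y => S.indicator (1 : E3 × E3 → ℝ≥0∞) (x, y) :=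
    hΦ.comp measurable_prodMk_left
  have hx' : ∫⁻ y, S.indicator (1 : E3 × E3 → ℝ≥0∞) (x, y) = 0 := hx
  rw [lintegral_eq_zero_iff h2] at hx'
  filter_upwards [hx'] with y hy hyU
  by_contra! h3
  have : (x, y) ∈ S := ⟨hxU, hyU, h3⟩
  simp [this] at hy

end Translation

theorem integrable_indicator_of_integrableOn {F : Type*} [NormedAddCommGroup F] {f : E3 → F}
    {S : Set E3} (hS : MeasurableSet S) (hf : IntegrableOn f S) : Integrable (S.indicator f) :=
  hf.integrable_indicator hS

/-- The mean value of `w` deviates from a vector by at most the mean deviation. -/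
theorem measure_mul_enorm_average_sub_le {A : Set E3} (hA : volume A ≠ ⊤)
    {w : E3 → E3} (hw : IntegrableOn w A) (c : E3) :
    volume A * ‖(⨍ x in A, w x) - c‖ₑ ≤ ∫⁻ x in A, ‖w x - c‖ₑ := by
  have hfin : IsFiniteMeasure (volume.restrict A) := ⟨by simpa using hA.lt_top⟩
  have h1 : (volume.real A) • ((⨍ x in A, w x) - c) = ∫ x in A, (w x - c) := by
    rw [integral_sub hw (integrable_const c), setIntegral_const, smul_sub,
      measure_smul_setAverage _ hA]
  calc volume A * ‖(⨍ x in A, w x) - c‖ₑ = ‖(volume.real A) • ((⨍ x in A, w x) - c)‖ₑ := by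
        rw [enorm_smul, Real.enorm_of_nonneg measureReal_nonneg, measureReal_def,
          ENNReal.ofReal_toReal hA]
    _ ≤ _ := by rw [h1]; exact enorm_integral_le_lintegral_enorm _

section Poincare

variable {Ω U A B : Set E3} {w : E3 → E3} {g : E3 → E3 →L[ℝ] E3}

/-- Globally defined, strongly measurable representatives of a Sobolev function and its gradient. -/
theorem HasWeakFDeriv.exists_representative (hΩ : IsOpen Ω) (hwg : HasWeakFDeriv Ω w g)
    (hw : IntegrableOn w Ω) (hg : IntegrableOn g Ω) (hU : IsOpen U) (hUΩ : U ⊆ Ω) :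
    ∃ (w' : E3 → E3) (g' : E3 → E3 →L[ℝ] E3), Integrable w' ∧ StronglyMeasurable w' ∧
      Integrable g' ∧ StronglyMeasurable g' ∧
      (∀ᵐ x ∂(volume.restrict U), w' x = w x) ∧ (∀ᵐ x ∂(volume.restrict U), g' x = g x) ∧
      ∀ φ : E3 → ℝ, ContDiff ℝ ∞ φ → HasCompactSupport φ → tsupport φ ⊆ U → ∀ e : E3,
        ∫ x, fderiv ℝ φ x e • w' x = -∫ x, φ x • g' x e := by
  have hwU := hw.mono_set hUΩ
  have hgU := hg.mono_set hUΩ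
  have h1 : (∀ᵐ x ∂(volume.restrict U), U.indicator (hwU.1.mk w) x = w x) := by
    filter_upwards [hwU.1.ae_eq_mk, ae_restrict_mem hU.measurableSet] with x hx hxU
    rw [Set.indicator_of_mem hxU, hx]
  have h2 : (∀ᵐ x ∂(volume.restrict U), U.indicator (hgU.1.mk g) x = g x) := by
    filter_upwards [hgU.1.ae_eq_mk, ae_restrict_mem hU.measurableSet] with x hx hxU
    rw [Set.indicator_of_mem hxU, hx]
  refine ⟨U.indicator (hwU.1.mk w), U.indicator (hgU.1.mk g), ?_,
    hwU.1.stronglyMeasurable_mk.indicator hU.measurableSet, ?_,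
    hgU.1.stronglyMeasurable_mk.indicator hU.measurableSet, h1, h2, ?_⟩
  · exact integrable_indicator_of_integrableOn hU.measurableSet (hwU.congr hwU.1.ae_eq_mk)
  · exact integrable_indicator_of_integrableOn hU.measurableSet (hgU.congr hgU.1.ae_eq_mk)
  · intro φ hφ hφc hφs e
    have hs1 : Function.support (fun x => fderiv ℝ φ x e) ⊆ U := by
      refine (subset_trans ?_ (tsupport_fderiv_subset ℝ (f := φ))).trans hφs
      intro x hx
      refine subset_tsupport _ ?_
      intro h
      exact hx (by simp [h])
    have hs2 : Function.support φ ⊆ U := (subset_tsupport _).trans hφs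
    have h3 := hwg.2.2 φ hφ hφc (hφs.trans hUΩ) e
    have e1 : ∫ x, fderiv ℝ φ x e • U.indicator (hwU.1.mk w) x
        = ∫ x in Ω, fderiv ℝ φ x e • w x := by
      rw [← setIntegral_eq_integral_of_forall_compl_eq_zero (s := U),
        setIntegral_eq_of_subset_of_forall_sdiff_eq_zero hΩ.measurableSet hUΩ]
      · refine integral_congr_ae ?_
        filter_upwards [h1] with x hx
        rw [hx]
      · intro x hx
        rw [Function.notMem_support.1 fun h => hx.2 (hs1 h), zero_smul]
      · intro x hx
        rw [Function.notMem_support.1 fun h => hx (hs1 h), zero_smul]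
    have e2 : ∫ x, φ x • U.indicator (hgU.1.mk g) x e = ∫ x in Ω, φ x • g x e := by
      rw [← setIntegral_eq_integral_of_forall_compl_eq_zero (s := U),
        setIntegral_eq_of_subset_of_forall_sdiff_eq_zero hΩ.measurableSet hUΩ]
      · refine integral_congr_ae ?_
        filter_upwards [h2] with x hx
        rw [hx]
      · intro x hx
        rw [Function.notMem_support.1 fun h => hx.2 (hs2 h), zero_smul]
      · intro x hx
        rw [Function.notMem_support.1 fun h => hx (hs2 h), zero_smul]
    rw [e1, e2, h3]

/-- The Poincaré inequality in double integral form, for a convex subset of the domain. -/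
theorem HasWeakFDeriv.lintegral_lintegral_le (hΩ : IsOpen Ω) (hwg : HasWeakFDeriv Ω w g)
    (hw : IntegrableOn w Ω) (hg : IntegrableOn g Ω) (hU : IsOpen U) (hUΩ : U ⊆ Ω)
    (hUc : Convex ℝ U) {d : ℝ} (hd : ∀ x ∈ U, ∀ y ∈ U, ‖x - y‖ ≤ d) :
    ∫⁻ x in U, ∫⁻ y in U, ‖w x - w y‖ₑ ≤
      8 * ENNReal.ofReal d * volume U * ∫⁻ x in U, ‖g x‖ₑ := by
  obtain ⟨w', g', h1, h2, h3, h4, h5, h6, h7⟩ := hwg.exists_representative hΩ hw hg hU hUΩ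
  have := lintegral_lintegral_enorm_sub_le hU hUc h1 h2 h3 h4 h7 hd
  have e1 : ∫⁻ x in U, ∫⁻ y in U, ‖w x - w y‖ₑ = ∫⁻ x in U, ∫⁻ y in U, ‖w' x - w' y‖ₑ := by
    refine lintegral_congr_ae ?_
    filter_upwards [h5] with x hx
    refine lintegral_congr_ae ?_
    filter_upwards [h5] with y hy
    rw [hx, hy]
  have e2 : ∫⁻ x in U, ‖g x‖ₑ = ∫⁻ x in U, ‖g' x‖ₑ := by
    refine lintegral_congr_ae ?_
    filter_upwards [h6] with x hx
    rw [hx]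
  rw [e1, e2]
  exact this

/-- Comparison of the means of a Sobolev function over two subsets of a convex set. -/
theorem HasWeakFDeriv.enorm_average_sub_average_le (hΩ : IsOpen Ω) (hwg : HasWeakFDeriv Ω w g)
    (hw : IntegrableOn w Ω) (hg : IntegrableOn g Ω) (hU : IsOpen U) (hUΩ : U ⊆ Ω)
    (hUc : Convex ℝ U) {d : ℝ} (hd : ∀ x ∈ U, ∀ y ∈ U, ‖x - y‖ ≤ d) (hAU : A ⊆ U) (hBU : B ⊆ U)
    (hA : volume A ≠ ⊤) (hB : volume B ≠ ⊤) :
    volume A * volume B * ‖(⨍ x in A, w x) - ⨍ x in B, w x‖ₑ ≤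
      8 * ENNReal.ofReal d * volume U * ∫⁻ x in U, ‖g x‖ₑ := by
  have hwA := hw.mono_set (hAU.trans hUΩ)
  have hwB := hw.mono_set (hBU.trans hUΩ)
  calc volume A * volume B * ‖(⨍ x in A, w x) - ⨍ x in B, w x‖ₑ
      = volume B * (volume A * ‖(⨍ x in A, w x) - ⨍ x in B, w x‖ₑ) := by ring
    _ ≤ volume B * ∫⁻ x in A, ‖w x - ⨍ x in B, w x‖ₑ := by
        gcongr; exact measure_mul_enorm_average_sub_le hA hwA _
    _ = ∫⁻ x in A, volume B * ‖(⨍ x in B, w x) - w x‖ₑ := by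
        rw [← lintegral_const_mul' _ _ hB]
        simp_rw [← enorm_neg (w _ - _), neg_sub]
    _ ≤ ∫⁻ x in A, ∫⁻ y in B, ‖w x - w y‖ₑ := by
        refine lintegral_mono fun x => (measure_mul_enorm_average_sub_le hB hwB _).trans ?_
        refine lintegral_mono fun y => ?_
        rw [← enorm_neg, neg_sub]
    _ ≤ ∫⁻ x in U, ∫⁻ y in U, ‖w x - w y‖ₑ := by
        refine (lintegral_mono_set hAU).trans (lintegral_mono fun x => lintegral_mono_set hBU)
    _ ≤ _ := hwg.lintegral_lintegral_le hΩ hw hg hU hUΩ hUc hd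

/-- The Poincaré inequality in `L¹` on a convex set. -/
theorem HasWeakFDeriv.lintegral_sub_average_le (hΩ : IsOpen Ω) (hwg : HasWeakFDeriv Ω w g)
    (hw : IntegrableOn w Ω) (hg : IntegrableOn g Ω) (hU : IsOpen U) (hUΩ : U ⊆ Ω)
    (hUc : Convex ℝ U) {d : ℝ} (hd : ∀ x ∈ U, ∀ y ∈ U, ‖x - y‖ ≤ d)
    (h0 : volume U ≠ 0) (hfin : volume U ≠ ⊤) :
    ∫⁻ x in U, ‖w x - ⨍ x in U, w x‖ₑ ≤ 8 * ENNReal.ofReal d * ∫⁻ x in U, ‖g x‖ₑ := by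
  have h1 : volume U * ∫⁻ x in U, ‖w x - ⨍ x in U, w x‖ₑ ≤
      8 * ENNReal.ofReal d * volume U * ∫⁻ x in U, ‖g x‖ₑ := by
    refine le_trans ?_ (hwg.lintegral_lintegral_le hΩ hw hg hU hUΩ hUc hd)
    rw [← lintegral_const_mul' _ _ hfin]
    refine lintegral_mono fun x => ?_
    rw [← enorm_neg, neg_sub]
    refine (measure_mul_enorm_average_sub_le hfin (hw.mono_set hUΩ) _).trans ?_
    refine lintegral_mono fun y => ?_
    rw [← enorm_neg, neg_sub]
  rw [← ENNReal.mul_le_mul_iff_right h0 hfin]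
  refine h1.trans_eq ?_
  ring

/-- The Poincaré inequality in `L^∞` on a convex set. -/
theorem HasWeakFDeriv.ae_norm_sub_average_le (hΩ : IsOpen Ω) (hwg : HasWeakFDeriv Ω w g)
    (hw : IntegrableOn w Ω) (hg : IntegrableOn g Ω) (hU : IsOpen U) (hUΩ : U ⊆ Ω)
    (hUc : Convex ℝ U) {d G : ℝ} (hd : ∀ x ∈ U, ∀ y ∈ U, ‖x - y‖ ≤ d)
    (h0 : volume U ≠ 0) (hfin : volume U ≠ ⊤) (hG0 : 0 ≤ G)
    (hG : ∀ᵐ x ∂(volume.restrict Ω), ‖g x‖ ≤ G) :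
    ∀ᵐ x ∂(volume.restrict U), ‖w x - ⨍ x in U, w x‖ ≤ d * G := by
  obtain ⟨w', g', h1, h2, h3, h4, h5, h6, h7⟩ := hwg.exists_representative hΩ hw hg hU hUΩ
  set S : Set E3 := U ∩ {x | ‖g' x‖ ≤ G} with hS
  have hSm : MeasurableSet S :=
    hU.measurableSet.inter (measurableSet_le h4.norm.measurable measurable_const)
  have h8 : ∀ x, ‖S.indicator g' x‖ ≤ G := by
    intro x
    by_cases hx : x ∈ S
    · rw [Set.indicator_of_mem hx]; exact hx.2
    · rw [Set.indicator_of_notMem hx]; simpa using hG0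
  have h9 : ∀ᵐ x ∂(volume.restrict U), S.indicator g' x = g' x := by
    filter_upwards [h6, ae_restrict_mem hU.measurableSet,
      ae_mono (Measure.restrict_mono hUΩ le_rfl) hG] with x hx hxU hxG
    rw [Set.indicator_of_mem]
    exact ⟨hxU, by simpa [hx] using hxG⟩
  have key := ae_ae_norm_sub_le (G := G) hU hUc h1 h2
    (integrable_indicator_of_integrableOn hSm h3.integrableOn) (h4.indicator hSm) ?_ hd h8
  · filter_upwards [h5, ae_restrict_mem hU.measurableSet, ae_restrict_of_ae key] with x hx hxU hk
    have hdG : 0 ≤ d * G := mul_nonneg ((norm_nonneg _).trans (hd x hxU x hxU)) hG0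
    have h10 : volume U * ‖(⨍ x in U, w x) - w x‖ₑ ≤ volume U * ENNReal.ofReal (d * G) := by
      refine (measure_mul_enorm_average_sub_le hfin (hw.mono_set hUΩ) _).trans ?_
      rw [mul_comm, ← setLIntegral_const]
      refine lintegral_mono_ae ?_
      filter_upwards [h5, ae_restrict_mem hU.measurableSet,
        ae_restrict_of_ae (hk hxU)] with y hy hyU hk'
      rw [← ofReal_norm]
      refine ENNReal.ofReal_le_ofReal ?_
      rw [← hx, ← hy, norm_sub_rev]
      exact hk' hyU
    rw [ENNReal.mul_le_mul_iff_right h0 hfin, ← ofReal_norm,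
      ENNReal.ofReal_le_ofReal_iff hdG, norm_sub_rev] at h10
    exact h10
  · intro φ hφ hφc hφs e
    rw [h7 φ hφ hφc hφs e]
    have hs2 : Function.support φ ⊆ U := (subset_tsupport _).trans hφs
    have hz : ∀ (k : E3 → E3 →L[ℝ] E3), ∫ x in U, φ x • k x e = ∫ x, φ x • k x e := fun k =>
      setIntegral_eq_integral_of_forall_compl_eq_zero fun x hx => by
        rw [Function.notMem_support.1 fun h => hx (hs2 h), zero_smul]
    rw [← hz, ← hz]
    refine congrArg _ (integral_congr_ae ?_)
    filter_upwards [h9] with x hx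
    rw [hx]

end Poincare

section Tetrahedra

/-! ### Volumes of balls -/

/-- The volume of the unit ball of `ℝ³`. -/
def ballVol : ℝ := volume.real (Metric.ball (0 : E3) 1)

theorem ballVol_pos : 0 < ballVol :=
  ENNReal.toReal_pos (Metric.measure_ball_pos _ _ one_pos).ne' measure_ball_lt_top.ne

theorem volume_ball_eq (x : E3) {ρ : ℝ} (hρ : 0 ≤ ρ) :
    volume (Metric.ball x ρ) = ENNReal.ofReal (ρ ^ 3 * ballVol) := by
  rw [Measure.addHaar_ball _ _ hρ, ENNReal.ofReal_mul (by positivity), ballVol, measureReal_def,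
    ENNReal.ofReal_toReal measure_ball_lt_top.ne]
  simp

theorem volume_closedBall_eq (x : E3) {ρ : ℝ} (hρ : 0 ≤ ρ) :
    volume (Metric.closedBall x ρ) = ENNReal.ofReal (ρ ^ 3 * ballVol) := by
  rw [Measure.addHaar_closedBall_eq_addHaar_ball, volume_ball_eq x hρ]

variable {Ω : Set E3} (𝒯 : Triangulation Ω)

/-! ### Barycentric coordinates -/

theorem affineIndependent_element (t : 𝒯.elements) :
    AffineIndependent ℝ ((↑) : {z // z ∈ (t : Finset E3)} → E3) :=
  𝒯.indep t.2.1

/-- The vertices of a tetrahedron as an affine basis of `ℝ³`. -/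
def elemBasis (t : 𝒯.elements) : AffineBasis {z // z ∈ (t : Finset E3)} ℝ E3 where
  toFun := (↑)
  ind' := affineIndependent_element 𝒯 t
  tot' := by
    rw [(affineIndependent_element 𝒯 t).affineSpan_eq_top_iff_card_eq_finrank_add_one]
    simp [t.2.2, finrank_euclideanSpace]

open Classical in
/-- The barycentric coordinate of a tetrahedron that belongs to the vertex `z`. It is `0` if `z` is
not a vertex of the tetrahedron. -/
def bary (t : 𝒯.elements) (z : E3) : E3 →ᵃ[ℝ] ℝ :=
  if hz : z ∈ (t : Finset E3) then (elemBasis 𝒯 t).coord ⟨z, hz⟩ else AffineMap.const ℝ E3 0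

variable {𝒯}

theorem bary_of_mem {t : 𝒯.elements} {z : E3} (hz : z ∈ (t : Finset E3)) :
    bary 𝒯 t z = (elemBasis 𝒯 t).coord ⟨z, hz⟩ := by simp [bary, hz]

theorem bary_of_notMem {t : 𝒯.elements} {z : E3} (hz : z ∉ (t : Finset E3)) (x : E3) :
    bary 𝒯 t z x = 0 := by simp [bary, hz]

theorem sum_bary (t : 𝒯.elements) (x : E3) : ∑ z ∈ (t : Finset E3), bary 𝒯 t z x = 1 := by
  rw [← (elemBasis 𝒯 t).sum_coord_apply_eq_one x, ← Finset.sum_coe_sort]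
  exact Finset.sum_congr rfl fun z _ => by rw [bary_of_mem z.2]

theorem sum_bary_smul (t : 𝒯.elements) (x : E3) :
    ∑ z ∈ (t : Finset E3), bary 𝒯 t z x • z = x := by
  conv_rhs => rw [← (elemBasis 𝒯 t).linear_combination_coord_eq_self x]
  rw [← Finset.sum_coe_sort]
  exact Finset.sum_congr rfl fun z _ => by rw [bary_of_mem z.2]; rfl

theorem bary_vertex {t : 𝒯.elements} {z y : E3} [Decidable (z = y)] (hz : z ∈ (t : Finset E3))
    (hy : y ∈ (t : Finset E3)) :
    bary 𝒯 t z y = if z = y then 1 else 0 := by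
  classical
  rw [bary_of_mem hz]
  have := (elemBasis 𝒯 t).coord_apply ⟨z, hz⟩ ⟨y, hy⟩
  simp only [Subtype.mk.injEq] at this
  have e : (elemBasis 𝒯 t) ⟨y, hy⟩ = y := rfl
  rw [e] at this
  rw [this]

theorem range_elemBasis (t : 𝒯.elements) : Set.range (elemBasis 𝒯 t) = (t : Finset E3) :=
  Subtype.range_coe

theorem mem_tet_iff {t : 𝒯.elements} {x : E3} :
    x ∈ tet (t : Finset E3) ↔ ∀ z, 0 ≤ bary 𝒯 t z x := by
  rw [tet, ← range_elemBasis, (elemBasis 𝒯 t).convexHull_eq_nonneg_coord]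
  constructor
  · intro h z
    by_cases hz : z ∈ (t : Finset E3)
    · rw [bary_of_mem hz]; exact h _
    · rw [bary_of_notMem hz]
  · intro h z
    rw [← bary_of_mem z.2]; exact h _

theorem mem_interior_tet_iff {t : 𝒯.elements} {x : E3} :
    x ∈ interior (tet (t : Finset E3)) ↔ ∀ z ∈ (t : Finset E3), 0 < bary 𝒯 t z x := by
  rw [tet, ← range_elemBasis, (elemBasis 𝒯 t).interior_convexHull]
  constructor
  · intro h z hz
    rw [bary_of_mem hz]; exact h _
  · intro h z
    rw [← bary_of_mem z.2]; exact h _ z.2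

theorem bary_le_one {t : 𝒯.elements} {x : E3} (hx : x ∈ tet (t : Finset E3)) (z : E3) :
    bary 𝒯 t z x ≤ 1 := by
  by_cases hz : z ∈ (t : Finset E3)
  · rw [← sum_bary t x]
    exact Finset.single_le_sum (f := fun z => bary 𝒯 t z x) (fun y _ => mem_tet_iff.1 hx y) hz
  · rw [bary_of_notMem hz]; exact zero_le_one

theorem affineMap_sum_smul {V ι : Type*} [AddCommGroup V] [Module ℝ V] (f : E3 →ᵃ[ℝ] V)
    {s : Finset ι} {w : ι → ℝ} (hw : ∑ y ∈ s, w y = 1) (p : ι → E3) :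
    f (∑ y ∈ s, w y • p y) = ∑ y ∈ s, w y • f (p y) := by
  have h : ∀ x, f x = f.linear x + f 0 := fun x => by
    have := f.map_vadd 0 x
    simpa using this
  rw [h, map_sum]
  simp only [map_smul]
  have : f 0 = ∑ y ∈ s, w y • f 0 := by rw [← Finset.sum_smul, hw, one_smul]
  rw [this, ← Finset.sum_add_distrib]
  exact Finset.sum_congr rfl fun y _ => by rw [h (p y), smul_add]

theorem affineMap_eq_sum_bary (f : E3 →ᵃ[ℝ] ℝ) (t : 𝒯.elements) (x : E3) :
    f x = ∑ z ∈ (t : Finset E3), bary 𝒯 t z x * f z := by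
  conv_lhs => rw [← sum_bary_smul t x]
  exact affineMap_sum_smul f (sum_bary t x) fun z => z

open Classical in
/-- Barycentric coordinates of a point of a face. -/
theorem bary_sum_smul {t : 𝒯.elements} {s : Finset E3} (hs : s ⊆ (t : Finset E3)) {w : E3 → ℝ}
    (hw : ∑ y ∈ s, w y = 1) (z : E3) :
    bary 𝒯 t z (∑ y ∈ s, w y • y) = if z ∈ s then w z else 0 := by
  rw [affineMap_sum_smul _ hw fun y => y]
  by_cases hz : z ∈ (t : Finset E3)
  · rw [Finset.sum_congr rfl fun y hy => by rw [bary_vertex hz (hs hy)]]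
    simp
  · rw [Finset.sum_congr rfl fun y hy => by rw [bary_of_notMem hz]]
    have : z ∉ s := fun h => hz (hs h)
    simp [this]

open Classical in
theorem exists_weights_of_mem_inter {t t' : 𝒯.elements} {x : E3} (hx : x ∈ tet (t : Finset E3))
    (hx' : x ∈ tet (t' : Finset E3)) : ∃ w : E3 → ℝ,
      (∀ y ∈ (t : Finset E3) ∩ t', 0 ≤ w y) ∧ ∑ y ∈ (t : Finset E3) ∩ t', w y = 1 ∧
        ∑ y ∈ (t : Finset E3) ∩ t', w y • y = x := by
  have h := 𝒯.inter_subset_convexHull t.2.1 t'.2.1 ⟨hx, hx'⟩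
  rw [← Finset.coe_inter] at h
  exact Finset.mem_convexHull'.1 h

/-- The barycentric coordinates of neighbouring tetrahedra agree on their intersection. -/
theorem bary_eq_of_mem {t t' : 𝒯.elements} {x : E3} (hx : x ∈ tet (t : Finset E3))
    (hx' : x ∈ tet (t' : Finset E3)) (z : E3) : bary 𝒯 t z x = bary 𝒯 t' z x := by
  classical
  obtain ⟨w, -, h1, rfl⟩ := exists_weights_of_mem_inter hx hx'
  rw [bary_sum_smul Finset.inter_subset_left h1, bary_sum_smul Finset.inter_subset_right h1]

theorem vertex_mem_tet {t : Finset E3} {z : E3} (hz : z ∈ t) : z ∈ tet t :=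
  subset_convexHull ℝ _ (by exact_mod_cast hz)

theorem convex_tet (t : Finset E3) : Convex ℝ (tet t) := convex_convexHull ℝ _

theorem isCompact_tet (t : Finset E3) : IsCompact (tet t) :=
  t.finite_toSet.isCompact_convexHull ℝ

theorem isClosed_tet (t : Finset E3) : IsClosed (tet t) := (isCompact_tet t).isClosed

theorem tet_subset_closure (t : 𝒯.elements) : tet (t : Finset E3) ⊆ closure Ω := by
  rw [← 𝒯.space_eq]
  exact 𝒯.convexHull_subset_space t.2.1

theorem BoundedDomain.isOpen (hΩ : BoundedDomain Ω) : IsOpen Ω := by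
  rw [← hΩ.interior_closure]; exact isOpen_interior

theorem subset_of_subset_closure (hΩ : BoundedDomain Ω) {U : Set E3} (hU : IsOpen U)
    (h : U ⊆ closure Ω) : U ⊆ Ω := by
  rw [← hΩ.interior_closure]
  exact interior_maximal h hU

theorem interior_tet_subset (hΩ : BoundedDomain Ω) (t : 𝒯.elements) :
    interior (tet (t : Finset E3)) ⊆ Ω :=
  subset_of_subset_closure hΩ isOpen_interior (interior_subset.trans (tet_subset_closure t))

/-- A tetrahedron that meets the interior of another one coincides with it. -/
theorem eq_of_mem_interior {t t' : 𝒯.elements} {x : E3}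
    (hx : x ∈ interior (tet (t : Finset E3))) (hx' : x ∈ tet (t' : Finset E3)) : t = t' := by
  have h1 : (t : Finset E3) ⊆ t' := by
    intro z hz
    by_contra h
    have h2 := mem_interior_tet_iff.1 hx z hz
    rw [bary_eq_of_mem (interior_subset hx) hx', bary_of_notMem h] at h2
    exact lt_irrefl _ h2
  exact Subtype.ext (Finset.eq_of_subset_of_card_le h1 (by rw [t.2.2, t'.2.2]))

theorem pairwise_disjoint_interior :
    Pairwise fun t t' : 𝒯.elements =>
      Disjoint (interior (tet (t : Finset E3))) (interior (tet (t' : Finset E3))) := by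
  intro t t' h
  rw [Set.disjoint_left]
  exact fun x hx hx' => h (eq_of_mem_interior hx (interior_subset hx'))

theorem ae_exists_mem_interior (𝒯 : Triangulation Ω) (hΩ : IsOpen Ω) :
    ∀ᵐ x ∂(volume.restrict Ω), ∃ t : 𝒯.elements, x ∈ interior (tet (t : Finset E3)) := by
  have := finite_elements 𝒯
  have h1 : ∀ᵐ x : E3, ∀ t : 𝒯.elements, x ∉ frontier (tet (t : Finset E3)) := by
    rw [ae_all_iff]
    intro t
    exact measure_eq_zero_iff_ae_notMem.1 ((convex_tet _).addHaar_frontier volume)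
  filter_upwards [ae_restrict_of_ae h1, ae_restrict_mem hΩ.measurableSet] with x hx hxΩ
  obtain ⟨t, ht⟩ := exists_mem_tet 𝒯 (subset_closure hxΩ)
  refine ⟨t, ?_⟩
  by_contra h
  exact hx t ⟨subset_closure ht, h⟩

instance : Finite 𝒯.elements := finite_elements 𝒯

instance : Fintype 𝒯.elements := Fintype.ofFinite _

theorem lintegral_eq_sum (𝒯 : Triangulation Ω) (hΩ : BoundedDomain Ω) (f : E3 → ℝ≥0∞) :
    ∫⁻ x in Ω, f x = ∑ t : 𝒯.elements, ∫⁻ x in interior (tet (t : Finset E3)), f x := by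
  have h1 : (Ω : Set E3) =ᵐ[volume] ⋃ t : 𝒯.elements, interior (tet (t : Finset E3)) := by
    refine Filter.eventuallyLE_antisymm_iff.2 ⟨?_, ?_⟩
    · have := (ae_restrict_iff' hΩ.isOpen.measurableSet).1 (ae_exists_mem_interior 𝒯 hΩ.isOpen)
      filter_upwards [this] with x hx h
      exact Set.mem_iUnion.2 (hx h)
    · exact Filter.Eventually.of_forall fun x hx => by
        obtain ⟨t, ht⟩ := Set.mem_iUnion.1 hx
        exact interior_tet_subset hΩ t ht
  rw [setLIntegral_congr h1, lintegral_iUnion (fun t => isOpen_interior.measurableSet)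
    pairwise_disjoint_interior, tsum_fintype]

theorem integral_eq_sum {F : Type*} [NormedAddCommGroup F] [NormedSpace ℝ F]
    (𝒯 : Triangulation Ω) (hΩ : BoundedDomain Ω) {f : E3 → F}
    (hf : IntegrableOn f Ω) :
    ∫ x in Ω, f x = ∑ t : 𝒯.elements, ∫ x in interior (tet (t : Finset E3)), f x := by
  have h1 : (Ω : Set E3) =ᵐ[volume] ⋃ t : 𝒯.elements, interior (tet (t : Finset E3)) := by
    refine Filter.eventuallyLE_antisymm_iff.2 ⟨?_, ?_⟩
    · have := (ae_restrict_iff' hΩ.isOpen.measurableSet).1 (ae_exists_mem_interior 𝒯 hΩ.isOpen)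
      filter_upwards [this] with x hx h
      exact Set.mem_iUnion.2 (hx h)
    · exact Filter.Eventually.of_forall fun x hx => by
        obtain ⟨t, ht⟩ := Set.mem_iUnion.1 hx
        exact interior_tet_subset hΩ t ht
  have h2 : ∀ t : 𝒯.elements, IntegrableOn f (interior (tet (t : Finset E3))) :=
    fun t => hf.mono_set (interior_tet_subset hΩ t)
  rw [setIntegral_congr_set h1, integral_iUnion_fintype (fun t => isOpen_interior.measurableSet)
    pairwise_disjoint_interior h2]

/-! ### Uniform triangulations -/

/-- All tetrahedra have diameter at most `h` and contain balls of radius `h / K`. -/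
structure Triangulation.IsUniform (𝒯 : Triangulation Ω) (K h : ℝ) : Prop where
  one_le : 1 ≤ K
  pos : 0 < h
  diam_le : ∀ t : 𝒯.elements, Metric.diam (tet (t : Finset E3)) ≤ h
  exists_ball : ∀ t : 𝒯.elements, ∃ c, Metric.closedBall c (h / K) ⊆ tet (t : Finset E3)

variable {K h : ℝ}

namespace Triangulation.IsUniform

variable (hu : 𝒯.IsUniform K h)
include hu

theorem K_pos : 0 < K := zero_lt_one.trans_le hu.one_le

theorem dist_le {t : 𝒯.elements} {x y : E3} (hx : x ∈ tet (t : Finset E3))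
    (hy : y ∈ tet (t : Finset E3)) : dist x y ≤ h :=
  (Metric.dist_le_diam_of_mem (isCompact_tet _).isBounded hx hy).trans (hu.diam_le t)

theorem tet_subset_closedBall {t : 𝒯.elements} {x : E3} (hx : x ∈ tet (t : Finset E3)) :
    tet (t : Finset E3) ⊆ Metric.closedBall x h := fun _ hy => hu.dist_le hy hx

/-- Barycentric coordinates vary by at most `1` over the inscribed ball of radius `h / K`, which
bounds their slope. -/
theorem abs_bary_sub_le (t : 𝒯.elements) (z x y : E3) :
    |bary 𝒯 t z x - bary 𝒯 t z y| ≤ K / h * ‖x - y‖ := by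
  obtain ⟨c, hc⟩ := hu.exists_ball t
  have hK := hu.K_pos
  have hh := hu.pos
  have e : bary 𝒯 t z x - bary 𝒯 t z y = (bary 𝒯 t z).linear (x - y) := by
    have := (bary 𝒯 t z).linearMap_vsub x y
    simpa using this.symm
  rcases eq_or_ne x y with rfl | hxy
  · simp
  have hn : 0 < ‖x - y‖ := norm_pos_iff.2 (sub_ne_zero.2 hxy)
  set s : ℝ := h / K / ‖x - y‖ with hs
  have hs0 : 0 < s := by positivity
  have h1 : c + s • (x - y) ∈ tet (t : Finset E3) := by
    refine hc ?_
    rw [Metric.mem_closedBall, dist_eq_norm, add_sub_cancel_left, norm_smul, Real.norm_eq_abs,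
      abs_of_pos hs0, hs, div_mul_cancel₀ _ hn.ne']
  have h2 : c ∈ tet (t : Finset E3) := hc (Metric.mem_closedBall_self (by positivity))
  have e2 : bary 𝒯 t z (c + s • (x - y)) - bary 𝒯 t z c = s * (bary 𝒯 t z).linear (x - y) := by
    have := (bary 𝒯 t z).linearMap_vsub (c + s • (x - y)) c
    simpa using this.symm
  have h3 : |s * (bary 𝒯 t z).linear (x - y)| ≤ 1 := by
    rw [← e2, abs_le]
    have := mem_tet_iff.1 h1 z
    have := mem_tet_iff.1 h2 z
    have := bary_le_one h1 z
    have := bary_le_one h2 z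
    constructor <;> linarith
  rw [e, abs_mul, abs_of_pos hs0] at *
  rw [show K / h * ‖x - y‖ = 1 / s by rw [hs]; field_simp, le_div_iff₀ hs0]
  linarith

theorem le_volume (t : 𝒯.elements) :
    ENNReal.ofReal ((h / K) ^ 3 * ballVol) ≤ volume (interior (tet (t : Finset E3))) := by
  obtain ⟨c, hc⟩ := hu.exists_ball t
  have hK := hu.K_pos
  have hh := hu.pos
  rw [← volume_ball_eq c (by positivity)]
  exact measure_mono (interior_maximal (Metric.ball_subset_closedBall.trans hc) Metric.isOpen_ball)

theorem volume_le (t : 𝒯.elements) :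
    volume (interior (tet (t : Finset E3))) ≤ ENNReal.ofReal (h ^ 3 * ballVol) := by
  obtain ⟨c, hc⟩ := hu.exists_ball t
  have hK := hu.K_pos
  have hh := hu.pos
  rw [← volume_closedBall_eq c hu.pos.le]
  exact measure_mono (interior_subset.trans
    (hu.tet_subset_closedBall (hc (Metric.mem_closedBall_self (by positivity)))))

theorem volume_ne_top (t : 𝒯.elements) : volume (interior (tet (t : Finset E3))) ≠ ⊤ :=
  ((hu.volume_le t).trans_lt ENNReal.ofReal_lt_top).ne

theorem volume_ne_zero (t : 𝒯.elements) : volume (interior (tet (t : Finset E3))) ≠ 0 := by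
  have hK := hu.K_pos
  have hh := hu.pos
  have := ballVol_pos
  refine ((ENNReal.ofReal_pos.2 ?_).trans_le (hu.le_volume t)).ne'
  positivity

theorem nonempty_interior (t : 𝒯.elements) : (interior (tet (t : Finset E3))).Nonempty := by
  by_contra h0
  rw [Set.not_nonempty_iff_eq_empty] at h0
  exact hu.volume_ne_zero t (by simp [h0])

theorem subset_closure_interior (t : 𝒯.elements) :
    tet (t : Finset E3) ⊆ closure (interior (tet (t : Finset E3))) := by
  rw [(convex_tet _).closure_interior_eq_closure_of_nonempty_interior (hu.nonempty_interior t)]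
  exact subset_closure

/-- A ball of radius `L h` contains at most `(L K)³` tetrahedra. -/
theorem card_le {S : Finset 𝒯.elements} {y : E3} {L : ℝ} (hL : 0 ≤ L)
    (hS : ∀ t ∈ S, tet (t : Finset E3) ⊆ Metric.closedBall y (L * h)) :
    (S.card : ℝ) ≤ (L * K) ^ 3 := by
  have hK := hu.K_pos
  have hh := hu.pos
  have hb := ballVol_pos
  have h1 : (S.card : ℝ≥0∞) * ENNReal.ofReal ((h / K) ^ 3 * ballVol) ≤
      ENNReal.ofReal ((L * h) ^ 3 * ballVol) := by
    rw [← volume_closedBall_eq y (ρ := L * h) (by positivity)]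
    calc (S.card : ℝ≥0∞) * ENNReal.ofReal ((h / K) ^ 3 * ballVol)
        = ∑ t ∈ S, ENNReal.ofReal ((h / K) ^ 3 * ballVol) := by simp
      _ ≤ ∑ t ∈ S, volume (interior (tet (t : Finset E3))) :=
          Finset.sum_le_sum fun t _ => hu.le_volume t
      _ = volume (⋃ t ∈ S, interior (tet (t : Finset E3))) := by
          rw [measure_biUnion_finset (fun t _ t' _ h => pairwise_disjoint_interior h)
            (fun t _ => isOpen_interior.measurableSet)]
      _ ≤ _ := measure_mono (Set.iUnion₂_subset fun t ht => interior_subset.trans (hS t ht))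
  rw [← ENNReal.ofReal_natCast, ← ENNReal.ofReal_mul (by positivity),
    ENNReal.ofReal_le_ofReal_iff (by positivity)] at h1
  have h2 : (S.card : ℝ) * ((h / K) ^ 3 * ballVol) ≤ (L * K) ^ 3 * ((h / K) ^ 3 * ballVol) := by
    refine h1.trans_eq ?_
    field_simp
  exact le_of_mul_le_mul_right h2 (by positivity)

end Triangulation.IsUniform

end Tetrahedra

/-! ### Mean values over neighbouring tetrahedra -/

section NeighbouringTetrahedra

theorem affineSpan_ne_top_of_card_le {s : Finset E3} (hs : s.card ≤ 3) :
    affineSpan ℝ (s : Set E3) ≠ ⊤ := by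
  classical
  rcases s.eq_empty_or_nonempty with rfl | hne
  · rw [Finset.coe_empty, AffineSubspace.span_empty]
    exact AffineSubspace.bot_ne_top ℝ E3 E3
  intro h
  obtain ⟨n, hn⟩ : ∃ n, s.card = n + 1 := ⟨s.card - 1, by have := hne.card_pos; omega⟩
  have h1 := finrank_vectorSpan_image_finset_le ℝ (id : E3 → E3) s hn
  rw [Finset.image_id, ← direction_affineSpan, h, AffineSubspace.direction_top, finrank_top,
    finrank_euclideanSpace, Fintype.card_fin] at h1
  omega

variable {Ω : Set E3} {𝒯 : Triangulation Ω} {K h : ℝ}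

open Classical in
/-- Within a convex open subset of `Ω`, any two tetrahedra are connected by a chain of tetrahedra
that share faces: a generic segment does not meet the edges. -/
theorem reflTransGen_of_convex (hu : 𝒯.IsUniform K h) {B : Set E3} (hB : IsOpen B)
    (hBc : Convex ℝ B) (hBΩ : B ⊆ Ω) {P : 𝒯.elements → Prop}
    (hP : ∀ t : 𝒯.elements, (tet (t : Finset E3) ∩ B).Nonempty → P t) {t₁ t₂ : 𝒯.elements}
    (h₁ : (tet (t₁ : Finset E3) ∩ B).Nonempty) (h₂ : (tet (t₂ : Finset E3) ∩ B).Nonempty) :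
    Relation.ReflTransGen
      (fun t t' => P t ∧ P t' ∧ 3 ≤ ((t : Finset E3) ∩ t').card) t₁ t₂ := by
  set R := fun t t' : 𝒯.elements => P t ∧ P t' ∧ 3 ≤ ((t : Finset E3) ∩ t').card
  have hopen : ∀ t : 𝒯.elements, (tet (t : Finset E3) ∩ B).Nonempty →
      (interior (tet (t : Finset E3)) ∩ B).Nonempty := by
    rintro t ⟨x, hx, hxB⟩
    rw [Set.inter_comm]
    exact mem_closure_iff.1 (hu.subset_closure_interior t hx) B hB hxB
  have hnull : ∀ s : Finset E3, s.card ≤ 3 → ∀ᵐ x : E3, x ∉ affineSpan ℝ (s : Set E3) :=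
    fun s hs => measure_eq_zero_iff_ae_notMem.1
      (Measure.addHaar_affineSubspace volume _ (affineSpan_ne_top_of_card_le hs))
  -- a generic segment from one tetrahedron to the other avoids all edges: `a` lies on none of the
  -- lines spanned by them, and `b` on none of the planes spanned by `a` and an edge
  obtain ⟨a, ⟨ha1, haB⟩, ha⟩ : ∃ a ∈ interior (tet (t₁ : Finset E3)) ∩ B,
      ∀ t t' : 𝒯.elements, ((t : Finset E3) ∩ t').card ≤ 2 →
        a ∉ affineSpan ℝ (((t : Finset E3) ∩ t' : Finset E3) : Set E3) := by
    have : ∀ᵐ x : E3, ∀ t t' : 𝒯.elements, ((t : Finset E3) ∩ t').card ≤ 2 →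
        x ∉ affineSpan ℝ (((t : Finset E3) ∩ t' : Finset E3) : Set E3) := by
      simp only [ae_all_iff]
      exact fun t t' hc => hnull _ (by omega)
    obtain ⟨a, ha, ha'⟩ := (Measure.dense_of_ae this).inter_open_nonempty _
      (isOpen_interior.inter hB) (hopen _ h₁)
    exact ⟨a, ha, ha'⟩
  obtain ⟨b, ⟨hb1, hbB⟩, hb⟩ : ∃ b ∈ interior (tet (t₂ : Finset E3)) ∩ B,
      ∀ t t' : 𝒯.elements, ((t : Finset E3) ∩ t').card ≤ 2 →
        b ∉ affineSpan ℝ ((insert a ((t : Finset E3) ∩ t') : Finset E3) : Set E3) := by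
    have : ∀ᵐ x : E3, ∀ t t' : 𝒯.elements, ((t : Finset E3) ∩ t').card ≤ 2 →
        x ∉ affineSpan ℝ ((insert a ((t : Finset E3) ∩ t') : Finset E3) : Set E3) := by
      simp only [ae_all_iff]
      exact fun t t' hc => hnull _ ((Finset.card_insert_le _ _).trans (by omega))
    obtain ⟨b, hb, hb'⟩ := (Measure.dense_of_ae this).inter_open_nonempty _
      (isOpen_interior.inter hB) (hopen _ h₂)
    exact ⟨b, hb, hb'⟩
  by_contra hcon
  -- otherwise the segment meets both a tetrahedron that is reached from `t₁` and one that is not,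
  -- at a common point, which belongs to an edge
  have hseg : segment ℝ a b ⊆ B := hBc.segment_subset haB hbB
  have hcl : ∀ Q : 𝒯.elements → Prop, IsClosed (⋃ t : {t // Q t}, tet (t.1 : Finset E3)) :=
    fun Q => isClosed_iUnion_of_finite fun t => isClosed_tet _
  obtain ⟨y, hy, hyA, hyB⟩ := isPreconnected_closed_iff.1 (convex_segment a b).isPreconnected
    _ _ (hcl (Relation.ReflTransGen R t₁)) (hcl fun t => ¬ Relation.ReflTransGen R t₁ t)
    (by
      intro x hx
      obtain ⟨t, ht⟩ := exists_mem_tet 𝒯 (subset_closure (hBΩ (hseg hx)))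
      by_cases hR : Relation.ReflTransGen R t₁ t
      · exact Or.inl (Set.mem_iUnion.2 ⟨⟨t, hR⟩, ht⟩)
      · exact Or.inr (Set.mem_iUnion.2 ⟨⟨t, hR⟩, ht⟩))
    ⟨a, left_mem_segment ℝ a b, Set.mem_iUnion.2 ⟨⟨t₁, .refl⟩, interior_subset ha1⟩⟩
    ⟨b, right_mem_segment ℝ a b, Set.mem_iUnion.2 ⟨⟨t₂, hcon⟩, interior_subset hb1⟩⟩
  obtain ⟨⟨t, ht⟩, hyt⟩ := Set.mem_iUnion.1 hyA
  obtain ⟨⟨t', ht'⟩, hyt'⟩ := Set.mem_iUnion.1 hyB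
  simp only at hyt hyt'
  refine ht' (ht.tail ⟨hP t ⟨y, hyt, hseg hy⟩, hP t' ⟨y, hyt', hseg hy⟩, ?_⟩)
  by_contra hcard
  have hcard' : ((t : Finset E3) ∩ t').card ≤ 2 := by omega
  have hys : y ∈ affineSpan ℝ (((t : Finset E3) ∩ t' : Finset E3) : Set E3) := by
    refine convexHull_subset_affineSpan _ ?_
    rw [Finset.coe_inter]
    exact 𝒯.inter_subset_convexHull t.2.1 t'.2.1 ⟨hyt, hyt'⟩
  rw [segment_eq_image_lineMap] at hy
  obtain ⟨θ, -, rfl⟩ := hy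
  have hθ : θ ≠ 0 := by
    rintro rfl
    rw [AffineMap.lineMap_apply_zero] at hys
    exact ha t t' hcard' hys
  refine hb t t' hcard' ?_
  have hb' : b = AffineMap.lineMap a (AffineMap.lineMap a b θ) θ⁻¹ := by
    simp [AffineMap.lineMap_apply, smul_smul, inv_mul_cancel₀ hθ]
  rw [hb']
  refine AffineMap.lineMap_mem _ (mem_affineSpan ℝ (by simp)) ?_
  exact affineSpan_mono ℝ (by simp) hys

theorem mem_of_vertex_mem_tet {t t' : 𝒯.elements} {z : E3} (hz : z ∈ (t : Finset E3))
    (hz' : z ∈ tet (t' : Finset E3)) : z ∈ (t' : Finset E3) := by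
  classical
  by_contra h
  have := bary_eq_of_mem (vertex_mem_tet hz) hz' z
  rw [bary_vertex hz hz, bary_of_notMem h] at this
  simp at this

open Classical in
/-- Two tetrahedra with a common vertex are connected by a chain of tetrahedra with this vertex
such that successive ones share a face. This uses the local connectedness of `Ω` at its
boundary. -/
theorem reflTransGen_of_vertex (hΩ : BoundedDomain Ω) (hu : 𝒯.IsUniform K h) {z : E3}
    {t t' : 𝒯.elements} (hz : z ∈ (t : Finset E3)) (hz' : z ∈ (t' : Finset E3)) :
    Relation.ReflTransGen (fun s s' : 𝒯.elements => z ∈ (s : Finset E3) ∧ z ∈ (s' : Finset E3) ∧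
      3 ≤ ((s : Finset E3) ∩ s').card) t t' := by
  set R := fun s s' : 𝒯.elements => z ∈ (s : Finset E3) ∧ z ∈ (s' : Finset E3) ∧
      3 ≤ ((s : Finset E3) ∩ s').card
  have hcl : ∀ Q : 𝒯.elements → Prop, IsClosed (⋃ t : {t // Q t}, tet (t.1 : Finset E3)) :=
    fun Q => isClosed_iUnion_of_finite fun t => isClosed_tet _
  -- a neighbourhood of `z` that meets only the tetrahedra with vertex `z`
  set U : Set E3 := (⋃ s : {s : 𝒯.elements // z ∉ (s : Finset E3)}, tet (s.1 : Finset E3))ᶜ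
  have hUo : IsOpen U := (hcl fun s => z ∉ (s : Finset E3)).isOpen_compl
  have hUz : z ∈ U := by
    intro hmem
    obtain ⟨⟨s, hs⟩, hs'⟩ := Set.mem_iUnion.1 hmem
    exact hs (mem_of_vertex_mem_tet hz hs')
  have hU : ∀ (s : 𝒯.elements), ∀ x ∈ U, x ∈ tet (s : Finset E3) → z ∈ (s : Finset E3) := by
    intro s x hx hxs
    by_contra h
    exact hx (Set.mem_iUnion.2 ⟨⟨s, h⟩, hxs⟩)
  obtain ⟨V, hVz, hVU, hV⟩ : ∃ V ∈ 𝓝 z, V ⊆ U ∧ IsConnected (V ∩ Ω) := by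
    by_cases hzΩ : z ∈ Ω
    · obtain ⟨ε, hε, hb⟩ := Metric.isOpen_iff.1 (hUo.inter hΩ.isOpen) z ⟨hUz, hzΩ⟩
      refine ⟨Metric.ball z ε, Metric.ball_mem_nhds z hε, fun x hx => (hb hx).1, ?_⟩
      rw [Set.inter_eq_left.2 fun x hx => (hb hx).2]
      exact (convex_ball z ε).isConnected ⟨z, Metric.mem_ball_self hε⟩
    · refine hΩ.connected_at_frontier z ?_ U (hUo.mem_nhds hUz)
      rw [hΩ.isOpen.frontier_eq]
      exact ⟨tet_subset_closure t (vertex_mem_tet hz), hzΩ⟩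
  have hmeet : ∀ s : 𝒯.elements, z ∈ (s : Finset E3) → ∃ x ∈ V ∩ Ω, x ∈ tet (s : Finset E3) := by
    intro s hs
    have h1 := hu.subset_closure_interior s (vertex_mem_tet hs)
    obtain ⟨x, hx, hx'⟩ := mem_closure_iff_nhds.1 h1 V hVz
    exact ⟨x, ⟨hx, interior_tet_subset hΩ s hx'⟩, interior_subset hx'⟩
  by_contra hcon
  obtain ⟨x, hxV, hxt⟩ := hmeet t hz
  obtain ⟨x', hxV', hxt'⟩ := hmeet t' hz'
  obtain ⟨y, ⟨hyV, hyΩ⟩, hyA, hyB⟩ := isPreconnected_closed_iff.1 hV.isPreconnected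
    _ _ (hcl (Relation.ReflTransGen R t)) (hcl fun s => ¬ Relation.ReflTransGen R t s)
    (by
      intro x hx
      obtain ⟨s, hs⟩ := exists_mem_tet 𝒯 (subset_closure hx.2)
      by_cases hR : Relation.ReflTransGen R t s
      · exact Or.inl (Set.mem_iUnion.2 ⟨⟨s, hR⟩, hs⟩)
      · exact Or.inr (Set.mem_iUnion.2 ⟨⟨s, hR⟩, hs⟩))
    ⟨x, hxV, Set.mem_iUnion.2 ⟨⟨t, .refl⟩, hxt⟩⟩
    ⟨x', hxV', Set.mem_iUnion.2 ⟨⟨t', hcon⟩, hxt'⟩⟩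
  -- near a point of `Ω` where a reached and an unreached tetrahedron meet, the convex case applies
  obtain ⟨⟨s, hs⟩, hys⟩ := Set.mem_iUnion.1 hyA
  obtain ⟨⟨s', hs'⟩, hys'⟩ := Set.mem_iUnion.1 hyB
  obtain ⟨ε, hε, hb⟩ := Metric.isOpen_iff.1 (hUo.inter hΩ.isOpen) y ⟨hVU hyV, hyΩ⟩
  refine hs' (hs.trans ?_)
  have hyb := Metric.mem_ball_self (x := y) hε
  exact reflTransGen_of_convex hu Metric.isOpen_ball (convex_ball y ε)
    (fun x hx => (hb hx).2) (P := fun s => z ∈ (s : Finset E3))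
    (fun s ⟨x, hxs, hxb⟩ => hU s x (hb hxb).1 hxs) ⟨y, hys, hyb⟩ ⟨y, hys', hyb⟩

/-- Along a chain without repetitions, a function varies by at most the number of elements times
the variation in a single step. -/
theorem edist_le_card_mul_of_reflTransGen {ι F : Type*} [PseudoEMetricSpace F] {R : ι → ι → Prop}
    (hsymm : ∀ a b, R a b → R b a) {S : Finset ι} (hS : ∀ a b, R a b → a ∈ S) {f : ι → F}
    {D : ℝ≥0∞} (hf : ∀ a b, R a b → edist (f a) (f b) ≤ D) {a b : ι}
    (hab : Relation.ReflTransGen R a b) : edist (f a) (f b) ≤ S.card * D := by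
  classical
  set H : SimpleGraph ι := SimpleGraph.fromRel R with hH
  have hadj : ∀ a b, H.Adj a b → R a b := by
    intro a b h
    rw [hH, SimpleGraph.fromRel_adj] at h
    exact h.2.elim id (hsymm _ _)
  have hreach : H.Reachable a b := by
    induction hab with
    | refl => exact .refl _
    | tail _ h ih =>
      rename_i x y _
      rcases eq_or_ne x y with rfl | hne
      · exact ih
      · exact ih.trans (SimpleGraph.Adj.reachable
          ((SimpleGraph.fromRel_adj R x y).2 ⟨hne, Or.inl h⟩))
  -- a path has no repetitions, so its length is at most the number of elements
  obtain ⟨p, hp⟩ := hreach.exists_isPath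
  have hwalk : ∀ {x y : ι} (q : H.Walk x y), edist (f x) (f y) ≤ q.length * D := by
    intro x y q
    induction q with
    | nil => simp
    | cons h q ih =>
      rename_i u v _
      refine (edist_triangle _ (f v) _).trans ?_
      rw [SimpleGraph.Walk.length_cons, Nat.cast_add, Nat.cast_one, add_mul, one_mul, add_comm]
      exact add_le_add ih (hf _ _ (hadj _ _ h))
  refine (hwalk p).trans ?_
  gcongr
  have hsub : ∀ {x y : ι} (q : H.Walk x y), ∀ u ∈ q.support.dropLast, u ∈ S := by
    intro x y q
    induction q with
    | nil => simp
    | cons h q ih =>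
      rw [SimpleGraph.Walk.support_cons, List.dropLast_cons_of_ne_nil q.support_ne_nil]
      intro u hu
      rcases List.mem_cons.1 hu with rfl | hu
      · exact hS _ _ (hadj _ _ h)
      · exact ih u hu
  have h1 : p.length = p.support.dropLast.toFinset.card := by
    rw [List.toFinset_card_of_nodup (hp.support_nodup.sublist (List.dropLast_sublist _)),
      List.length_dropLast, SimpleGraph.Walk.length_support, Nat.add_sub_cancel]
  rw [h1]
  exact Finset.card_le_card fun u hu => hsub p u (List.mem_toFinset.1 hu)

theorem le_ofReal_div_mul {a b : ℝ} {X I : ℝ≥0∞} (ha : 0 < a)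
    (hX : ENNReal.ofReal a * X ≤ ENNReal.ofReal b * I) : X ≤ ENNReal.ofReal (b / a) * I := by
  rw [ENNReal.ofReal_div_of_pos ha, ENNReal.mul_div_right_comm.symm]
  rw [ENNReal.le_div_iff_mul_le (Or.inl (by simpa using ha)) (Or.inl ENNReal.ofReal_ne_top)]
  rwa [mul_comm]

open Classical in
/-- Two tetrahedra that share a face cover a ball around the barycentre of the face. -/
theorem exists_ball_subset_union (hu : 𝒯.IsUniform K h) {t t' : 𝒯.elements}
    (hcard : 3 ≤ ((t : Finset E3) ∩ t').card) :
    ∃ x₀, x₀ ∈ tet (t : Finset E3) ∧ x₀ ∈ tet (t' : Finset E3) ∧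
      Metric.ball x₀ (h / (3 * K)) ⊆ tet (t : Finset E3) ∪ tet (t' : Finset E3) := by
  have hK := hu.K_pos
  have hh := hu.pos
  set s := (t : Finset E3) ∩ t' with hs
  have hst : s ⊆ t := Finset.inter_subset_left
  have hst' : s ⊆ t' := Finset.inter_subset_right
  by_cases hle : 4 ≤ s.card
  · have h1 : s = t := Finset.eq_of_subset_of_card_le hst (by rw [t.2.2]; exact hle)
    have h2 : s = t' := Finset.eq_of_subset_of_card_le hst' (by rw [t'.2.2]; exact hle)
    have h3 : t = t' := Subtype.ext (h1.symm.trans h2)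
    subst h3
    obtain ⟨c, hc⟩ := hu.exists_ball t
    have hc' : c ∈ tet (t : Finset E3) := hc (Metric.mem_closedBall_self (by positivity))
    refine ⟨c, hc', hc', ?_⟩
    rw [Set.union_self]
    refine subset_trans ?_ hc
    refine Metric.ball_subset_closedBall.trans (Metric.closedBall_subset_closedBall ?_)
    gcongr
    linarith
  have hs3 : s.card = 3 := by omega
  obtain ⟨d, hd⟩ : ∃ d, (t : Finset E3) \ s = {d} := Finset.card_eq_one.1 (by
    rw [Finset.card_sdiff_of_subset hst, t.2.2, hs3])
  obtain ⟨d', hd'⟩ : ∃ d', (t' : Finset E3) \ s = {d'} := Finset.card_eq_one.1 (by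
    rw [Finset.card_sdiff_of_subset hst', t'.2.2, hs3])
  have hdt : d ∈ (t : Finset E3) ∧ d ∉ s := Finset.mem_sdiff.1 (hd ▸ Finset.mem_singleton_self d)
  have hdt' : d' ∈ (t' : Finset E3) ∧ d' ∉ s :=
    Finset.mem_sdiff.1 (hd' ▸ Finset.mem_singleton_self d')
  have hins : ∀ z ∈ (t : Finset E3), z ∈ s ∨ z = d := by
    intro z hz
    by_contra! hcon
    have : z ∈ (t : Finset E3) \ s := Finset.mem_sdiff.2 ⟨hz, hcon.1⟩
    rw [hd, Finset.mem_singleton] at this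
    exact hcon.2 this
  have hins' : ∀ z ∈ (t' : Finset E3), z ∈ s ∨ z = d' := by
    intro z hz
    by_contra! hcon
    have : z ∈ (t' : Finset E3) \ s := Finset.mem_sdiff.2 ⟨hz, hcon.1⟩
    rw [hd', Finset.mem_singleton] at this
    exact hcon.2 this
  set x₀ : E3 := ∑ y ∈ s, (1 / 3 : ℝ) • y with hx₀
  have hw : ∑ y ∈ s, (fun _ => (1 / 3 : ℝ)) y = 1 := by simp [hs3]
  have hb0 : ∀ {u : 𝒯.elements}, s ⊆ u → ∀ z, bary 𝒯 u z x₀ = if z ∈ s then 1 / 3 else 0 :=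
    fun {u} hsu z => bary_sum_smul hsu hw z
  have hx0 : ∀ {u : 𝒯.elements}, s ⊆ u → x₀ ∈ tet (u : Finset E3) := by
    intro u hsu
    rw [mem_tet_iff]
    intro z
    rw [hb0 hsu]
    split_ifs <;> norm_num
  have hpos : ∀ {u : 𝒯.elements}, s ⊆ u → ∀ z ∈ s, ∀ x ∈ Metric.ball x₀ (h / (3 * K)),
      0 < bary 𝒯 u z x := by
    intro u hsu z hz x hx
    have h1 := hu.abs_bary_sub_le u z x x₀
    rw [hb0 hsu, if_pos hz] at h1
    rw [Metric.mem_ball, dist_eq_norm] at hx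
    have h2 : K / h * ‖x - x₀‖ < K / h * (h / (3 * K)) := by gcongr
    have h3 : K / h * (h / (3 * K)) = 1 / 3 := by field_simp
    have := (abs_le.1 h1).1
    linarith
  -- the coordinates of the two opposite vertices both vanish on the face, hence are proportional
  set κ := bary 𝒯 t' d' d with hκ
  have hprop : ∀ x, bary 𝒯 t' d' x = bary 𝒯 t d x * κ := by
    intro x
    rw [affineMap_eq_sum_bary (bary 𝒯 t' d') t x, Finset.sum_eq_single_of_mem d hdt.1]
    intro z hz hzd
    rcases hins z hz with hzs | hzd'
    · rw [bary_vertex hdt'.1 (hst' hzs), if_neg, mul_zero]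
      rintro rfl
      exact hdt'.2 hzs
    · exact absurd hzd' hzd
  have hmem : ∀ x ∈ Metric.ball x₀ (h / (3 * K)), 0 ≤ bary 𝒯 t d x → x ∈ tet (t : Finset E3) := by
    intro x hx h0
    rw [mem_tet_iff]
    intro z
    by_cases hz : z ∈ (t : Finset E3)
    · rcases hins z hz with hzs | rfl
      · exact (hpos hst z hzs x hx).le
      · exact h0
    · rw [bary_of_notMem hz]
  have hmem' : ∀ x ∈ Metric.ball x₀ (h / (3 * K)), 0 ≤ bary 𝒯 t' d' x →
      x ∈ tet (t' : Finset E3) := by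
    intro x hx h0
    rw [mem_tet_iff]
    intro z
    by_cases hz : z ∈ (t' : Finset E3)
    · rcases hins' z hz with hzs | rfl
      · exact (hpos hst' z hzs x hx).le
      · exact h0
    · rw [bary_of_notMem hz]
  -- the opposite vertices lie on different sides of the common face
  have hκ0 : κ ≤ 0 := by
    by_contra! hκ0
    have hcont : Filter.Tendsto (fun ε : ℝ => x₀ + ε • (d - x₀)) (𝓝[>] 0) (𝓝 x₀) := by
      have : Continuous fun ε : ℝ => x₀ + ε • (d - x₀) := by fun_prop
      have h1 := this.tendsto 0
      simp only [zero_smul, add_zero] at h1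
      exact h1.mono_left nhdsWithin_le_nhds
    have h1 := hcont.eventually (Metric.ball_mem_nhds x₀ (by positivity : 0 < h / (3 * K)))
    obtain ⟨ε, hε, hε0⟩ := (h1.and self_mem_nhdsWithin).exists
    have hε0 : 0 < ε := hε0
    have h2 : bary 𝒯 t d (x₀ + ε • (d - x₀)) = ε := by
      have h3 : x₀ + ε • (d - x₀) = AffineMap.lineMap x₀ d ε := by
        simp [AffineMap.lineMap_apply, add_comm]
      rw [h3, AffineMap.apply_lineMap, hb0 hst, if_neg hdt.2, bary_vertex hdt.1 hdt.1, if_pos rfl]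
      simp [AffineMap.lineMap_apply]
    have h4 := hmem _ hε (by rw [h2]; exact hε0.le)
    have h5 := hmem' _ hε (by rw [hprop, h2]; positivity)
    have h6 := bary_eq_of_mem h4 h5 d
    rw [h2, bary_of_notMem (t := t') (z := d)] at h6
    · exact hε0.ne' h6
    · exact fun h => hdt.2 (Finset.mem_inter.2 ⟨hdt.1, h⟩)
  refine ⟨x₀, hx0 hst, hx0 hst', fun x hx => ?_⟩
  rcases le_total 0 (bary 𝒯 t d x) with h0 | h0
  · exact Or.inl (hmem x hx h0)
  · exact Or.inr (hmem' x hx (by rw [hprop]; exact mul_nonneg_of_nonpos_of_nonpos h0 hκ0))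

/-- The inscribed ball of a tetrahedron, shrunk towards a point `x₀` of the tetrahedron, is a ball
close to `x₀`. -/
theorem exists_small_ball (hu : 𝒯.IsUniform K h) {t : 𝒯.elements} {x₀ : E3}
    (hx₀ : x₀ ∈ tet (t : Finset E3)) :
    ∃ c, Metric.ball c (h / (6 * K ^ 2)) ⊆ interior (tet (t : Finset E3)) ∧
      Metric.ball c (h / (6 * K ^ 2)) ⊆ Metric.ball x₀ (h / (3 * K)) := by
  have hK := hu.K_pos
  have hh := hu.pos
  obtain ⟨c, hc⟩ := hu.exists_ball t
  have hcm : c ∈ tet (t : Finset E3) := hc (Metric.mem_closedBall_self (by positivity))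
  set η : ℝ := 1 / (6 * K) with hη
  have hη0 : 0 < η := by positivity
  have hη1 : η ≤ 1 := by
    rw [hη, div_le_one (by positivity)]; linarith [hu.one_le]
  refine ⟨x₀ + η • (c - x₀), ?_, ?_⟩
  · refine interior_maximal (fun x hx => ?_) Metric.isOpen_ball
    set q := x₀ + η⁻¹ • (x - x₀) with hq
    have hqt : q ∈ tet (t : Finset E3) := by
      refine hc ?_
      rw [Metric.mem_closedBall, dist_eq_norm]
      have e : q - c = η⁻¹ • (x - (x₀ + η • (c - x₀))) := by
        rw [hq, ← sub_sub x, smul_sub _ (x - x₀), smul_smul, inv_mul_cancel₀ hη0.ne', one_smul]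
        abel
      rw [e, norm_smul, Real.norm_of_nonneg (by positivity)]
      rw [Metric.mem_ball, dist_eq_norm] at hx
      calc η⁻¹ * ‖x - (x₀ + η • (c - x₀))‖ ≤ η⁻¹ * (h / (6 * K ^ 2)) := by gcongr
        _ = h / K := by rw [hη]; field_simp
    have := (convex_tet _) hx₀ hqt (sub_nonneg.2 hη1) hη0.le (by ring)
    convert this using 1
    rw [hq, smul_add, smul_smul, mul_inv_cancel₀ hη0.ne', one_smul]
    module
  · refine Metric.ball_subset_ball' ?_
    have h1 : dist (x₀ + η • (c - x₀)) x₀ ≤ η * h := by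
      rw [dist_eq_norm, add_sub_cancel_left, norm_smul, Real.norm_of_nonneg hη0.le, ← dist_eq_norm]
      gcongr
      exact hu.dist_le hcm hx₀
    have h2 : h / (6 * K ^ 2) ≤ h / (6 * K) := by
      gcongr
      nlinarith [hu.one_le]
    have h3 : η * h = h / (6 * K) := by rw [hη]; ring
    have h4 : h / (3 * K) = h / (6 * K) + h / (6 * K) := by field_simp; norm_num
    linarith

section

variable {w : E3 → E3} {g : E3 → E3 →L[ℝ] E3}

/-- The constant in the comparison of mean values over tetrahedra that share a face. -/
def faceConst (K : ℝ) : ℝ := 16 * (6 * K ^ 2) ^ 3 / ballVol + 8 * ((6 * K ^ 2) ^ 3) ^ 2 / ballVol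

open Classical in
/-- Comparison of the mean values over two tetrahedra that share a face. Each mean is compared
with the mean over a small ball inside the tetrahedron; both balls lie in a larger ball around a
point of the common face, which is convex and contained in `Ω`. -/
theorem average_sub_average_le_of_face (hΩ : BoundedDomain Ω) (hu : 𝒯.IsUniform K h)
    (hwg : HasWeakFDeriv Ω w g) (hw : IntegrableOn w Ω) (hg : IntegrableOn g Ω)
    {z : E3} {t t' : 𝒯.elements} (hz : z ∈ (t : Finset E3)) (hz' : z ∈ (t' : Finset E3))
    (hcard : 3 ≤ ((t : Finset E3) ∩ t').card) :
    ‖(⨍ x in interior (tet (t : Finset E3)), w x) - ⨍ x in interior (tet (t' : Finset E3)), w x‖ₑ ≤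
      ENNReal.ofReal (faceConst K / h ^ 2) * ∫⁻ x in Ω ∩ Metric.closedBall z h, ‖g x‖ₑ := by
  have hK := hu.K_pos
  have hh := hu.pos
  have hb := ballVol_pos
  obtain ⟨x₀, hx₀, hx₀', hU⟩ := exists_ball_subset_union hu hcard
  obtain ⟨c, hc, hcU⟩ := exists_small_ball hu hx₀
  obtain ⟨c', hc', hcU'⟩ := exists_small_ball hu hx₀'
  set I := ∫⁻ x in Ω ∩ Metric.closedBall z h, ‖g x‖ₑ
  set a : ℝ := (h / (6 * K ^ 2)) ^ 3 * ballVol with ha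
  have ha0 : 0 < a := by positivity
  have hvolA : ∀ y : E3, volume (Metric.ball y (h / (6 * K ^ 2))) = ENNReal.ofReal a :=
    fun y => volume_ball_eq y (by positivity)
  have hUΩ : Metric.ball x₀ (h / (3 * K)) ⊆ Ω := subset_of_subset_closure hΩ Metric.isOpen_ball
    (hU.trans (Set.union_subset (tet_subset_closure t) (tet_subset_closure t')))
  have hIt : ∀ {s : 𝒯.elements}, z ∈ (s : Finset E3) →
      ∫⁻ x in interior (tet (s : Finset E3)), ‖g x‖ₑ ≤ I := fun {s} hs =>
    lintegral_mono_set (Set.subset_inter (interior_tet_subset hΩ s)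
      (interior_subset.trans (hu.tet_subset_closedBall (vertex_mem_tet hs))))
  have hIU : ∫⁻ x in Metric.ball x₀ (h / (3 * K)), ‖g x‖ₑ ≤ I :=
    lintegral_mono_set (Set.subset_inter hUΩ (hU.trans (Set.union_subset
      (hu.tet_subset_closedBall (vertex_mem_tet hz))
      (hu.tet_subset_closedBall (vertex_mem_tet hz')))))
  -- comparison of the mean over a tetrahedron with the mean over a small ball in it
  have step1 : ∀ {s : 𝒯.elements} {y : E3}, z ∈ (s : Finset E3) →
      Metric.ball y (h / (6 * K ^ 2)) ⊆ interior (tet (s : Finset E3)) →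
      ‖(⨍ x in interior (tet (s : Finset E3)), w x) -
        ⨍ x in Metric.ball y (h / (6 * K ^ 2)), w x‖ₑ ≤ ENNReal.ofReal (8 * h / a) * I := by
    intro s y hs hy
    have h1 := hwg.enorm_average_sub_average_le hΩ.isOpen hw hg isOpen_interior
      (interior_tet_subset hΩ s) (convex_tet _).interior (d := h)
      (fun p hp q hq => by
        rw [← dist_eq_norm]; exact hu.dist_le (interior_subset hp) (interior_subset hq))
      subset_rfl hy (hu.volume_ne_top s) (by rw [hvolA]; exact ENNReal.ofReal_ne_top)
    refine le_ofReal_div_mul ha0 ?_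
    rw [← ENNReal.mul_le_mul_iff_right (hu.volume_ne_zero s) (hu.volume_ne_top s), ← mul_assoc,
      ← hvolA y]
    refine h1.trans ?_
    rw [ENNReal.ofReal_mul (by norm_num), ENNReal.ofReal_ofNat]
    calc _ = volume (interior (tet (s : Finset E3))) * (8 * ENNReal.ofReal h *
          ∫⁻ x in interior (tet (s : Finset E3)), ‖g x‖ₑ) := by ring
      _ ≤ _ := by gcongr; exact hIt hs
  -- comparison of the means over the two small balls
  have step2 : ‖(⨍ x in Metric.ball c (h / (6 * K ^ 2)), w x) -
        ⨍ x in Metric.ball c' (h / (6 * K ^ 2)), w x‖ₑ ≤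
        ENNReal.ofReal (8 * h * (h ^ 3 * ballVol) / (a * a)) * I := by
    have h1 := hwg.enorm_average_sub_average_le hΩ.isOpen hw hg Metric.isOpen_ball hUΩ
      (convex_ball _ _) (d := h)
      (fun p hp q hq => by
        rw [← dist_eq_norm]
        have h1 := dist_triangle_right p q x₀
        rw [Metric.mem_ball] at hp hq
        have h2 : h / (3 * K) + h / (3 * K) ≤ h := by
          rw [← add_div, div_le_iff₀ (by positivity)]
          nlinarith [hu.one_le]
        linarith)
      hcU hcU' (by rw [hvolA]; exact ENNReal.ofReal_ne_top)
      (by rw [hvolA]; exact ENNReal.ofReal_ne_top)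
    refine le_ofReal_div_mul (by positivity) ?_
    rw [ENNReal.ofReal_mul ha0.le]
    rw [hvolA, hvolA] at h1
    refine h1.trans ?_
    rw [ENNReal.ofReal_mul (by positivity), ENNReal.ofReal_mul (by norm_num),
      ENNReal.ofReal_ofNat]
    gcongr
    rw [volume_ball_eq _ (by positivity)]
    refine ENNReal.ofReal_le_ofReal ?_
    gcongr
    rw [div_le_iff₀ (by positivity)]
    nlinarith [hu.one_le]
  have htri : ∀ p q r s : E3, ‖p - q‖ₑ ≤ ‖p - r‖ₑ + ‖r - s‖ₑ + ‖q - s‖ₑ := by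
    intro p q r s
    simp only [← edist_eq_enorm_sub]
    rw [edist_comm q s]
    exact edist_triangle4 _ _ _ _
  refine (htri _ _ _ _).trans ((add_le_add (add_le_add (step1 hz hc) step2) (step1 hz' hc')).trans
    (le_of_eq ?_))
  rw [← add_mul, ← add_mul, ← ENNReal.ofReal_add (by positivity) (by positivity),
    ← ENNReal.ofReal_add (by positivity) (by positivity)]
  congr 2
  rw [faceConst, ha]
  field_simp
  ring

/-- Comparison of the mean values over two tetrahedra with a common vertex. -/
theorem average_sub_average_le_of_vertex (hΩ : BoundedDomain Ω) (hu : 𝒯.IsUniform K h)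
    (hwg : HasWeakFDeriv Ω w g) (hw : IntegrableOn w Ω) (hg : IntegrableOn g Ω)
    {z : E3} {t t' : 𝒯.elements} (hz : z ∈ (t : Finset E3)) (hz' : z ∈ (t' : Finset E3)) :
    ‖(⨍ x in interior (tet (t : Finset E3)), w x) - ⨍ x in interior (tet (t' : Finset E3)), w x‖ₑ ≤
      ENNReal.ofReal (K ^ 3 * (faceConst K / h ^ 2)) *
        ∫⁻ x in Ω ∩ Metric.closedBall z h, ‖g x‖ₑ := by
  classical
  set S : Finset 𝒯.elements := Finset.univ.filter fun s => z ∈ (s : Finset E3) with hS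
  have h1 := edist_le_card_mul_of_reflTransGen
    (f := fun s : 𝒯.elements => ⨍ x in interior (tet (s : Finset E3)), w x) (S := S)
    (fun a b hab => ⟨hab.2.1, hab.1, by rw [Finset.inter_comm]; exact hab.2.2⟩)
    (fun a b hab => by rw [hS, Finset.mem_filter]; exact ⟨Finset.mem_univ _, hab.1⟩)
    (fun a b hab => by
      rw [edist_eq_enorm_sub]
      exact average_sub_average_le_of_face hΩ hu hwg hw hg hab.1 hab.2.1 hab.2.2)
    (reflTransGen_of_vertex hΩ hu hz hz')
  rw [edist_eq_enorm_sub] at h1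
  refine h1.trans ?_
  have h2 : (S.card : ℝ) ≤ (1 * K) ^ 3 := hu.card_le (y := z) zero_le_one fun s hs => by
    rw [one_mul]
    exact hu.tet_subset_closedBall (vertex_mem_tet (Finset.mem_filter.1 hs).2)
  have hK := hu.K_pos
  rw [ENNReal.ofReal_mul (by positivity), mul_assoc, ← ENNReal.ofReal_natCast]
  gcongr
  simpa using h2

end

end NeighbouringTetrahedra

/-! ### The reference simplex -/

open Classical in
/-- A homogeneous polynomial that vanishes on the open face of the standard simplex spanned by `s`
has no monomials supported in `s`. -/
theorem coeff_eq_zero_of_eval_eq_zero {σ : Type*} {p : MvPolynomial σ ℝ} {n : ℕ}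
    (hp : p.IsHomogeneous n) {s : Finset σ} (hs : s.Nonempty)
    (h : ∀ w : σ → ℝ, (∀ z ∈ s, 0 < w z) → (∀ z ∉ s, w z = 0) → ∑ z ∈ s, w z = 1 →
      MvPolynomial.eval w p = 0) {α : σ →₀ ℕ} (hα : α.support ⊆ s) : p.coeff α = 0 := by
  -- the part `q` of `p` supported in `s` vanishes on the positive orthant, by homogeneity
  set q : MvPolynomial σ ℝ := ∑ β ∈ p.support.filter fun β => β.support ⊆ s,
    MvPolynomial.monomial β (p.coeff β) with hq
  have hcoeff : q.coeff α = p.coeff α := by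
    rw [hq, MvPolynomial.coeff_sum]
    simp only [MvPolynomial.coeff_monomial]
    rw [Finset.sum_ite_eq']
    split_ifs with h1
    · rfl
    · rw [Finset.mem_filter, not_and] at h1
      by_contra h2
      exact h1 (MvPolynomial.mem_support_iff.2 (Ne.symm h2)) hα
  have hev : ∀ u : σ → ℝ, MvPolynomial.eval u q =
      ∑ β ∈ p.support.filter fun β => β.support ⊆ s, p.coeff β * β.prod fun z k => u z ^ k := by
    intro u
    rw [hq, map_sum]
    simp only [MvPolynomial.eval_monomial]
  suffices hq0 : q = 0 by rw [← hcoeff, hq0, MvPolynomial.coeff_zero]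
  refine MvPolynomial.funext_set (fun _ => Set.Ioi (0 : ℝ)) (fun _ => Set.Ioi_infinite 0)
    fun u hu => ?_
  rw [map_zero]
  have hu' : ∀ z, 0 < u z := fun z => hu z (Set.mem_univ z)
  set S := ∑ z ∈ s, u z with hS
  have hS0 : 0 < S := Finset.sum_pos (fun z _ => hu' z) hs
  set w : σ → ℝ := fun z => if z ∈ s then S⁻¹ * u z else 0 with hw
  have hwin : ∀ z ∈ s, w z = S⁻¹ * u z := fun z hz => if_pos hz
  have hwout : ∀ z ∉ s, w z = 0 := fun z hz => if_neg hz
  have h1 : MvPolynomial.eval w p = 0 := by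
    refine h w (fun z hz => ?_) hwout ?_
    · rw [hwin z hz]
      have := hu' z
      positivity
    · rw [Finset.sum_congr rfl fun z hz => hwin z hz, ← Finset.mul_sum,
        inv_mul_cancel₀ hS0.ne']
  have h2 : MvPolynomial.eval w p = S⁻¹ ^ n * MvPolynomial.eval u q := by
    rw [hev, MvPolynomial.eval_eq, Finset.mul_sum, ← Finset.sum_filter_add_sum_filter_not p.support
      fun β => β.support ⊆ s]
    rw [Finset.sum_eq_zero (s := p.support.filter fun β => ¬ β.support ⊆ s), add_zero]
    · refine Finset.sum_congr rfl fun β hβ => ?_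
      obtain ⟨hβ1, hβ2⟩ := Finset.mem_filter.1 hβ
      have hdeg : β.degree = n := by
        by_contra hne
        exact MvPolynomial.mem_support_iff.1 hβ1 (hp.coeff_eq_zero hne)
      have : ∏ i ∈ β.support, w i ^ β i = S⁻¹ ^ n * ∏ i ∈ β.support, u i ^ β i := by
        rw [← hdeg, Finsupp.degree_apply, ← Finset.prod_pow_eq_pow_sum, ← Finset.prod_mul_distrib]
        refine Finset.prod_congr rfl fun i hi => ?_
        rw [hwin i (hβ2 hi), mul_pow]
      rw [this, Finsupp.prod]
      ring
    · intro β hβ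
      obtain ⟨hβ1, hβ2⟩ := Finset.mem_filter.1 hβ
      obtain ⟨z, hz, hzs⟩ := Finset.not_subset.1 hβ2
      rw [Finset.prod_eq_zero hz, mul_zero]
      rw [hwout z hzs, zero_pow (Finsupp.mem_support_iff.1 hz)]
  rw [h2] at h1
  exact (mul_eq_zero.1 h1).resolve_left (pow_ne_zero _ (inv_ne_zero hS0.ne'))

/-- Multi-indices of degree `r` in four variables. -/
abbrev RefIdx (r : ℕ) : Type := {d : Fin 4 →₀ ℕ // d.degree = r}

instance (r : ℕ) : Finite (RefIdx r) := (Finsupp.finite_of_degree_eq r).to_subtype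

instance (r : ℕ) : Fintype (RefIdx r) := Fintype.ofFinite _

/-- Barycentric coordinates with respect to the reference simplex with vertices
`0, e₀, e₁, e₂`. -/
def refBary (y : E3) : Fin 4 → ℝ := Fin.cons (1 - ∑ i, y i) fun i => y i

theorem refBary_zero (y : E3) : refBary y 0 = 1 - ∑ i, y i := rfl

theorem refBary_succ (y : E3) (i : Fin 3) : refBary y i.succ = y i := rfl

theorem continuous_refBary (i : Fin 4) : Continuous fun y => refBary y i := by
  refine Fin.cases ?_ (fun i => ?_) i
  · simp only [refBary_zero]; fun_prop
  · simp only [refBary_succ]; fun_prop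

theorem sum_refBary (y : E3) : ∑ i, refBary y i = 1 := by
  rw [Fin.sum_univ_succ]
  simp [refBary_zero, refBary_succ]

/-- The open reference simplex. -/
def refSimplex : Set E3 := {y | ∀ i, 0 < refBary y i}

theorem isOpen_refSimplex : IsOpen refSimplex := by
  have : refSimplex = ⋂ i, {y | 0 < refBary y i} := by ext; simp [refSimplex]
  rw [this]
  exact isOpen_iInter_of_finite fun i => isOpen_lt continuous_const (continuous_refBary i)

theorem refBary_le_one {y : E3} (hy : y ∈ refSimplex) (i : Fin 4) : refBary y i ≤ 1 := by
  rw [← sum_refBary y]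
  exact Finset.single_le_sum (f := refBary y) (fun j _ => (hy j).le) (Finset.mem_univ i)

theorem volume_refSimplex_lt_top : volume refSimplex < ⊤ := by
  have : refSimplex ⊆ Metric.closedBall 0 2 := by
    intro y hy
    rw [mem_closedBall_zero_iff, EuclideanSpace.norm_eq]
    refine Real.sqrt_le_iff.2 ⟨by norm_num, ?_⟩
    have h1 : ∀ i : Fin 3, ‖y i‖ ^ 2 ≤ 1 := by
      intro i
      have h2 := hy i.succ
      have h3 := refBary_le_one hy i.succ
      rw [refBary_succ] at h2 h3
      rw [Real.norm_eq_abs, sq_abs]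
      nlinarith
    calc ∑ i, ‖y i‖ ^ 2 ≤ ∑ i : Fin 3, (1 : ℝ) := Finset.sum_le_sum fun i _ => h1 i
      _ ≤ 2 ^ 2 := by norm_num
  exact (measure_mono this).trans_lt measure_closedBall_lt_top

instance : IsFiniteMeasure (volume.restrict refSimplex) :=
  ⟨by simpa using volume_refSimplex_lt_top⟩

/-- The monomials in the barycentric coordinates of the reference simplex. -/
def refMono {r : ℕ} (d : RefIdx r) (y : E3) : ℝ := d.1.prod fun i n => refBary y i ^ n

theorem continuous_refMono {r : ℕ} (d : RefIdx r) : Continuous (refMono d) := by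
  unfold refMono Finsupp.prod
  exact continuous_finsetProd _ fun i _ => (continuous_refBary i).pow _

theorem abs_refMono_le {r : ℕ} (d : RefIdx r) {y : E3} (hy : y ∈ refSimplex) :
    ‖refMono d y‖ ≤ 1 := by
  rw [refMono, Finsupp.prod, Real.norm_eq_abs, Finset.abs_prod]
  refine Finset.prod_le_one (fun i _ => abs_nonneg _) fun i _ => ?_
  rw [abs_of_nonneg (pow_nonneg (hy i).le _)]
  exact pow_le_one₀ (hy i).le (refBary_le_one hy i)

theorem memLp_refMono {r : ℕ} (d : RefIdx r) :
    MemLp (refMono d) 1 (volume.restrict refSimplex) := by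
  refine MemLp.of_bound (continuous_refMono d).aestronglyMeasurable 1 ?_
  filter_upwards [ae_restrict_mem isOpen_refSimplex.measurableSet] with y hy
  exact abs_refMono_le d hy

theorem exists_refSimplex_eq (w : Fin 4 → ℝ) (hw : ∑ i, w i = 1) : ∃ y, refBary y = w := by
  refine ⟨WithLp.toLp 2 fun i : Fin 3 => w i.succ, ?_⟩
  ext i
  refine Fin.cases ?_ (fun i => ?_) i
  · rw [refBary_zero]
    rw [Fin.sum_univ_succ] at hw
    simp only
    linarith
  · rw [refBary_succ]

/-- The monomials of degree `r` in the barycentric coordinates are linearly independent. -/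
theorem eq_zero_of_refMono {r : ℕ} {c : RefIdx r → ℝ}
    (hc : ∀ y ∈ refSimplex, ∑ d, c d * refMono d y = 0) : c = 0 := by
  classical
  set p : MvPolynomial (Fin 4) ℝ := ∑ d, MvPolynomial.monomial d.1 (c d) with hp
  have hph : p.IsHomogeneous r :=
    MvPolynomial.IsHomogeneous.sum _ _ _ fun d _ => MvPolynomial.isHomogeneous_monomial _ d.2
  ext d
  have h1 := coeff_eq_zero_of_eval_eq_zero hph (s := Finset.univ) Finset.univ_nonempty
    (fun w hw _ hw1 => ?_) (Finset.subset_univ d.1.support)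
  · rw [hp, MvPolynomial.coeff_sum] at h1
    simp only [MvPolynomial.coeff_monomial, Subtype.val_inj] at h1
    simpa using h1
  · obtain ⟨y, rfl⟩ := exists_refSimplex_eq w hw1
    rw [hp, map_sum]
    simp only [MvPolynomial.eval_monomial]
    exact hc y fun i => hw i (Finset.mem_univ i)

/-- On the reference simplex the coefficients of a polynomial in the Bernstein basis are bounded
by its `L¹` norm, as all norms on a finite-dimensional space are equivalent. -/
theorem exists_refConst (r : ℕ) : ∃ C : ℝ, 0 ≤ C ∧ ∀ (c : RefIdx r → ℝ) (d : RefIdx r),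
    ‖c d‖ₑ ≤ ENNReal.ofReal C * ∫⁻ y in refSimplex, ‖∑ d, c d * refMono d y‖ₑ := by
  set v : RefIdx r → Lp ℝ 1 (volume.restrict refSimplex) := fun d => (memLp_refMono d).toLp _
  set T := Fintype.linearCombination ℝ v with hT
  have hTc : ∀ c, (T c : E3 → ℝ) =ᵐ[volume.restrict refSimplex]
      fun y => ∑ d, c d * refMono d y := by
    intro c
    rw [hT, Fintype.linearCombination_apply]
    have h1 : ∀ d, ((c d • v d : Lp ℝ 1 (volume.restrict refSimplex)) : E3 → ℝ)
        =ᵐ[volume.restrict refSimplex] fun y => c d * refMono d y := by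
      intro d
      filter_upwards [Lp.coeFn_smul (c d) (v d), (memLp_refMono d).coeFn_toLp] with y h2 h3
      rw [h2, Pi.smul_apply, h3, smul_eq_mul]
    filter_upwards [Lp.coeFn_finsetSum Finset.univ (fun d => c d • v d),
      ae_all_iff.2 h1] with y h2 h3
    rw [h2, Finset.sum_apply]
    exact Finset.sum_congr rfl fun d _ => h3 d
  have hker : LinearMap.ker T = ⊥ := by
    rw [LinearMap.ker_eq_bot']
    intro c hc
    refine eq_zero_of_refMono ?_
    have h1 := hTc c
    rw [hc] at h1
    have h2 : (fun y => ∑ d, c d * refMono d y) =ᵐ[volume.restrict refSimplex] fun _ => (0 : ℝ) :=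
      h1.symm.trans (Lp.coeFn_zero _ _ _)
    have h3 := Measure.eqOn_open_of_ae_eq h2 isOpen_refSimplex
      (Continuous.continuousOn (by
        exact continuous_finsetSum _ fun d _ => continuous_const.mul (continuous_refMono d)))
      continuousOn_const
    exact fun y hy => h3 hy
  obtain ⟨C, -, hC⟩ := T.exists_antilipschitzWith hker
  refine ⟨C, C.2, fun c d => ?_⟩
  have h1 : ‖c‖ ≤ C * ‖T c‖ := hC.le_mul_norm (map_zero T) c
  have h2 : ‖T c‖ₑ = ∫⁻ y in refSimplex, ‖∑ d, c d * refMono d y‖ₑ := by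
    rw [Lp.enorm_def, eLpNorm_congr_ae (hTc c), eLpNorm_one_eq_lintegral_enorm]
  rw [← h2, ← ofReal_norm, ← ofReal_norm, ← ENNReal.ofReal_mul NNReal.zero_le_coe]
  exact ENNReal.ofReal_le_ofReal ((norm_le_pi_norm c d).trans h1)

section BernsteinBasis

variable {Ω : Set E3}

/-! ### The Bernstein basis -/

/-- The indices of the Bernstein basis of `V_h`: multi-indices of degree `r` that are supported in
the vertices of some tetrahedron. -/
abbrev Idx (𝒯 : Triangulation Ω) (r : ℕ) : Type :=
  {α : E3 →₀ ℕ // ∃ t : 𝒯.elements, α.support ⊆ (t : Finset E3) ∧ α.degree = r}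

variable {𝒯 : Triangulation Ω} {r : ℕ}

/-- An enumeration of the vertices of a tetrahedron. -/
def vert (t : 𝒯.elements) (i : Fin 4) : E3 :=
  ((t : Finset E3).equivFinOfCardEq t.2.2).symm i

theorem vert_mem (t : 𝒯.elements) (i : Fin 4) : vert t i ∈ (t : Finset E3) := Subtype.prop _

theorem vert_injective (t : 𝒯.elements) : Function.Injective (vert t) := fun _ _ hij =>
  ((t : Finset E3).equivFinOfCardEq t.2.2).symm.injective (Subtype.ext hij)

theorem range_vert (t : 𝒯.elements) : Set.range (vert t) = ((t : Finset E3) : Set E3) := by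
  ext z
  constructor
  · rintro ⟨i, rfl⟩; exact vert_mem t i
  · intro hz
    exact ⟨(t : Finset E3).equivFinOfCardEq t.2.2 ⟨z, hz⟩, by simp [vert]⟩

/-- The multi-indices that belong to a given tetrahedron. -/
def idxEmb (t : 𝒯.elements) : RefIdx r ↪ Idx 𝒯 r where
  toFun d := ⟨d.1.mapDomain (vert t), t, by
      classical
      intro z hz
      obtain ⟨i, -, rfl⟩ := Finset.mem_image.1 (Finsupp.mapDomain_support hz)
      exact vert_mem t i, by
      rw [Finsupp.degree_mapDomain, d.2]⟩
  inj' d d' h := Subtype.ext (Finsupp.mapDomain_injective (vert_injective t) (Subtype.ext_iff.1 h))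

theorem exists_idxEmb_eq {t : 𝒯.elements} {α : Idx 𝒯 r} (hα : α.1.support ⊆ (t : Finset E3)) :
    ∃ d, idxEmb t d = α := by
  have h1 : (α.1.support : Set E3) ⊆ Set.range (vert t) := by
    rw [range_vert]; exact_mod_cast hα
  have h2 := Finsupp.mapDomain_comapDomain (vert t) (vert_injective t) α.1 h1
  refine ⟨⟨Finsupp.comapDomain (vert t) α.1 (vert_injective t).injOn, ?_⟩, Subtype.ext h2⟩
  obtain ⟨s, -, hs⟩ := α.2
  exact ((Finsupp.degree_mapDomain (vert t) _).symm.trans (congrArg _ h2)).trans hs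

instance : Finite (Idx 𝒯 r) := by
  refine Finite.of_surjective (fun z : 𝒯.elements × RefIdx r => idxEmb z.1 z.2) fun α => ?_
  obtain ⟨t, ht, -⟩ := α.2
  obtain ⟨d, hd⟩ := exists_idxEmb_eq ht
  exact ⟨(t, d), hd⟩

instance : Fintype (Idx 𝒯 r) := Fintype.ofFinite _

/-- The indices that belong to a given tetrahedron, as a finite set. -/
def locIdx (r : ℕ) (t : 𝒯.elements) : Finset (Idx 𝒯 r) := Finset.univ.map (idxEmb t)

theorem mem_locIdx {t : 𝒯.elements} {α : Idx 𝒯 r} :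
    α ∈ locIdx r t ↔ α.1.support ⊆ (t : Finset E3) := by
  rw [locIdx, Finset.mem_map]
  constructor
  · rintro ⟨d, -, rfl⟩ z hz
    classical
    obtain ⟨i, -, rfl⟩ := Finset.mem_image.1 (Finsupp.mapDomain_support hz)
    exact vert_mem t i
  · intro h
    obtain ⟨d, hd⟩ := exists_idxEmb_eq h
    exact ⟨d, Finset.mem_univ _, hd⟩

theorem card_locIdx (t : 𝒯.elements) : (locIdx r t).card = Fintype.card (RefIdx r) := by
  rw [locIdx, Finset.card_map, Finset.card_univ]

/-- The polynomial in the barycentric coordinates of a tetrahedron that belongs to a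
multi-index. -/
def bernOn (t : 𝒯.elements) (α : Idx 𝒯 r) (x : E3) : ℝ := α.1.prod fun z n => bary 𝒯 t z x ^ n

open Classical in
/-- The global barycentric coordinate (hat function) of the vertex `z`. It is `0` outside the
closure of `Ω`. -/
def hat (𝒯 : Triangulation Ω) (z x : E3) : ℝ :=
  if hx : x ∈ closure Ω then bary 𝒯 (exists_mem_tet 𝒯 hx).choose z x else 0

theorem hat_eq {t : 𝒯.elements} {x : E3} (hx : x ∈ tet (t : Finset E3)) (z : E3) :
    hat 𝒯 z x = bary 𝒯 t z x := by
  have h := tet_subset_closure t hx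
  rw [hat, dif_pos h]
  exact bary_eq_of_mem (exists_mem_tet 𝒯 h).choose_spec hx z

/-- The Bernstein basis function of a multi-index: the monomial in the hat functions, without the
multinomial coefficient that is customary. -/
def bern (α : Idx 𝒯 r) (x : E3) : ℝ := α.1.prod fun z n => hat 𝒯 z x ^ n

theorem bern_eq {t : 𝒯.elements} {x : E3} (hx : x ∈ tet (t : Finset E3)) (α : Idx 𝒯 r) :
    bern α x = bernOn t α x := by
  simp only [bern, bernOn, hat_eq hx]

theorem hat_mem_Icc (z x : E3) : hat 𝒯 z x ∈ Set.Icc (0 : ℝ) 1 := by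
  by_cases hx : x ∈ closure Ω
  · obtain ⟨t, ht⟩ := exists_mem_tet 𝒯 hx
    rw [hat_eq ht]
    exact ⟨mem_tet_iff.1 ht z, bary_le_one ht z⟩
  · rw [hat, dif_neg hx]; simp

theorem bern_nonneg (α : Idx 𝒯 r) (x : E3) : 0 ≤ bern α x :=
  Finset.prod_nonneg fun z _ => pow_nonneg (hat_mem_Icc z x).1 _

theorem bern_le_one (α : Idx 𝒯 r) (x : E3) : bern α x ≤ 1 :=
  Finset.prod_le_one (fun z _ => pow_nonneg (hat_mem_Icc z x).1 _)
    fun z _ => pow_le_one₀ (hat_mem_Icc z x).1 (hat_mem_Icc z x).2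

theorem bern_eq_zero {t : 𝒯.elements} {x : E3} (hx : x ∈ tet (t : Finset E3)) {α : Idx 𝒯 r}
    (hα : α ∉ locIdx r t) : bern α x = 0 := by
  rw [mem_locIdx] at hα
  obtain ⟨z, hz, hzt⟩ := Finset.not_subset.1 hα
  refine Finset.prod_eq_zero hz ?_
  simp only
  rw [hat_eq hx, bary_of_notMem hzt, zero_pow (Finsupp.mem_support_iff.1 hz)]

theorem continuous_bernOn (t : 𝒯.elements) (α : Idx 𝒯 r) : Continuous (bernOn t α) := by
  unfold bernOn Finsupp.prod
  exact continuous_finsetProd _ fun z _ =>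
    ((bary 𝒯 t z).continuous_of_finiteDimensional).pow _

theorem closure_eq_iUnion (𝒯 : Triangulation Ω) :
    closure Ω = ⋃ t : 𝒯.elements, tet (t : Finset E3) := by
  ext x
  rw [Set.mem_iUnion]
  exact ⟨fun hx => exists_mem_tet 𝒯 hx, fun ⟨t, ht⟩ => tet_subset_closure t ht⟩

theorem continuousOn_bern (α : Idx 𝒯 r) : ContinuousOn (bern α) (closure Ω) := by
  rw [closure_eq_iUnion 𝒯]
  refine (locallyFinite_of_finite _).continuousOn_iUnion (fun t => isClosed_tet _) fun t => ?_
  exact (continuous_bernOn t α).continuousOn.congr fun x hx => bern_eq hx α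

section Functions

variable {F : Type*} [NormedAddCommGroup F] [NormedSpace ℝ F]

/-- The finite element function with given coefficients in the Bernstein basis. -/
def feFun (c : Idx 𝒯 r → F) (x : E3) : F := ∑ α, bern α x • c α

theorem feFun_eq {t : 𝒯.elements} {x : E3} (hx : x ∈ tet (t : Finset E3)) (c : Idx 𝒯 r → F) :
    feFun c x = ∑ α ∈ locIdx r t, bernOn t α x • c α := by
  rw [feFun, ← Finset.sum_subset (Finset.subset_univ (locIdx r t))]
  · exact Finset.sum_congr rfl fun α _ => by rw [bern_eq hx]
  · intro α _ hα
    rw [bern_eq_zero hx hα, zero_smul]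

theorem continuousOn_feFun (c : Idx 𝒯 r → F) : ContinuousOn (feFun c) (closure Ω) := by
  unfold feFun
  exact continuousOn_finsetSum _ fun α _ => (continuousOn_bern α).smul continuousOn_const

theorem feFun_add (c c' : Idx 𝒯 r → F) (x : E3) : feFun (c + c') x = feFun c x + feFun c' x := by
  simp [feFun, smul_add, Finset.sum_add_distrib]

theorem feFun_sub (c c' : Idx 𝒯 r → F) (x : E3) : feFun (c - c') x = feFun c x - feFun c' x := by
  simp [feFun, smul_sub, Finset.sum_sub_distrib]

theorem norm_feFun_le {t : 𝒯.elements} {x : E3} (hx : x ∈ tet (t : Finset E3)) (c : Idx 𝒯 r → F) :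
    ‖feFun c x‖ ≤ ∑ α ∈ locIdx r t, ‖c α‖ := by
  rw [feFun_eq hx]
  refine norm_sum_le_of_le _ fun α _ => ?_
  rw [norm_smul, ← bern_eq hx, Real.norm_of_nonneg (bern_nonneg α x)]
  exact mul_le_of_le_one_left (norm_nonneg _) (bern_le_one α x)

end Functions

/-! ### Coefficients are controlled locally -/

/-- The affine map from the reference simplex preserves barycentric coordinates. -/
theorem bary_sum_vert (t : 𝒯.elements) (y : E3) (i : Fin 4) :
    bary 𝒯 t (vert t i) (∑ j, refBary y j • vert t j) = refBary y i := by
  classical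
  rw [affineMap_sum_smul _ (sum_refBary y)]
  rw [Finset.sum_congr rfl fun j _ => by rw [bary_vertex (vert_mem t i) (vert_mem t j)]]
  simp [(vert_injective t).eq_iff]

/-- The linear part of the affine map from the reference simplex to a tetrahedron. -/
def refLin (t : 𝒯.elements) : E3 →ₗ[ℝ] E3 :=
  ∑ i : Fin 3, (EuclideanSpace.proj i : E3 →L[ℝ] ℝ).toLinearMap.smulRight
    (vert t i.succ - vert t 0)

theorem refLin_add (t : 𝒯.elements) (y : E3) :
    vert t 0 + refLin t y = ∑ j, refBary y j • vert t j := by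
  rw [Fin.sum_univ_succ, refBary_zero]
  simp only [refLin, LinearMap.sum_apply, LinearMap.smulRight_apply, refBary_succ, smul_sub,
    Finset.sum_sub_distrib, sub_smul, one_smul, Finset.sum_smul]
  have h : ∀ i, ((EuclideanSpace.proj i : E3 →L[ℝ] ℝ) : E3 →ₗ[ℝ] ℝ) y = y i := fun _ => rfl
  simp only [h]
  abel

theorem bary_refLin (t : 𝒯.elements) (y : E3) (i : Fin 4) :
    bary 𝒯 t (vert t i) (vert t 0 + refLin t y) = refBary y i := by
  rw [refLin_add, bary_sum_vert]

theorem det_refLin_ne_zero (t : 𝒯.elements) : LinearMap.det (refLin t) ≠ 0 := by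
  intro h
  have h1 := LinearMap.bot_lt_ker_of_det_eq_zero h
  refine h1.ne' ?_
  rw [LinearMap.ker_eq_bot']
  intro y hy
  ext i
  have h2 := bary_refLin t y i.succ
  have h3 := bary_refLin t 0 i.succ
  rw [hy, refBary_succ] at h2
  rw [map_zero, refBary_succ] at h3
  exact h2.symm.trans h3

theorem mem_interior_refLin_iff (t : 𝒯.elements) (y : E3) :
    vert t 0 + refLin t y ∈ interior (tet (t : Finset E3)) ↔ y ∈ refSimplex := by
  rw [mem_interior_tet_iff]
  constructor
  · intro h i
    rw [← bary_refLin t y i]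
    exact h _ (vert_mem t i)
  · intro h z hz
    have : z ∈ Set.range (vert t) := by rw [range_vert]; exact hz
    obtain ⟨i, rfl⟩ := this
    rw [bary_refLin]
    exact h i

theorem lintegral_interior_tet (t : 𝒯.elements) {f : E3 → ℝ≥0∞} (hf : Measurable f) :
    ∫⁻ y in refSimplex, f (vert t 0 + refLin t y) =
      ENNReal.ofReal |(LinearMap.det (refLin t))⁻¹| *
        ∫⁻ x in interior (tet (t : Finset E3)), f x := by
  set T := interior (tet (t : Finset E3)) with hT
  have hTm : MeasurableSet T := isOpen_interior.measurableSet
  have hLm : Measurable (refLin t) := (LinearMap.continuous_of_finiteDimensional _).measurable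
  have hg : Measurable fun x => T.indicator f (vert t 0 + x) :=
    (hf.indicator hTm).comp (measurable_const_add _)
  rw [← lintegral_indicator isOpen_refSimplex.measurableSet, ← lintegral_indicator hTm]
  have e1 : ∀ y, refSimplex.indicator (fun y => f (vert t 0 + refLin t y)) y =
      T.indicator f (vert t 0 + refLin t y) := by
    intro y
    by_cases hy : y ∈ refSimplex
    · rw [Set.indicator_of_mem hy, Set.indicator_of_mem ((mem_interior_refLin_iff t y).2 hy)]
    · rw [Set.indicator_of_notMem hy, Set.indicator_of_notMem
        fun h => hy ((mem_interior_refLin_iff t y).1 h)]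
  simp_rw [e1]
  have h1 := lintegral_map (μ := (volume : Measure E3)) hg hLm
  rw [← h1, Measure.map_linearMap_addHaar_eq_smul_addHaar _ (det_refLin_ne_zero t),
    lintegral_smul_measure, smul_eq_mul,
    lintegral_add_left_eq_self (fun x => T.indicator f x) (vert t 0)]

theorem bernOn_idxEmb (t : 𝒯.elements) (d : RefIdx r) (y : E3) :
    bernOn t (idxEmb t d) (vert t 0 + refLin t y) = refMono d y := by
  change (d.1.mapDomain (vert t)).prod _ = _
  rw [Finsupp.prod_mapDomain_index_inj (vert_injective t)]
  simp only [bary_refLin]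
  rfl

/-- The constant that bounds the Bernstein coefficients on a tetrahedron by the mean of the
function. -/
def locConst (r : ℕ) : ℝ := (exists_refConst r).choose * volume.real refSimplex

theorem locConst_nonneg (r : ℕ) : 0 ≤ locConst r :=
  mul_nonneg (exists_refConst r).choose_spec.1 measureReal_nonneg

theorem volume_mul_enorm_coeff_le_real (t : 𝒯.elements) (c : Idx 𝒯 r → ℝ) {α : Idx 𝒯 r}
    (hα : α ∈ locIdx r t) :
    volume (interior (tet (t : Finset E3))) * ‖c α‖ₑ ≤
      ENNReal.ofReal (locConst r) * ∫⁻ x in interior (tet (t : Finset E3)), ‖feFun c x‖ₑ := by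
  obtain ⟨hC0, hC⟩ := (exists_refConst r).choose_spec
  obtain ⟨d, rfl⟩ := exists_idxEmb_eq (mem_locIdx.1 hα)
  set T := interior (tet (t : Finset E3)) with hT
  set D := ENNReal.ofReal |(LinearMap.det (refLin t))⁻¹| with hD
  have hD0 : D ≠ 0 := by
    rw [hD, ne_eq, ENNReal.ofReal_eq_zero, not_le]
    exact abs_pos.2 (inv_ne_zero (det_refLin_ne_zero t))
  have hDt : D ≠ ⊤ := ENNReal.ofReal_ne_top
  have hvol : volume refSimplex = D * volume T := by
    have := lintegral_interior_tet t (f := 1) measurable_one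
    simp only [Pi.one_apply, setLIntegral_one] at this
    exact this
  set f : E3 → ℝ≥0∞ := fun x => ‖∑ α ∈ locIdx r t, bernOn t α x * c α‖ₑ with hf
  have hfm : Measurable f := by
    refine Continuous.measurable ?_
    refine Continuous.enorm ?_
    exact continuous_finsetSum _ fun α _ => (continuous_bernOn t α).mul continuous_const
  have e1 : ∫⁻ x in T, ‖feFun c x‖ₑ = ∫⁻ x in T, f x := by
    refine setLIntegral_congr_fun isOpen_interior.measurableSet fun x hx => ?_
    simp only [hf]
    rw [feFun_eq (interior_subset hx)]
    rfl
  have e2 : ∫⁻ y in refSimplex, ‖∑ d, c (idxEmb t d) * refMono d y‖ₑ = D * ∫⁻ x in T, f x := by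
    rw [← lintegral_interior_tet t hfm]
    refine lintegral_congr fun y => ?_
    simp only [hf, locIdx, Finset.sum_map, bernOn_idxEmb]
    congr 1
    exact Finset.sum_congr rfl fun d _ => mul_comm _ _
  have h1 := hC (fun d => c (idxEmb t d)) d
  rw [e2] at h1
  rw [e1, ← ENNReal.mul_le_mul_iff_right hD0 hDt, ← mul_assoc, ← hvol]
  calc volume refSimplex * ‖c (idxEmb t d)‖ₑ
      ≤ volume refSimplex * (ENNReal.ofReal (exists_refConst r).choose * (D * ∫⁻ x in T, f x)) := by
        gcongr
    _ = D * (ENNReal.ofReal (locConst r) * ∫⁻ x in T, f x) := by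
        rw [locConst, ENNReal.ofReal_mul hC0, measureReal_def,
          ENNReal.ofReal_toReal volume_refSimplex_lt_top.ne]
        ring

/-- The Bernstein coefficients on a tetrahedron are bounded by the mean of the function. -/
theorem volume_mul_enorm_coeff_le {F : Type*} [NormedAddCommGroup F] [NormedSpace ℝ F]
    (t : 𝒯.elements) (c : Idx 𝒯 r → F) {α : Idx 𝒯 r} (hα : α ∈ locIdx r t) :
    volume (interior (tet (t : Finset E3))) * ‖c α‖ₑ ≤
      ENNReal.ofReal (locConst r) * ∫⁻ x in interior (tet (t : Finset E3)), ‖feFun c x‖ₑ := by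
  obtain ⟨g, hg, hgc⟩ := exists_dual_vector'' ℝ (c α)
  have h1 := volume_mul_enorm_coeff_le_real t (fun β => g (c β)) hα
  have h2 : ‖g (c α)‖ₑ = ‖c α‖ₑ := by
    rw [hgc, ← ofReal_norm, ← ofReal_norm]; simp
  rw [h2] at h1
  refine h1.trans ?_
  gcongr with x
  have h3 : feFun (fun β => g (c β)) x = g (feFun c x) := by
    simp [feFun, map_sum]
  rw [h3]
  refine (g.le_opENorm _).trans ?_
  have h4 : ‖g‖ₑ ≤ 1 := by
    rw [← ofReal_norm, ← ENNReal.ofReal_one]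
    exact ENNReal.ofReal_le_ofReal hg
  exact mul_le_of_le_one_left' h4

/-! ### The Bernstein basis spans the finite element space -/

/-- A polynomial of degree at most `r` is a form of degree `r` in the barycentric coordinates of a
tetrahedron. -/
theorem exists_form_of_polynomial (t : 𝒯.elements) {P : MvPolynomial (Fin 3) ℝ}
    (hP : P.totalDegree ≤ r) : ∃ Q : MvPolynomial E3 ℝ, Q.IsHomogeneous r ∧
      Q ∈ MvPolynomial.supported ℝ ((t : Finset E3) : Set E3) ∧
      ∀ x, MvPolynomial.eval (fun z => bary 𝒯 t z x) Q =
        MvPolynomial.eval (fun i => x i) P := by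
  -- homogenize: `ℓ i` is the `i`-th Cartesian coordinate, and `σ` is the sum of the barycentric
  -- coordinates, which is `1`
  set ℓ : Fin 3 → MvPolynomial E3 ℝ := fun i =>
    ∑ z ∈ (t : Finset E3), MvPolynomial.C (z i) * MvPolynomial.X z with hℓ
  set σ : MvPolynomial E3 ℝ := ∑ z ∈ (t : Finset E3), MvPolynomial.X z with hσ
  have hX : ∀ z ∈ (t : Finset E3), (MvPolynomial.X z : MvPolynomial E3 ℝ) ∈
      MvPolynomial.supported ℝ ((t : Finset E3) : Set E3) := fun z hz =>
    MvPolynomial.X_mem_supported.2 hz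
  have hC : ∀ a : ℝ, (MvPolynomial.C a : MvPolynomial E3 ℝ) ∈
      MvPolynomial.supported ℝ ((t : Finset E3) : Set E3) := fun a =>
    (MvPolynomial.supported ℝ _).algebraMap_mem a
  have hℓh : ∀ i, (ℓ i).IsHomogeneous 1 := fun i =>
    MvPolynomial.IsHomogeneous.sum _ _ _ fun z _ => (MvPolynomial.isHomogeneous_X ℝ z).C_mul _
  have hσh : σ.IsHomogeneous 1 :=
    MvPolynomial.IsHomogeneous.sum _ _ _ fun z _ => MvPolynomial.isHomogeneous_X ℝ z
  have hℓs : ∀ i, ℓ i ∈ MvPolynomial.supported ℝ ((t : Finset E3) : Set E3) := fun i =>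
    Subalgebra.sum_mem _ fun z hz => Subalgebra.mul_mem _ (hC _) (hX z hz)
  have hσs : σ ∈ MvPolynomial.supported ℝ ((t : Finset E3) : Set E3) :=
    Subalgebra.sum_mem _ fun z hz => hX z hz
  have hℓe : ∀ i x, MvPolynomial.eval (fun z => bary 𝒯 t z x) (ℓ i) = x i := by
    intro i x
    rw [hℓ, map_sum]
    conv_rhs => rw [← sum_bary_smul t x]
    simp only [map_mul, MvPolynomial.eval_C, MvPolynomial.eval_X, WithLp.ofLp_sum, Finset.sum_apply,
      PiLp.smul_apply, smul_eq_mul]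
    exact Finset.sum_congr rfl fun z _ => mul_comm _ _
  have hσe : ∀ x, MvPolynomial.eval (fun z => bary 𝒯 t z x) σ = 1 := by
    intro x
    rw [hσ, map_sum]
    simp only [MvPolynomial.eval_X]
    exact sum_bary t x
  refine ⟨∑ d ∈ P.support, MvPolynomial.C (P.coeff d) * ((∏ i, ℓ i ^ d i) * σ ^ (r - d.degree)),
    ?_, ?_, fun x => ?_⟩
  · refine MvPolynomial.IsHomogeneous.sum _ _ _ fun d hd => MvPolynomial.IsHomogeneous.C_mul ?_ _
    have h1 : (∏ i, ℓ i ^ d i).IsHomogeneous (∑ i, 1 * d i) :=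
      MvPolynomial.IsHomogeneous.prod _ _ _ fun i _ => (hℓh i).pow _
    have h2 : (σ ^ (r - d.degree)).IsHomogeneous (1 * (r - d.degree)) := hσh.pow _
    have h3 := h1.mul h2
    have h4 : d.degree ≤ r := by
      refine le_trans ?_ hP
      rw [Finsupp.degree_apply]
      exact MvPolynomial.le_totalDegree hd
    have h5 : ∑ i, 1 * d i + 1 * (r - d.degree) = r := by
      simp only [one_mul]
      rw [← Finsupp.degree_eq_sum]
      omega
    rwa [h5] at h3
  · refine Subalgebra.sum_mem _ fun d _ => Subalgebra.mul_mem _ (hC _) (Subalgebra.mul_mem _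
      (Subalgebra.prod_mem _ fun i _ => Subalgebra.pow_mem _ (hℓs i) _)
      (Subalgebra.pow_mem _ hσs _))
  · rw [map_sum, MvPolynomial.eval_eq']
    refine Finset.sum_congr rfl fun d _ => ?_
    simp only [map_mul, MvPolynomial.eval_C, map_prod, map_pow, hℓe, hσe, one_pow, mul_one]

/-- Expansion of a form in the barycentric coordinates in Bernstein polynomials. -/
theorem eval_form_eq {t : 𝒯.elements} {Q : MvPolynomial E3 ℝ} (hQ : Q.IsHomogeneous r)
    (hQs : Q ∈ MvPolynomial.supported ℝ ((t : Finset E3) : Set E3)) (x : E3) :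
    MvPolynomial.eval (fun z => bary 𝒯 t z x) Q =
      ∑ α ∈ locIdx r t, bernOn t α x * Q.coeff α.1 := by
  classical
  have h1 : Q.support ⊆ (locIdx r t).map ⟨Subtype.val, Subtype.val_injective⟩ := by
    intro α hα
    have hα2 : α.support ⊆ (t : Finset E3) := by
      intro z hz
      have h2 := MvPolynomial.mem_supported.1 hQs
      exact h2 ((MvPolynomial.mem_vars_iff_mem_support z).2 ⟨α, hα, hz⟩)
    have hα3 : α.degree = r := by
      by_contra hne
      exact MvPolynomial.mem_support_iff.1 hα (hQ.coeff_eq_zero hne)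
    exact Finset.mem_map.2 ⟨⟨α, t, hα2, hα3⟩, mem_locIdx.2 hα2, rfl⟩
  rw [MvPolynomial.eval_eq, Finset.sum_subset h1, Finset.sum_map]
  · exact Finset.sum_congr rfl fun α _ => by rw [mul_comm]; rfl
  · intro α _ hα
    rw [MvPolynomial.notMem_support_iff.1 hα, zero_mul]

/-- Every finite element function is a combination of the Bernstein basis. The local coefficients
fit together because the coefficients of a form are determined by its values on a face. -/
theorem exists_coeff_of_mem_feSpace (hr : 1 ≤ r) {v : E3 → ℝ} (hv : v ∈ feSpace 𝒯 r) :
    ∃ c : Idx 𝒯 r → ℝ, ∀ x ∈ closure Ω, v x = feFun c x := by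
  classical
  choose P hP hPv using fun t : 𝒯.elements => hv.2 t t.2
  choose Q hQ hQs hQe using fun t : 𝒯.elements => exists_form_of_polynomial t (hP t)
  have hcons : ∀ (t t' : 𝒯.elements) (α : Idx 𝒯 r), α.1.support ⊆ (t : Finset E3) →
      α.1.support ⊆ (t' : Finset E3) → (Q t).coeff α.1 = (Q t').coeff α.1 := by
    intro t t' α hα hα'
    have hsub : α.1.support ⊆ (t : Finset E3) ∩ t' := Finset.subset_inter hα hα'
    have hne : ((t : Finset E3) ∩ t').Nonempty := by
      refine Finset.Nonempty.mono hsub ?_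
      obtain ⟨-, -, h⟩ := α.2
      rw [Finsupp.support_nonempty_iff]
      intro h0
      rw [h0, map_zero] at h
      omega
    have h1 := coeff_eq_zero_of_eval_eq_zero ((hQ t).sub (hQ t')) hne (fun w hw hw0 hw1 => ?_) hsub
    · rw [MvPolynomial.coeff_sub] at h1
      linarith
    · have hb : ∀ u : 𝒯.elements, (t : Finset E3) ∩ t' ⊆ u → ∀ z,
          bary 𝒯 u z (∑ y ∈ (t : Finset E3) ∩ t', w y • y) = w z := by
        intro u hu z
        rw [bary_sum_smul hu hw1]
        split_ifs with hz
        · rfl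
        · exact (hw0 z hz).symm
      set x := ∑ y ∈ (t : Finset E3) ∩ t', w y • y
      have hmem : ∀ u : 𝒯.elements, (t : Finset E3) ∩ t' ⊆ u → x ∈ tet (u : Finset E3) := by
        intro u hu
        rw [mem_tet_iff]
        intro z
        rw [hb u hu]
        by_cases hz : z ∈ (t : Finset E3) ∩ t'
        · exact (hw z hz).le
        · exact (hw0 z hz).ge
      have e1 : ∀ u : 𝒯.elements, (t : Finset E3) ∩ t' ⊆ u → MvPolynomial.eval w (Q u) = v x := by
        intro u hu
        rw [hPv u x (hmem u hu), ← hQe u x]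
        congr 2
        ext z
        rw [hb u hu]
      rw [map_sub, e1 t Finset.inter_subset_left, e1 t' Finset.inter_subset_right, sub_self]
  refine ⟨fun α => (Q α.2.choose).coeff α.1, fun x hx => ?_⟩
  obtain ⟨t, ht⟩ := exists_mem_tet 𝒯 hx
  rw [hPv t x ht, ← hQe t x, eval_form_eq (hQ t) (hQs t), feFun_eq ht]
  refine Finset.sum_congr rfl fun α hα => ?_
  rw [smul_eq_mul, hcons t α.2.choose α (mem_locIdx.1 hα) α.2.choose_spec.1]

theorem exists_polynomial_of_affineMap (f : E3 →ᵃ[ℝ] ℝ) :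
    ∃ p : MvPolynomial (Fin 3) ℝ, p.totalDegree ≤ 1 ∧
      ∀ x : E3, MvPolynomial.eval (fun i => x i) p = f x := by
  refine ⟨MvPolynomial.C (f 0) + ∑ i, MvPolynomial.C (f.linear (EuclideanSpace.single i 1)) *
    MvPolynomial.X i, ?_, fun x => ?_⟩
  · refine (MvPolynomial.totalDegree_add _ _).trans (max_le (by simp) ?_)
    refine (MvPolynomial.totalDegree_finsetSum _ _).trans (Finset.sup_le fun i _ => ?_)
    refine (MvPolynomial.totalDegree_mul _ _).trans ?_
    simp
  · have h1 : f x = f.linear x + f 0 := by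
      have := f.map_vadd 0 x
      simpa using this
    have h2 : x = ∑ i, x i • EuclideanSpace.single i (1 : ℝ) := by
      ext j
      simp [Finset.sum_apply, Pi.single_apply]
    have h3 : f.linear x = ∑ i, x i * f.linear (EuclideanSpace.single i (1 : ℝ)) := by
      conv_lhs => rw [h2]
      simp [map_sum]
    rw [h1, h3]
    simp only [map_add, map_sum, map_mul, MvPolynomial.eval_C, MvPolynomial.eval_X]
    rw [add_comm]
    congr 1
    exact Finset.sum_congr rfl fun i _ => mul_comm _ _

theorem feFun_mem_feSpace (c : Idx 𝒯 r → ℝ) : feFun c ∈ feSpace 𝒯 r := by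
  refine ⟨continuousOn_feFun c, fun t ht => ?_⟩
  set t' : 𝒯.elements := ⟨t, ht⟩
  choose p hp hpe using fun z => exists_polynomial_of_affineMap (bary 𝒯 t' z)
  refine ⟨∑ α ∈ locIdx r t', (α.1.prod fun z n => p z ^ n) * MvPolynomial.C (c α), ?_,
    fun x hx => ?_⟩
  · refine (MvPolynomial.totalDegree_finsetSum _ _).trans (Finset.sup_le fun α _ => ?_)
    refine (MvPolynomial.totalDegree_mul _ _).trans ?_
    rw [MvPolynomial.totalDegree_C, add_zero]
    refine (MvPolynomial.totalDegree_finsetProd _ _).trans ?_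
    obtain ⟨-, -, h⟩ := α.2
    refine le_trans ?_ h.le
    rw [Finsupp.degree_apply]
    refine Finset.sum_le_sum fun z _ => (MvPolynomial.totalDegree_pow _ _).trans ?_
    exact (Nat.mul_le_mul_left _ (hp z)).trans_eq (mul_one _)
  · rw [feFun_eq (t := t') hx, map_sum]
    refine Finset.sum_congr rfl fun α _ => ?_
    simp only [map_mul, MvPolynomial.eval_C, Finsupp.prod, map_prod, map_pow, hpe, bernOn,
      smul_eq_mul]

end BernsteinBasis

section Gradients

/-! ### Weak derivatives -/

section WeakDerivatives

variable {Ω : Set E3} {u u' : E3 → E3} {g g' : E3 → E3 →L[ℝ] E3}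

theorem HasWeakFDeriv.congr (h : HasWeakFDeriv Ω u g) (hu : u =ᵐ[volume.restrict Ω] u') :
    HasWeakFDeriv Ω u' g := by
  obtain ⟨h1, h2, h3⟩ := h
  refine ⟨?_, h2, fun φ hφ hc hs e => ?_⟩
  · intro x hx
    obtain ⟨s, hs, hi⟩ := h1 x hx
    refine ⟨s ∩ Ω, Filter.inter_mem hs self_mem_nhdsWithin, ?_⟩
    refine (hi.mono_set Set.inter_subset_left).congr ?_
    exact ae_mono (Measure.restrict_mono Set.inter_subset_right le_rfl) hu
  · rw [← h3 φ hφ hc hs e]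
    refine integral_congr_ae ?_
    filter_upwards [hu] with x hx
    rw [hx]

theorem LocallyIntegrableOn.integrableOn_smul {F : Type*} [NormedAddCommGroup F] [NormedSpace ℝ F]
    {f : E3 → F} (hf : LocallyIntegrableOn f Ω) {φ : E3 → ℝ} (hφ : Continuous φ)
    (hc : HasCompactSupport φ) (hs : tsupport φ ⊆ Ω) : IntegrableOn (fun x => φ x • f x) Ω := by
  have h1 : IntegrableOn f (tsupport φ) := hf.integrableOn_compact_subset hs hc
  have h2 : IntegrableOn (fun x => φ x • f x) (tsupport φ) :=
    h1.continuousOn_smul hφ.continuousOn hc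
  have h3 : Integrable (fun x => φ x • f x) := by
    refine (integrableOn_iff_integrable_of_support_subset ?_).1 h2
    intro x hx
    refine subset_tsupport _ ?_
    rw [Function.mem_support] at hx ⊢
    intro h0
    rw [h0, zero_smul] at hx
    exact hx rfl
  exact h3.integrableOn

/-- Weak derivatives are unique. -/
theorem HasWeakFDeriv.ae_eq (hΩ : IsOpen Ω) (h : HasWeakFDeriv Ω u g) (h' : HasWeakFDeriv Ω u g') :
    g =ᵐ[volume.restrict Ω] g' := by
  have key : ∀ i : Fin 3, ∀ᵐ x ∂(volume : Measure E3), x ∈ Ω →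
      (g x - g' x) (EuclideanSpace.single i 1) = 0 := by
    intro i
    set e : E3 := EuclideanSpace.single i 1
    have hgl : LocallyIntegrableOn (fun x => g x - g' x) Ω := h.2.1.sub h'.2.1
    have hl : LocallyIntegrableOn (fun x => (g x - g' x) e) Ω := by
      intro x hx
      obtain ⟨s, hs, hi⟩ := hgl x hx
      exact ⟨s, hs, (ContinuousLinearMap.apply ℝ E3 e).integrable_comp hi⟩
    refine hΩ.ae_eq_zero_of_integral_contDiff_smul_eq_zero hl fun φ hφ hc hs => ?_
    have i1 := LocallyIntegrableOn.integrableOn_smul h.2.1 hφ.continuous hc hs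
    have i2 := LocallyIntegrableOn.integrableOn_smul h'.2.1 hφ.continuous hc hs
    have j1 : IntegrableOn (fun x => φ x • g x e) Ω :=
      (ContinuousLinearMap.apply ℝ E3 e).integrable_comp i1
    have j2 : IntegrableOn (fun x => φ x • g' x e) Ω :=
      (ContinuousLinearMap.apply ℝ E3 e).integrable_comp i2
    have e1 : ∫ x, φ x • (g x - g' x) e = ∫ x in Ω, φ x • (g x - g' x) e := by
      symm
      refine setIntegral_eq_integral_of_forall_compl_eq_zero fun x hx => ?_
      rw [image_eq_zero_of_notMem_tsupport fun h => hx (hs h), zero_smul]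
    rw [e1]
    simp only [sub_apply, smul_sub]
    rw [integral_sub j1 j2]
    have a1 := h.2.2 φ hφ hc hs e
    have a2 := h'.2.2 φ hφ hc hs e
    rw [a1] at a2
    rw [neg_inj.1 a2, sub_self]
  rw [Filter.EventuallyEq, ae_restrict_iff' hΩ.measurableSet]
  filter_upwards [ae_all_iff.2 key] with x hx hxΩ
  rw [← sub_eq_zero]
  refine ContinuousLinearMap.coe_injective ?_
  refine (EuclideanSpace.basisFun (Fin 3) ℝ).toBasis.ext fun i => ?_
  simpa using hx i hxΩ

theorem HasWeakFDeriv.normW1_eq (hΩ : IsOpen Ω) (h : HasWeakFDeriv Ω u g) (p : ℝ≥0∞) :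
    normW1 Ω p u = eLpNorm u p (volume.restrict Ω) + eLpNorm g p (volume.restrict Ω) := by
  refine le_antisymm (iInf₂_le g h) (le_iInf₂ fun g' h' => ?_)
  rw [eLpNorm_congr_ae (h.ae_eq hΩ h')]

theorem exists_of_normW1_lt_top {p : ℝ≥0∞} (h : normW1 Ω p u < ⊤) : ∃ g, HasWeakFDeriv Ω u g := by
  by_contra! hne
  rw [normW1] at h
  simp [hne] at h

theorem normW1_congr {p : ℝ≥0∞} (hu : u =ᵐ[volume.restrict Ω] u') :
    normW1 Ω p u = normW1 Ω p u' := by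
  unfold normW1
  refine iInf_congr fun g => ?_
  rw [eLpNorm_congr_ae hu]
  exact iInf_congr_Prop ⟨fun h => h.congr hu, fun h => h.congr hu.symm⟩ fun _ => rfl

end WeakDerivatives

/-! ### Gradients of finite element functions -/

variable {Ω : Set E3} {𝒯 : Triangulation Ω} {r : ℕ} {K h : ℝ}
variable {F : Type*} [NormedAddCommGroup F] [NormedSpace ℝ F]

/-- Monomials on the unit cube are Lipschitz, with their degree as the constant. -/
theorem abs_prod_pow_sub_prod_pow_le {ι : Type*} (s : Finset ι) (n : ι → ℕ) {a b : ι → ℝ} {d : ℝ}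
    (ha : ∀ i, a i ∈ Set.Icc (0 : ℝ) 1) (hb : ∀ i, b i ∈ Set.Icc (0 : ℝ) 1)
    (hab : ∀ i, |a i - b i| ≤ d) :
    |∏ i ∈ s, a i ^ n i - ∏ i ∈ s, b i ^ n i| ≤ (∑ i ∈ s, n i : ℕ) * d := by
  classical
  have hmul : ∀ {x y x' y' : ℝ}, x ∈ Set.Icc (0 : ℝ) 1 → y' ∈ Set.Icc (0 : ℝ) 1 →
      |x * y - x' * y'| ≤ |x - x'| + |y - y'| := by
    intro x y x' y' hx hy
    have e : x * y - x' * y' = x * (y - y') + y' * (x - x') := by ring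
    rw [e]
    refine (abs_add_le _ _).trans ?_
    rw [abs_mul, abs_mul, abs_of_nonneg hx.1, abs_of_nonneg hy.1]
    have := mul_le_of_le_one_left (abs_nonneg (y - y')) hx.2
    have := mul_le_of_le_one_left (abs_nonneg (x - x')) hy.2
    linarith
  have hpow : ∀ i (k : ℕ), |a i ^ k - b i ^ k| ≤ k * d := by
    intro i k
    induction k with
    | zero => simp
    | succ k ih =>
      rw [pow_succ, pow_succ]
      refine (hmul ⟨pow_nonneg (ha i).1 _, pow_le_one₀ (ha i).1 (ha i).2⟩ (hb i)).trans ?_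
      have := hab i
      push_cast
      linarith
  induction s using Finset.induction_on with
  | empty => simp
  | insert i s hi ih =>
    rw [Finset.prod_insert hi, Finset.prod_insert hi, Finset.sum_insert hi]
    refine (hmul ⟨pow_nonneg (ha i).1 _, pow_le_one₀ (ha i).1 (ha i).2⟩
      ⟨Finset.prod_nonneg fun j _ => pow_nonneg (hb j).1 _,
        Finset.prod_le_one (fun j _ => pow_nonneg (hb j).1 _)
          fun j _ => pow_le_one₀ (hb j).1 (hb j).2⟩).trans ?_
    have := hpow i (n i)
    push_cast at ih ⊢
    linarith

theorem abs_bern_sub_le (hu : 𝒯.IsUniform K h) {t : 𝒯.elements} {x y : E3}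
    (hx : x ∈ tet (t : Finset E3)) (hy : y ∈ tet (t : Finset E3)) (α : Idx 𝒯 r) :
    |bern α x - bern α y| ≤ r * K / h * ‖x - y‖ := by
  have h1 := abs_prod_pow_sub_prod_pow_le (d := K / h * ‖x - y‖) α.1.support α.1
    (fun z => hat_mem_Icc (𝒯 := 𝒯) z x) (fun z => hat_mem_Icc z y) (fun z => by
      rw [hat_eq hx, hat_eq hy]
      exact hu.abs_bary_sub_le t z x y)
  have h2 : ∑ z ∈ α.1.support, α.1 z = r := by
    obtain ⟨-, -, h⟩ := α.2
    exact h
  rw [h2] at h1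
  refine h1.trans_eq ?_
  ring

theorem norm_feFun_sub_le (hu : 𝒯.IsUniform K h) {t : 𝒯.elements} {x y : E3}
    (hx : x ∈ tet (t : Finset E3)) (hy : y ∈ tet (t : Finset E3)) (c : Idx 𝒯 r → F) :
    ‖feFun c x - feFun c y‖ ≤ r * K / h * (∑ α ∈ locIdx r t, ‖c α‖) * ‖x - y‖ := by
  rw [feFun_eq hx, feFun_eq hy, ← Finset.sum_sub_distrib, Finset.mul_sum, Finset.sum_mul]
  refine norm_sum_le_of_le _ fun α _ => ?_
  rw [← sub_smul, norm_smul, ← bern_eq hx, ← bern_eq hy, Real.norm_eq_abs]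
  have := abs_bern_sub_le hu hx hy α
  have := norm_nonneg (c α)
  calc _ ≤ r * K / h * ‖x - y‖ * ‖c α‖ := by gcongr
    _ = _ := by ring

theorem differentiable_bernOn (t : 𝒯.elements) (α : Idx 𝒯 r) : Differentiable ℝ (bernOn t α) := by
  unfold bernOn Finsupp.prod
  have h1 : ∀ z, Differentiable ℝ fun x => bary 𝒯 t z x := fun z => by
    have e : (fun x => bary 𝒯 t z x) = fun x =>
        LinearMap.toContinuousLinearMap (bary 𝒯 t z).linear x + bary 𝒯 t z 0 := by
      ext x
      have := (bary 𝒯 t z).map_vadd 0 x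
      simpa using this
    rw [e]
    exact (ContinuousLinearMap.differentiable _).add_const _
  intro x
  have h2 : ∀ z ∈ α.1.support, DifferentiableAt ℝ (fun y => bary 𝒯 t z y ^ α.1 z) x :=
    fun z _ => (h1 z x).fun_pow _
  classical
  have h3 := (HasFDerivAt.finsetProd fun z hz => (h2 z hz).hasFDerivAt).differentiableAt
  exact h3

theorem differentiableAt_feFun {t : 𝒯.elements} {x : E3}
    (hx : x ∈ interior (tet (t : Finset E3))) (c : Idx 𝒯 r → F) :
    DifferentiableAt ℝ (feFun c) x := by
  have h1 : DifferentiableAt ℝ (fun y => ∑ α ∈ locIdx r t, bernOn t α y • c α) x :=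
    DifferentiableAt.fun_sum fun α _ => ((differentiable_bernOn t α) x).smul_const _
  refine h1.congr_of_eventuallyEq ?_
  filter_upwards [mem_interior_iff_mem_nhds.1 hx] with y hy
  exact feFun_eq hy c

theorem norm_fderiv_feFun_le (hu : 𝒯.IsUniform K h) {t : 𝒯.elements} {x : E3}
    (hx : x ∈ interior (tet (t : Finset E3))) (c : Idx 𝒯 r → F) :
    ‖fderiv ℝ (feFun c) x‖ ≤ r * K / h * ∑ α ∈ locIdx r t, ‖c α‖ := by
  have hK := hu.K_pos
  have hh := hu.pos
  refine norm_fderiv_le_of_lip' ℝ (by positivity) ?_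
  filter_upwards [mem_interior_iff_mem_nhds.1 hx] with y hy
  exact norm_feFun_sub_le hu hy (interior_subset hx) c

theorem feFun_comp {F' : Type*} [NormedAddCommGroup F'] [NormedSpace ℝ F'] (L : F →L[ℝ] F')
    (c : Idx 𝒯 r → F) (x : E3) : feFun (fun α => L (c α)) x = L (feFun c x) := by
  simp [feFun, map_sum]

theorem fderiv_feFun_comp {F' : Type*} [NormedAddCommGroup F'] [NormedSpace ℝ F'] (L : F →L[ℝ] F')
    {t : 𝒯.elements} {x : E3} (hx : x ∈ interior (tet (t : Finset E3))) (c : Idx 𝒯 r → F) :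
    fderiv ℝ (feFun fun α => L (c α)) x = L.comp (fderiv ℝ (feFun c) x) := by
  have e : feFun (fun α => L (c α)) = fun x => L (feFun c x) := funext fun x => feFun_comp L c x
  rw [e]
  exact (L.hasFDerivAt.comp x (differentiableAt_feFun hx c).hasFDerivAt).fderiv

theorem BoundedDomain.isCompact_closure (hΩ : BoundedDomain Ω) : IsCompact (closure Ω) :=
  hΩ.isBounded.isCompact_closure

theorem BoundedDomain.volume_lt_top (hΩ : BoundedDomain Ω) : volume Ω < ⊤ :=
  hΩ.isBounded.measure_lt_top

theorem integrableOn_feFun (hΩ : BoundedDomain Ω) (c : Idx 𝒯 r → F) : IntegrableOn (feFun c) Ω :=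
  ((continuousOn_feFun c).integrableOn_compact hΩ.isCompact_closure).mono_set subset_closure

theorem aestronglyMeasurable_feFun (hΩ : BoundedDomain Ω) (c : Idx 𝒯 r → F) :
    AEStronglyMeasurable (feFun c) (volume.restrict Ω) := (integrableOn_feFun hΩ c).1

theorem norm_feFun_le_sum (c : Idx 𝒯 r → F) (x : E3) : ‖feFun c x‖ ≤ ∑ α, ‖c α‖ := by
  refine norm_sum_le_of_le _ fun α _ => ?_
  rw [norm_smul, Real.norm_of_nonneg (bern_nonneg α x)]
  exact mul_le_of_le_one_left (norm_nonneg _) (bern_le_one α x)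

theorem integrableOn_fderiv_feFun (hΩ : BoundedDomain Ω) (hu : 𝒯.IsUniform K h)
    [CompleteSpace F] [SecondCountableTopology (E3 →L[ℝ] F)] (c : Idx 𝒯 r → F) :
    IntegrableOn (fderiv ℝ (feFun c)) Ω := by
  have hK := hu.K_pos
  have hh := hu.pos
  refine Measure.integrableOn_of_bounded (M := r * K / h * ∑ α, ‖c α‖) hΩ.volume_lt_top.ne
    (measurable_fderiv ℝ _).aestronglyMeasurable ?_
  filter_upwards [ae_exists_mem_interior 𝒯 hΩ.isOpen] with x ⟨t, ht⟩
  refine (norm_fderiv_feFun_le hu ht c).trans ?_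
  gcongr
  exact Finset.subset_univ _

/-- A finite element function times a cut-off function is Lipschitz on all of `ℝ³`: it is
Lipschitz on each of the finitely many tetrahedra, and zero off the support of the cut-off
function. -/
theorem exists_lipschitzWith_mul_feFun (hΩ : IsOpen Ω) (hu : 𝒯.IsUniform K h) (c : Idx 𝒯 r → ℝ)
    {φ : E3 → ℝ} (hφ : ContDiff ℝ ∞ φ) (hc : HasCompactSupport φ) (hs : tsupport φ ⊆ Ω) :
    ∃ L, LipschitzWith L fun x => φ x * feFun c x := by
  have hK := hu.K_pos
  have hh := hu.pos
  obtain ⟨A, hA⟩ := ContDiff.lipschitzWith_of_hasCompactSupport hc hφ (by simp)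
  obtain ⟨B, hB⟩ := hc.exists_bound_of_continuous hφ.continuous
  have hB0 : 0 ≤ B := (norm_nonneg _).trans (hB 0)
  set S := ∑ α, ‖c α‖ with hS
  have hS0 : 0 ≤ S := Finset.sum_nonneg fun _ _ => norm_nonneg _
  set L : ℝ≥0 := ⟨B * (r * K / h * S) + S * A, by positivity⟩ with hL
  have hcont : Continuous fun x => φ x * feFun c x := by
    rw [continuous_iff_continuousAt]
    intro x
    by_cases hx : x ∈ tsupport φ
    · exact hφ.continuous.continuousAt.mul ((continuousOn_feFun c).continuousAt
        (Filter.mem_of_superset (hΩ.mem_nhds (hs hx)) subset_closure))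
    · have h0 : (fun x => φ x * feFun c x) =ᶠ[𝓝 x] fun _ => 0 := by
        filter_upwards [notMem_tsupport_iff_eventuallyEq.1 hx] with y hy
        rw [hy]; simp
      exact continuousAt_const.congr h0.symm
  refine ⟨L, ?_⟩
  rw [← lipschitzOnWith_univ]
  refine lipschitzOnWith_of_finite_closed_cover (ι := Option 𝒯.elements)
    (T := fun o => o.elim {x | φ x = 0} fun t => tet (t : Finset E3)) convex_univ
    hcont.continuousOn ?_ ?_ ?_
  · rintro (_ | t)
    · exact isClosed_eq hφ.continuous continuous_const
    · exact isClosed_tet _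
  · intro x _
    by_cases hx : x ∈ closure Ω
    · obtain ⟨t, ht⟩ := exists_mem_tet 𝒯 hx
      exact Set.mem_iUnion.2 ⟨some t, ht⟩
    · refine Set.mem_iUnion.2 ⟨none, ?_⟩
      exact image_eq_zero_of_notMem_tsupport fun h => hx (subset_closure (hs h))
  · rintro (_ | t) <;> rw [lipschitzOnWith_iff_norm_sub_le]
    · rintro x ⟨hx, -⟩ y ⟨hy, -⟩
      have hx' : φ x = 0 := hx
      have hy' : φ y = 0 := hy
      simp only [hx', hy', zero_mul, sub_self, norm_zero]
      positivity
    · rintro x ⟨hx, -⟩ y ⟨hy, -⟩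
      have e : φ x * feFun c x - φ y * feFun c y =
        φ x * (feFun c x - feFun c y) + feFun c y * (φ x - φ y) := by ring
      rw [e]
      refine (norm_add_le _ _).trans ?_
      rw [norm_mul, norm_mul]
      have h1 := norm_feFun_sub_le hu hx hy c
      have h2 : ∑ α ∈ locIdx r t, ‖c α‖ ≤ S := Finset.sum_le_sum_of_subset_of_nonneg
        (Finset.subset_univ _) fun _ _ _ => norm_nonneg _
      have h3 := hA.norm_sub_le x y
      have h4 := norm_feFun_le_sum c y
      calc ‖φ x‖ * ‖feFun c x - feFun c y‖ + ‖feFun c y‖ * ‖φ x - φ y‖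
          ≤ B * (r * K / h * S * ‖x - y‖) + S * (A * ‖x - y‖) := by
            have := hB x
            gcongr
            exact h1.trans (by gcongr)
        _ = L * ‖x - y‖ := by
            change _ = (B * (r * K / h * S) + S * A) * ‖x - y‖
            ring

/-- Integration by parts on `Ω` for a finite element function and a test function. It is the
statement that the derivatives of their product, which is Lipschitz with compact support, have
integral zero. -/
theorem integral_fderiv_mul_feFun (hΩ : BoundedDomain Ω) (hu : 𝒯.IsUniform K h) (c : Idx 𝒯 r → ℝ)
    {φ : E3 → ℝ} (hφ : ContDiff ℝ ∞ φ) (hc : HasCompactSupport φ) (hs : tsupport φ ⊆ Ω) (e : E3) :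
    ∫ x in Ω, (fderiv ℝ φ x e * feFun c x + φ x * fderiv ℝ (feFun c) x e) = 0 := by
  obtain ⟨L, hL⟩ := exists_lipschitzWith_mul_feFun hΩ.isOpen hu c hφ hc hs
  have hψc : HasCompactSupport fun x => φ x * feFun c x := hc.mul_right
  -- integration by parts for Lipschitz functions, against the constant function `1`
  have h0 := LipschitzWith.integral_lineDeriv_mul_eq (μ := (volume : Measure E3))
    (LipschitzWith.const (1 : ℝ)) hL hψc (-e)
  have hz : ∀ (a : ℝ) (x v : E3), lineDeriv ℝ (fun _ : E3 => a) x v = 0 := fun a x v => by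
    simp [lineDeriv]
  simp only [hz, zero_mul, integral_zero, neg_neg, mul_one] at h0
  rw [h0, ← integral_indicator hΩ.isOpen.measurableSet]
  refine integral_congr_ae ?_
  have h1 := ae_exists_mem_interior 𝒯 hΩ.isOpen
  rw [ae_restrict_iff' hΩ.isOpen.measurableSet] at h1
  filter_upwards [h1] with x hx
  by_cases hxΩ : x ∈ Ω
  · obtain ⟨t, ht⟩ := hx hxΩ
    rw [Set.indicator_of_mem hxΩ]
    have d1 : HasFDerivAt φ (fderiv ℝ φ x) x :=
      ((hφ.differentiable (by simp)) x).hasFDerivAt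
    have d2 := (d1.mul (differentiableAt_feFun ht c).hasFDerivAt)
    have d3 := (d2.hasLineDerivAt e).lineDeriv
    rw [show (fun x => φ x * feFun c x) = φ * feFun c from rfl, d3]
    simp
    ring
  · rw [Set.indicator_of_notMem hxΩ]
    have h2 : (fun x => φ x * feFun c x) =ᶠ[𝓝 x] fun _ => 0 := by
      filter_upwards [notMem_tsupport_iff_eventuallyEq.1 fun h => hxΩ (hs h)] with y hy
      rw [hy]; simp
    rw [h2.lineDeriv_eq, hz]

/-- Finite element functions are weakly differentiable, with their piecewise gradient. -/
theorem hasWeakFDeriv_feFun (hΩ : BoundedDomain Ω) (hu : 𝒯.IsUniform K h) (c : Idx 𝒯 r → E3) :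
    HasWeakFDeriv Ω (feFun c) (fderiv ℝ (feFun c)) := by
  refine ⟨(integrableOn_feFun hΩ c).locallyIntegrableOn,
    (integrableOn_fderiv_feFun hΩ hu c).locallyIntegrableOn, fun φ hφ hc hs e => ?_⟩
  have i1 : IntegrableOn (fun x => fderiv ℝ φ x e • feFun c x) Ω := by
    refine LocallyIntegrableOn.integrableOn_smul (integrableOn_feFun hΩ c).locallyIntegrableOn
      ((hφ.continuous_fderiv (by simp)).clm_apply continuous_const) (hc.fderiv_apply ℝ e)
      ((tsupport_fderiv_apply_subset ℝ e).trans hs)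
  have i2 : IntegrableOn (fun x => φ x • fderiv ℝ (feFun c) x e) Ω := by
    have := LocallyIntegrableOn.integrableOn_smul
      (integrableOn_fderiv_feFun hΩ hu c).locallyIntegrableOn hφ.continuous hc hs
    exact (ContinuousLinearMap.apply ℝ E3 e).integrable_comp this
  rw [eq_neg_iff_add_eq_zero, ← integral_add i1 i2]
  ext i
  have h1 := (EuclideanSpace.proj i : E3 →L[ℝ] ℝ).integral_comp_comm (i1.add i2)
  change (EuclideanSpace.proj i : E3 →L[ℝ] ℝ) _ = 0
  refine h1.symm.trans ?_
  rw [← integral_fderiv_mul_feFun hΩ hu (fun α => (EuclideanSpace.proj i : E3 →L[ℝ] ℝ) (c α))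
    hφ hc hs e]
  refine integral_congr_ae ?_
  filter_upwards [ae_exists_mem_interior 𝒯 hΩ.isOpen] with x ⟨t, ht⟩
  rw [feFun_comp, fderiv_feFun_comp _ ht]
  simp

theorem normW1_feFun (hΩ : BoundedDomain Ω) (hu : 𝒯.IsUniform K h) (c : Idx 𝒯 r → E3) (p : ℝ≥0∞) :
    normW1 Ω p (feFun c) = eLpNorm (feFun c) p (volume.restrict Ω) +
      eLpNorm (fderiv ℝ (feFun c)) p (volume.restrict Ω) :=
  (hasWeakFDeriv_feFun hΩ hu c).normW1_eq hΩ.isOpen p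

/-! ### Local bounds by the averaging operator -/

/-- Integrals over sets within distance `L h` of `x` are bounded by the averaging operator. -/
theorem setLIntegral_le_avgOp (hΩ : IsOpen Ω) (hh : 0 < h) {L : ℝ} (hL : 0 ≤ L)
    {A : Set E3} {x : E3} (hAΩ : A ⊆ Ω) (hA : A ⊆ Metric.closedBall x (L * h)) (f : E3 → ℝ≥0∞) :
    ∫⁻ y in A, f y ≤ ENNReal.ofReal (h ^ 3 * (1 + L) ^ 4) * avgOp Ω h f x := by
  rw [avgOp, ← lintegral_const_mul' _ _ ENNReal.ofReal_ne_top]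
  refine (lintegral_mono_set (Set.subset_inter hAΩ hA)).trans ?_
  refine le_trans ?_ (lintegral_mono_set (Set.inter_subset_left (t := Metric.closedBall x (L * h))))
  refine setLIntegral_mono' (hΩ.measurableSet.inter measurableSet_closedBall) fun y hy => ?_
  have hy' : ‖x - y‖ / h ≤ L := by
    rw [div_le_iff₀ hh, ← dist_eq_norm, dist_comm]
    exact hy.2
  rw [← mul_assoc, decayKernel, ← ENNReal.ofReal_mul (by positivity)]
  refine le_mul_of_one_le_left' ?_
  rw [ENNReal.one_le_ofReal]
  have h1 : (1 + ‖x - y‖ / h) ^ 4 ≤ (1 + L) ^ 4 := by gcongr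
  have h2 : 0 < (1 + ‖x - y‖ / h) ^ 4 := by positivity
  calc (1 : ℝ) ≤ (1 + L) ^ 4 / (1 + ‖x - y‖ / h) ^ 4 := by rwa [one_le_div h2]
    _ = _ := by field_simp

/-- The constant in `sum_enorm_coeff_le`. -/
def coeffConst (r : ℕ) (K : ℝ) : ℝ≥0 :=
  (Fintype.card (RefIdx r) * (locConst r * K ^ 3 * 16 / ballVol)).toNNReal

/-- The coefficients on a tetrahedron are bounded by the averaging operator at any point of it. -/
theorem sum_enorm_coeff_le (hΩ : BoundedDomain Ω) (hu : 𝒯.IsUniform K h) {t : 𝒯.elements} {x : E3}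
    (hx : x ∈ tet (t : Finset E3)) (c : Idx 𝒯 r → F) :
    ∑ α ∈ locIdx r t, ‖c α‖ₑ ≤ coeffConst r K * avgOp Ω h (fun y => ‖feFun c y‖ₑ) x := by
  have hK := hu.K_pos
  have hh := hu.pos
  have hb := ballVol_pos
  have hl := locConst_nonneg r
  have h1 := setLIntegral_le_avgOp (h := h) hΩ.isOpen hh zero_le_one (interior_tet_subset hΩ t)
    (interior_subset.trans (by rw [one_mul]; exact hu.tet_subset_closedBall hx))
    fun y => ‖feFun c y‖ₑ
  have h2 : ∀ α ∈ locIdx r t, ‖c α‖ₑ ≤ ENNReal.ofReal (locConst r * K ^ 3 * 16 / ballVol) *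
      avgOp Ω h (fun y => ‖feFun c y‖ₑ) x := by
    intro α hα
    have h3 := volume_mul_enorm_coeff_le t c hα
    have h4 : ENNReal.ofReal ((h / K) ^ 3 * ballVol) * ‖c α‖ₑ ≤ ENNReal.ofReal (locConst r *
        (h ^ 3 * (1 + 1) ^ 4)) * avgOp Ω h (fun y => ‖feFun c y‖ₑ) x := by
      refine le_trans ?_ (h3.trans ?_)
      · gcongr
        exact hu.le_volume t
      · rw [ENNReal.ofReal_mul hl, mul_assoc]
        gcongr
    refine (le_ofReal_div_mul (by positivity) h4).trans_eq ?_
    congr 2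
    field_simp
    norm_num
  refine (Finset.sum_le_sum h2).trans_eq ?_
  rw [Finset.sum_const, card_locIdx, nsmul_eq_mul, ← mul_assoc, ← ENNReal.ofReal_natCast,
    ← ENNReal.ofReal_mul (by positivity)]
  rfl

theorem ofReal_sum_norm {ι F : Type*} [NormedAddCommGroup F] (s : Finset ι) (c : ι → F) :
    ENNReal.ofReal (∑ α ∈ s, ‖c α‖) = ∑ α ∈ s, ‖c α‖ₑ := by
  rw [ENNReal.ofReal_sum_of_nonneg fun _ _ => norm_nonneg _]
  simp only [ofReal_norm]

/-- The inverse estimate. -/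
theorem enorm_fderiv_feFun_le (hΩ : BoundedDomain Ω) (hu : 𝒯.IsUniform K h) {t : 𝒯.elements}
    {x : E3} (hx : x ∈ interior (tet (t : Finset E3))) (c : Idx 𝒯 r → F) :
    ‖fderiv ℝ (feFun c) x‖ₑ ≤ ENNReal.ofReal (r * K / h) *
      (coeffConst r K * avgOp Ω h (fun y => ‖feFun c y‖ₑ) x) := by
  have hK := hu.K_pos
  have hh := hu.pos
  have h1 := ENNReal.ofReal_le_ofReal (norm_fderiv_feFun_le hu hx c)
  rw [ofReal_norm, ENNReal.ofReal_mul (by positivity), ofReal_sum_norm] at h1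
  refine h1.trans ?_
  gcongr
  exact sum_enorm_coeff_le hΩ hu (interior_subset hx) c

end Gradients

section MassMatrix

/-! ### The mass matrix -/

variable {Ω : Set E3} {𝒯 : Triangulation Ω} {r : ℕ} {K h : ℝ}
variable {F : Type*} [NormedAddCommGroup F] [NormedSpace ℝ F]

/-- The mass matrix of the Bernstein basis. -/
def massMatrix (𝒯 : Triangulation Ω) (r : ℕ) : Matrix (Idx 𝒯 r) (Idx 𝒯 r) ℝ :=
  fun α β => ∫ x in Ω, bern α x * bern β x

theorem integrableOn_bern_smul (hΩ : BoundedDomain Ω) (α : Idx 𝒯 r) {u : E3 → F}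
    (hu : IntegrableOn u Ω) : IntegrableOn (fun x => bern α x • u x) Ω := by
  refine Integrable.bdd_smul hu (C := 1) ?_ (.of_forall fun x => ?_)
  · exact ((continuousOn_bern α).mono subset_closure).aestronglyMeasurable hΩ.isOpen.measurableSet
  · rw [Real.norm_of_nonneg (bern_nonneg α x)]
    exact bern_le_one α x

theorem integrableOn_bern (hΩ : BoundedDomain Ω) (α : Idx 𝒯 r) : IntegrableOn (bern α) Ω :=
  ((continuousOn_bern α).integrableOn_compact hΩ.isCompact_closure).mono_set subset_closure

theorem integral_bern_smul_feFun [CompleteSpace F] (hΩ : BoundedDomain Ω)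
    (c : Idx 𝒯 r → F) (α : Idx 𝒯 r) :
    ∫ x in Ω, bern α x • feFun c x = ∑ β, massMatrix 𝒯 r α β • c β := by
  simp only [feFun, Finset.smul_sum, smul_smul]
  rw [integral_finsetSum]
  · refine Finset.sum_congr rfl fun β _ => ?_
    rw [integral_smul_const]
    rfl
  · intro β _
    exact Integrable.smul_const (integrableOn_bern_smul hΩ α (integrableOn_bern hΩ β)) _

theorem massMatrix_symm (α β : Idx 𝒯 r) : massMatrix 𝒯 r α β = massMatrix 𝒯 r β α := by
  simp only [massMatrix, mul_comm]

theorem massMatrix_nonneg (α β : Idx 𝒯 r) : 0 ≤ massMatrix 𝒯 r α β :=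
  integral_nonneg fun x => mul_nonneg (bern_nonneg α x) (bern_nonneg β x)

theorem integrableOn_sq_feFun (hΩ : BoundedDomain Ω) (c : Idx 𝒯 r → ℝ) :
    IntegrableOn (fun x => feFun c x ^ 2) Ω :=
  (((continuousOn_feFun c).pow 2).integrableOn_compact hΩ.isCompact_closure).mono_set subset_closure

/-- The quadratic form of the mass matrix is the square of the `L²` norm. -/
theorem sum_massMatrix (hΩ : BoundedDomain Ω) (c : Idx 𝒯 r → ℝ) :
    ∑ α, ∑ β, massMatrix 𝒯 r α β * c α * c β = ∫ x in Ω, feFun c x ^ 2 := by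
  have h1 : ∀ x, feFun c x ^ 2 = ∑ α, c α * (bern α x • feFun c x) := by
    intro x
    rw [sq]
    conv_lhs => enter [1]; rw [feFun]
    rw [Finset.sum_mul]
    refine Finset.sum_congr rfl fun α _ => ?_
    simp only [smul_eq_mul]
    ring
  simp_rw [h1]
  rw [integral_finsetSum _ fun α _ =>
    (integrableOn_bern_smul hΩ α (integrableOn_feFun hΩ c)).const_mul _]
  refine Finset.sum_congr rfl fun α _ => ?_
  rw [integral_const_mul, integral_bern_smul_feFun hΩ, Finset.mul_sum]
  refine Finset.sum_congr rfl fun β _ => ?_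
  rw [smul_eq_mul]; ring

theorem sq_coeff_mul_volume_le (hΩ : BoundedDomain Ω) (hu : 𝒯.IsUniform K h) (t : 𝒯.elements)
    (c : Idx 𝒯 r → ℝ) {α : Idx 𝒯 r} (hα : α ∈ locIdx r t) :
    c α ^ 2 * volume.real (interior (tet (t : Finset E3))) ≤
      locConst r ^ 2 * ∫ x in interior (tet (t : Finset E3)), feFun c x ^ 2 := by
  set T := interior (tet (t : Finset E3)) with hT
  have hTΩ : T ⊆ Ω := interior_tet_subset hΩ t
  have hl := locConst_nonneg r
  have i1 : IntegrableOn (feFun c) T := (integrableOn_feFun hΩ c).mono_set hTΩ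
  have i2 : IntegrableOn (fun x => feFun c x ^ 2) T := (integrableOn_sq_feFun hΩ c).mono_set hTΩ
  have h1 : volume.real T * |c α| ≤ locConst r * ∫ x in T, ‖feFun c x‖ := by
    have h2 := volume_mul_enorm_coeff_le t c hα
    rw [← ofReal_integral_norm_eq_lintegral_enorm i1, ← ENNReal.ofReal_mul hl,
      ← ENNReal.ofReal_toReal (hu.volume_ne_top t), ← ofReal_norm,
      ← ENNReal.ofReal_mul ENNReal.toReal_nonneg, ENNReal.ofReal_le_ofReal_iff] at h2
    · exact h2
    · exact mul_nonneg hl (integral_nonneg fun _ => norm_nonneg _)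
  have h3 : ∫ x in T, 2 * |c α| * (locConst r * ‖feFun c x‖) ≤
      ∫ x in T, (locConst r ^ 2 * feFun c x ^ 2 + c α ^ 2) := by
    refine integral_mono ((i1.norm.const_mul _).const_mul _) ((i2.const_mul _).add ?_) fun x => ?_
    · exact integrableOn_const (hu.volume_ne_top t)
    · have := sq_nonneg (locConst r * ‖feFun c x‖ - |c α|)
      have e1 : ‖feFun c x‖ ^ 2 = feFun c x ^ 2 := by rw [Real.norm_eq_abs, sq_abs]
      have e2 : |c α| ^ 2 = c α ^ 2 := sq_abs _
      simp only
      nlinarith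
  rw [integral_add (i2.const_mul _) (integrableOn_const (hu.volume_ne_top t)), integral_const_mul,
    integral_const_mul, integral_const_mul, setIntegral_const, smul_eq_mul] at h3
  have h4 : c α ^ 2 = |c α| * |c α| := by rw [← sq, sq_abs]
  have h5 := mul_le_mul_of_nonneg_left h1 (abs_nonneg (c α))
  rw [h4] at h3 ⊢
  linarith

theorem le_volume_real (hu : 𝒯.IsUniform K h) (t : 𝒯.elements) :
    (h / K) ^ 3 * ballVol ≤ volume.real (interior (tet (t : Finset E3))) := by
  have hK := hu.K_pos
  have hh := hu.pos
  have hb := ballVol_pos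
  rw [measureReal_def, ← ENNReal.ofReal_le_iff_le_toReal (hu.volume_ne_top t)]
  exact hu.le_volume t

theorem volume_real_le (hu : 𝒯.IsUniform K h) (t : 𝒯.elements) :
    volume.real (interior (tet (t : Finset E3))) ≤ h ^ 3 * ballVol := by
  have hh := hu.pos
  have hb := ballVol_pos
  exact ENNReal.toReal_le_of_le_ofReal (by positivity) (hu.volume_le t)

/-- The lower bound of the mass matrix, divided by `h ^ 3`. -/
def massLow (r : ℕ) (K : ℝ) : ℝ :=
  ballVol / (K ^ 3 * (Fintype.card (RefIdx r) * locConst r ^ 2 + 1))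

/-- The upper bound of the mass matrix, divided by `h ^ 3`. -/
def massUp (r : ℕ) (K : ℝ) : ℝ := ballVol * Fintype.card (RefIdx r) * K ^ 3

theorem sum_sq_le_sum_locIdx (c : Idx 𝒯 r → ℝ) :
    ∑ α, c α ^ 2 ≤ ∑ t : 𝒯.elements, ∑ α ∈ locIdx r t, c α ^ 2 := by
  classical
  have e : ∀ t : 𝒯.elements, ∑ α ∈ locIdx r t, c α ^ 2 =
      ∑ α, if α ∈ locIdx r t then c α ^ 2 else 0 := fun t => by
    rw [Finset.sum_ite_mem, Finset.univ_inter]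
  simp_rw [e]
  rw [Finset.sum_comm]
  refine Finset.sum_le_sum fun α _ => ?_
  have h1 : α ∈ locIdx r α.2.choose := mem_locIdx.2 α.2.choose_spec.1
  refine le_trans (le_of_eq (if_pos h1).symm) (Finset.single_le_sum
    (f := fun t : 𝒯.elements => if α ∈ locIdx r t then c α ^ 2 else 0) (fun t _ => ?_)
    (Finset.mem_univ α.2.choose))
  split_ifs <;> positivity

/-- The mass matrix is bounded from below by a multiple of `h ^ 3`. -/
theorem massLow_mul_le (hΩ : BoundedDomain Ω) (hu : 𝒯.IsUniform K h) (c : Idx 𝒯 r → ℝ) :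
    massLow r K * h ^ 3 * ∑ α, c α ^ 2 ≤ ∑ α, ∑ β, massMatrix 𝒯 r α β * c α * c β := by
  have hK := hu.K_pos
  have hh := hu.pos
  have hb := ballVol_pos
  have hl := locConst_nonneg r
  set D := Fintype.card (RefIdx r) with hD
  have hI : ∀ t : 𝒯.elements, 0 ≤ ∫ x in interior (tet (t : Finset E3)), feFun c x ^ 2 :=
    fun t => integral_nonneg fun _ => sq_nonneg _
  rw [sum_massMatrix hΩ, integral_eq_sum 𝒯 hΩ (integrableOn_sq_feFun hΩ c)]
  have h1 : ∀ t : 𝒯.elements, ∀ α ∈ locIdx r t,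
      massLow r K * h ^ 3 * c α ^ 2 * (D * locConst r ^ 2 + 1) ≤
      locConst r ^ 2 * ∫ x in interior (tet (t : Finset E3)), feFun c x ^ 2 := by
    intro t α hα
    refine le_trans ?_ (sq_coeff_mul_volume_le hΩ hu t c hα)
    have h2 := mul_le_mul_of_nonneg_left (le_volume_real hu t) (sq_nonneg (c α))
    refine le_trans (le_of_eq ?_) h2
    rw [massLow, ← hD]
    field_simp
  have h3 : ∀ t : 𝒯.elements, massLow r K * h ^ 3 * ∑ α ∈ locIdx r t, c α ^ 2 ≤
      ∫ x in interior (tet (t : Finset E3)), feFun c x ^ 2 := by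
    intro t
    have h4 := Finset.sum_le_sum (h1 t)
    rw [Finset.sum_const, card_locIdx, nsmul_eq_mul, ← Finset.sum_mul, ← Finset.mul_sum] at h4
    have h5 : 0 < D * locConst r ^ 2 + 1 := by positivity
    refine le_of_mul_le_mul_right (h4.trans ?_) h5
    have := hI t
    rw [← hD]
    nlinarith
  calc _ ≤ massLow r K * h ^ 3 * ∑ t : 𝒯.elements, ∑ α ∈ locIdx r t, c α ^ 2 := by
        have : 0 ≤ massLow r K := by unfold massLow; positivity
        gcongr
        exact sum_sq_le_sum_locIdx c
    _ ≤ _ := by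
        rw [Finset.mul_sum]
        exact Finset.sum_le_sum fun t _ => h3 t

/-! ### Nodes -/

open Classical in
/-- A vertex in the support of a multi-index, which serves as the position of the corresponding
basis function. The support is empty only for `r = 0`, and then the value is `0`. -/
def node (α : Idx 𝒯 r) : E3 := if hα : α.1.support.Nonempty then hα.choose else 0

theorem node_mem_support (hr : 1 ≤ r) (α : Idx 𝒯 r) : node α ∈ α.1.support := by
  have hα : α.1.support.Nonempty := by
    obtain ⟨-, -, h⟩ := α.2
    rw [Finsupp.support_nonempty_iff]
    intro h0
    rw [h0, map_zero] at h
    omega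
  rw [node, dif_pos hα]
  exact hα.choose_spec

theorem node_mem (hr : 1 ≤ r) {t : 𝒯.elements} {α : Idx 𝒯 r} (hα : α ∈ locIdx r t) :
    node α ∈ (t : Finset E3) := mem_locIdx.1 hα (node_mem_support hr α)

theorem dist_node_le (hr : 1 ≤ r) (hu : 𝒯.IsUniform K h) {t : 𝒯.elements} {α : Idx 𝒯 r}
    (hα : α ∈ locIdx r t) {x : E3} (hx : x ∈ tet (t : Finset E3)) : dist x (node α) ≤ h :=
  hu.dist_le hx (vertex_mem_tet (node_mem hr hα))

theorem card_filter_mem_locIdx_le (hr : 1 ≤ r) (hu : 𝒯.IsUniform K h) (α : Idx 𝒯 r)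
    [DecidablePred fun t : 𝒯.elements => α ∈ locIdx r t] :
    ((Finset.univ.filter fun t : 𝒯.elements => α ∈ locIdx r t).card : ℝ) ≤ K ^ 3 := by
  have h1 := hu.card_le (S := Finset.univ.filter fun t : 𝒯.elements => α ∈ locIdx r t)
    (y := node α) zero_le_one (fun t ht => by
      rw [one_mul]
      exact hu.tet_subset_closedBall
        (vertex_mem_tet (node_mem hr (Finset.mem_filter.1 ht).2)))
  rwa [one_mul] at h1

/-- The mass matrix is bounded from above by a multiple of `h ^ 3`. -/
theorem le_massUp_mul (hr : 1 ≤ r) (hΩ : BoundedDomain Ω) (hu : 𝒯.IsUniform K h)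
    (c : Idx 𝒯 r → ℝ) :
    ∑ α, ∑ β, massMatrix 𝒯 r α β * c α * c β ≤ massUp r K * h ^ 3 * ∑ α, c α ^ 2 := by
  classical
  have hK := hu.K_pos
  have hh := hu.pos
  have hb := ballVol_pos
  set D := Fintype.card (RefIdx r) with hD
  rw [sum_massMatrix hΩ, integral_eq_sum 𝒯 hΩ (integrableOn_sq_feFun hΩ c)]
  have h1 : ∀ t : 𝒯.elements, ∫ x in interior (tet (t : Finset E3)), feFun c x ^ 2 ≤
      h ^ 3 * ballVol * D * ∑ α ∈ locIdx r t, c α ^ 2 := by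
    intro t
    have h2 : ∫ x in interior (tet (t : Finset E3)), feFun c x ^ 2 ≤
        ∫ x in interior (tet (t : Finset E3)), D * ∑ α ∈ locIdx r t, c α ^ 2 := by
      refine setIntegral_mono_on ((integrableOn_sq_feFun hΩ c).mono_set (interior_tet_subset hΩ t))
        (integrableOn_const (hu.volume_ne_top t)) isOpen_interior.measurableSet fun x hx => ?_
      have h3 := norm_feFun_le (interior_subset hx) c
      have h4 := sq_sum_le_card_mul_sum_sq (s := locIdx r t) (f := fun α => ‖c α‖)
      rw [card_locIdx] at h4
      simp only [Real.norm_eq_abs, sq_abs] at h3 h4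
      rw [← sq_abs]
      exact (pow_le_pow_left₀ (abs_nonneg _) h3 2).trans h4
    rw [setIntegral_const, smul_eq_mul] at h2
    refine h2.trans ?_
    rw [mul_assoc]
    have : 0 ≤ ∑ α ∈ locIdx r t, c α ^ 2 := Finset.sum_nonneg fun _ _ => sq_nonneg _
    have := volume_real_le hu t
    gcongr
  refine (Finset.sum_le_sum fun t _ => h1 t).trans ?_
  rw [← Finset.mul_sum]
  have h5 : ∑ t : 𝒯.elements, ∑ α ∈ locIdx r t, c α ^ 2 ≤ K ^ 3 * ∑ α, c α ^ 2 := by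
    have e : ∀ t : 𝒯.elements, ∑ α ∈ locIdx r t, c α ^ 2 =
        ∑ α, if α ∈ locIdx r t then c α ^ 2 else 0 := fun t => by
      rw [Finset.sum_ite_mem, Finset.univ_inter]
    simp_rw [e]
    rw [Finset.sum_comm, Finset.mul_sum]
    refine Finset.sum_le_sum fun α _ => ?_
    rw [← Finset.sum_filter, Finset.sum_const, nsmul_eq_mul]
    exact mul_le_mul_of_nonneg_right (card_filter_mem_locIdx_le hr hu α) (sq_nonneg _)
  calc _ ≤ h ^ 3 * ballVol * D * (K ^ 3 * ∑ α, c α ^ 2) := by gcongr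
    _ = _ := by rw [massUp]; ring

theorem exists_locIdx_of_massMatrix_ne_zero {α β : Idx 𝒯 r} (h : massMatrix 𝒯 r α β ≠ 0) :
    ∃ t : 𝒯.elements, α ∈ locIdx r t ∧ β ∈ locIdx r t := by
  by_contra! hne
  refine h ?_
  rw [massMatrix]
  refine setIntegral_eq_zero_of_forall_eq_zero fun x hx => ?_
  obtain ⟨t, ht⟩ := exists_mem_tet 𝒯 (subset_closure hx)
  by_cases hα : α ∈ locIdx r t
  · rw [bern_eq_zero ht (hne t hα), mul_zero]
  · rw [bern_eq_zero ht hα, zero_mul]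

theorem massLow_pos (hK : 0 < K) : 0 < massLow r K := by
  have := ballVol_pos
  unfold massLow
  positivity

theorem isUnit_massMatrix (hΩ : BoundedDomain Ω) (hu : 𝒯.IsUniform K h) [DecidableEq (Idx 𝒯 r)] :
    IsUnit (massMatrix 𝒯 r) := by
  rw [← Matrix.mulVec_injective_iff_isUnit, ← Matrix.coe_mulVecLin, ← LinearMap.ker_eq_bot,
    LinearMap.ker_eq_bot']
  intro c hc
  have h1 := massLow_mul_le hΩ hu c
  have h2 : ∑ α, ∑ β, massMatrix 𝒯 r α β * c α * c β = 0 := by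
    refine Finset.sum_eq_zero fun α _ => ?_
    have h3 := congrFun hc α
    rw [Matrix.mulVecLin_apply, Matrix.mulVec, dotProduct] at h3
    rw [← mul_zero (c α), ← Pi.zero_apply (M := fun _ => ℝ) α, ← h3, Finset.mul_sum]
    exact Finset.sum_congr rfl fun β _ => by ring
  rw [h2] at h1
  have h4 : 0 < massLow r K * h ^ 3 := mul_pos (massLow_pos hu.K_pos) (pow_pos hu.pos 3)
  have h5 : ∑ α, c α ^ 2 ≤ 0 := by
    by_contra! h6
    exact absurd h1 (mul_pos h4 h6).not_ge
  have h6 := (Finset.sum_eq_zero_iff_of_nonneg fun α _ => sq_nonneg (c α)).1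
    (le_antisymm h5 (Finset.sum_nonneg fun α _ => sq_nonneg (c α)))
  ext α
  exact pow_eq_zero_iff (two_ne_zero) |>.1 (h6 α (Finset.mem_univ α))

theorem exists_small_rate {a b : ℝ} (ha : 0 < a) (hb : 0 ≤ b) :
    ∃ ε : ℝ, 0 < ε ∧ ε ≤ 1 ∧ ((1 + ε) ^ 4 - 1) ^ 2 * b ≤ a := by
  refine ⟨min 1 (a / (225 * (a + b))), by positivity, min_le_left _ _, ?_⟩
  set ε := min 1 (a / (225 * (a + b))) with hε
  have h0 : 0 < ε := by positivity
  have h1 : ε ≤ 1 := min_le_left _ _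
  have h2 : ε ≤ a / (225 * (a + b)) := min_le_right _ _
  rw [le_div_iff₀ (by positivity)] at h2
  have h3 : (1 + ε) ^ 4 - 1 ≤ 15 * ε := by nlinarith [pow_pos h0 2, pow_pos h0 3]
  have h4 : 0 ≤ (1 + ε) ^ 4 - 1 := by
    have : 1 ≤ (1 + ε) ^ 4 := one_le_pow₀ (by linarith)
    linarith
  have h5 : ((1 + ε) ^ 4 - 1) ^ 2 ≤ (15 * ε) ^ 2 := pow_le_pow_left₀ h4 h3 2
  have h6 : (15 * ε) ^ 2 ≤ 225 * ε := by nlinarith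
  calc _ ≤ 225 * ε * b := by gcongr; exact h5.trans h6
    _ ≤ a := by nlinarith

/-- The slow variation of the weights `a ↦ a ^ 4` that is used to prove decay. -/
theorem sq_pow_sub_pow_le {a b ε : ℝ} (ha : 1 ≤ a) (hb : 1 ≤ b) (hε : 0 ≤ ε) (hab : |a - b| ≤ ε) :
    (a ^ 4 - b ^ 4) ^ 2 ≤ ((1 + ε) ^ 4 - 1) ^ 2 * (a ^ 4 * b ^ 4) := by
  wlog hle : b ≤ a generalizing a b
  · have := this hb ha (by rwa [abs_sub_comm]) (not_le.1 hle).le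
    rw [← neg_sub, neg_sq, mul_comm (a ^ 4)]
    exact this
  have h1 : a ≤ b * (1 + ε) := by
    have := (abs_le.1 hab).2
    nlinarith
  have h2 : a ^ 4 ≤ b ^ 4 * (1 + ε) ^ 4 := by
    rw [← mul_pow]
    exact pow_le_pow_left₀ (by linarith) h1 4
  have h3 : b ^ 4 ≤ a ^ 4 := pow_le_pow_left₀ (by linarith) hle 4
  have h4 : 1 ≤ (1 + ε) ^ 4 := one_le_pow₀ (by linarith)
  have h5 : 0 < b ^ 4 := by positivity
  calc (a ^ 4 - b ^ 4) ^ 2 ≤ (((1 + ε) ^ 4 - 1) * b ^ 4) ^ 2 :=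
        pow_le_pow_left₀ (by linarith) (by linarith) 2
    _ = ((1 + ε) ^ 4 - 1) ^ 2 * (b ^ 4 * b ^ 4) := by ring
    _ ≤ _ := by gcongr

open Classical in
/-- The entries of the inverse of the mass matrix decay away from the diagonal, on the scale of the
meshwidth. -/
theorem exists_abs_inv_massMatrix_le (hr : 1 ≤ r) (hK : 0 < K) :
    ∃ C : ℝ, 0 ≤ C ∧ ∀ {Ω : Set E3} {𝒯 : Triangulation Ω} {h : ℝ}, BoundedDomain Ω →
      𝒯.IsUniform K h → ∀ α β : Idx 𝒯 r, |(massMatrix 𝒯 r)⁻¹ α β| ≤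
        C * (h⁻¹ ^ 3 * ((1 + ‖node α - node β‖ / h) ^ 4)⁻¹) := by
  have hlow : 0 < massLow r K := massLow_pos hK
  have hup : 0 ≤ massUp r K := by have := ballVol_pos; unfold massUp; positivity
  obtain ⟨ε, hε0, hε1, hε⟩ := exists_small_rate hlow hup
  refine ⟨2 / (massLow r K * ε ^ 4), by positivity, fun {Ω 𝒯 h} hΩ hu α β => ?_⟩
  have hh := hu.pos
  -- the weights grow slowly enough for the small rate `ε`, since coupled nodes have distance `≤ h`
  set wt : Idx 𝒯 r → ℝ := fun γ => (1 + ε * (‖node γ - node β‖ / h)) ^ 4 with hwt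
  have h1 : (massMatrix 𝒯 r).mulVec (fun γ => (massMatrix 𝒯 r)⁻¹ γ β) = Pi.single β 1 := by
    have := Matrix.mul_nonsing_inv (massMatrix 𝒯 r)
      ((Matrix.isUnit_iff_isUnit_det _).1 (isUnit_massMatrix hΩ hu))
    ext γ
    have h2 := congrFun (congrFun this γ) β
    rw [Matrix.mul_apply] at h2
    rw [Matrix.mulVec, dotProduct, h2, Matrix.one_apply, Pi.single_apply]
  have h2 := abs_le_of_mulVec_eq_single massMatrix_symm massMatrix_nonneg
    (a := massLow r K * h ^ 3) (b := massUp r K * h ^ 3) (θ := ((1 + ε) ^ 4 - 1) ^ 2) (wt := wt)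
    (by positivity) (massLow_mul_le hΩ hu) (le_massUp_mul hr hΩ hu)
    (by rw [← mul_assoc]; gcongr) (sq_nonneg _) (fun γ => by positivity) ?_ (by simp [hwt]) h1 α
  · refine h2.trans ?_
    have h3 : ε ^ 4 * (1 + ‖node α - node β‖ / h) ^ 4 ≤ wt α := by
      rw [hwt, ← mul_pow]
      have : 0 ≤ ‖node α - node β‖ / h := by positivity
      refine pow_le_pow_left₀ (by positivity) ?_ 4
      linarith
    calc 2 / (massLow r K * h ^ 3 * wt α)
        ≤ 2 / (massLow r K * h ^ 3 * (ε ^ 4 * (1 + ‖node α - node β‖ / h) ^ 4)) := by gcongr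
      _ = _ := by field_simp
  · intro γ δ hγδ
    obtain ⟨t, ht, ht'⟩ := exists_locIdx_of_massMatrix_ne_zero hγδ
    refine sq_pow_sub_pow_le ?_ ?_ hε0.le ?_
    · have : 0 ≤ ε * (‖node γ - node β‖ / h) := by positivity
      linarith
    · have : 0 ≤ ε * (‖node δ - node β‖ / h) := by positivity
      linarith
    · have h4 := dist_node_le hr hu ht' (vertex_mem_tet (node_mem hr ht))
      have h5 := abs_norm_sub_norm_le (node γ - node β) (node δ - node β)
      rw [sub_sub_sub_cancel_right, ← dist_eq_norm] at h5
      have e : 1 + ε * (‖node γ - node β‖ / h) - (1 + ε * (‖node δ - node β‖ / h)) =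
        ε * ((‖node γ - node β‖ - ‖node δ - node β‖) / h) := by ring
      rw [e, abs_mul, abs_of_pos hε0, abs_div, abs_of_pos hh]
      refine mul_le_of_le_one_right hε0.le ?_
      rw [div_le_one hh]
      exact h5.trans h4

/-! ### The `L²` projection onto the finite element space -/

open Classical in
/-- The coefficients of the finite element function with given moments, by means of the inverse of
the mass matrix. -/
def solve (b : Idx 𝒯 r → F) (α : Idx 𝒯 r) : F := ∑ β, (massMatrix 𝒯 r)⁻¹ α β • b β

/-- The coefficients of the `L²(Ω)`-orthogonal projection of a function onto the finite element
space. It makes sense for all integrable functions. -/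
def proj (𝒯 : Triangulation Ω) (r : ℕ) (u : E3 → F) : Idx 𝒯 r → F :=
  solve fun β => ∫ x in Ω, bern β x • u x

theorem sum_massMatrix_smul_solve (hΩ : BoundedDomain Ω) (hu : 𝒯.IsUniform K h) (b : Idx 𝒯 r → F)
    (α : Idx 𝒯 r) : ∑ β, massMatrix 𝒯 r α β • solve b β = b α := by
  classical
  have := Matrix.mul_nonsing_inv (massMatrix 𝒯 r)
    ((Matrix.isUnit_iff_isUnit_det _).1 (isUnit_massMatrix hΩ hu))
  simp only [solve, Finset.smul_sum, smul_smul]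
  rw [Finset.sum_comm]
  simp only [← Finset.sum_smul]
  have e : ∀ γ, ∑ β, massMatrix 𝒯 r α β * (massMatrix 𝒯 r)⁻¹ β γ =
      if α = γ then 1 else 0 := by
    intro γ
    rw [← Matrix.one_apply, ← this, Matrix.mul_apply]
  rw [Finset.sum_congr rfl fun γ _ => by
    rw [show (∑ i, massMatrix 𝒯 r α i * (massMatrix 𝒯 r)⁻¹ i γ) = if α = γ then 1 else 0 by
      convert e γ]]
  simp

theorem solve_sum_massMatrix (hΩ : BoundedDomain Ω) (hu : 𝒯.IsUniform K h) (c : Idx 𝒯 r → F) :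
    solve (fun α => ∑ β, massMatrix 𝒯 r α β • c β) = c := by
  classical
  have := Matrix.nonsing_inv_mul (massMatrix 𝒯 r)
    ((Matrix.isUnit_iff_isUnit_det _).1 (isUnit_massMatrix hΩ hu))
  ext α
  simp only [solve, Finset.smul_sum, smul_smul]
  rw [Finset.sum_comm]
  simp only [← Finset.sum_smul]
  have e : ∀ γ, ∑ β, (massMatrix 𝒯 r)⁻¹ α β * massMatrix 𝒯 r β γ =
      if α = γ then 1 else 0 := by
    intro γ
    rw [← Matrix.one_apply, ← this, Matrix.mul_apply]
  rw [Finset.sum_congr rfl fun γ _ => by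
    rw [show (∑ i, (massMatrix 𝒯 r)⁻¹ α i * massMatrix 𝒯 r i γ) = if α = γ then 1 else 0 by
      convert e γ]]
  simp

/-- The projection has the same moments as the function, which is its defining property. -/
theorem integral_bern_smul_feFun_proj [CompleteSpace F] (hΩ : BoundedDomain Ω)
    (hu : 𝒯.IsUniform K h) (u : E3 → F) (α : Idx 𝒯 r) :
    ∫ x in Ω, bern α x • feFun (proj 𝒯 r u) x = ∫ x in Ω, bern α x • u x := by
  rw [integral_bern_smul_feFun hΩ, proj, sum_massMatrix_smul_solve hΩ hu]

theorem proj_feFun [CompleteSpace F] (hΩ : BoundedDomain Ω) (hu : 𝒯.IsUniform K h)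
    (c : Idx 𝒯 r → F) : proj 𝒯 r (feFun c) = c := by
  rw [proj]
  simp only [integral_bern_smul_feFun hΩ]
  exact solve_sum_massMatrix hΩ hu c

theorem proj_sub (hΩ : BoundedDomain Ω) {u v : E3 → F} (hu : IntegrableOn u Ω)
    (hv : IntegrableOn v Ω) : proj 𝒯 r (u - v) = proj 𝒯 r u - proj 𝒯 r v := by
  ext α
  simp only [proj, solve, Pi.sub_apply, smul_sub]
  rw [← Finset.sum_sub_distrib]
  refine Finset.sum_congr rfl fun β _ => ?_
  rw [← smul_sub, integral_sub (integrableOn_bern_smul hΩ β hu) (integrableOn_bern_smul hΩ β hv)]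

theorem proj_congr {u v : E3 → F} (huv : u =ᵐ[volume.restrict Ω] v) :
    proj 𝒯 r u = proj 𝒯 r v := by
  unfold proj
  congr 1
  ext β
  refine integral_congr_ae ?_
  filter_upwards [huv] with x hx
  rw [hx]

theorem bern_ne_zero_imp (hr : 1 ≤ r) (hu : 𝒯.IsUniform K h) {α : Idx 𝒯 r} {x : E3}
    (hx : x ∈ closure Ω) (h0 : bern α x ≠ 0) : x ∈ Metric.closedBall (node α) h := by
  obtain ⟨t, ht⟩ := exists_mem_tet 𝒯 hx
  have hα : α ∈ locIdx r t := by
    by_contra hα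
    exact h0 (bern_eq_zero ht hα)
  exact dist_node_le hr hu hα ht

theorem enorm_integral_bern_smul_le (hr : 1 ≤ r) (hΩ : IsOpen Ω) (hu : 𝒯.IsUniform K h)
    (α : Idx 𝒯 r) (u : E3 → F) :
    ‖∫ x in Ω, bern α x • u x‖ₑ ≤ ∫⁻ x in Ω ∩ Metric.closedBall (node α) h, ‖u x‖ₑ := by
  refine (enorm_integral_le_lintegral_enorm _).trans ?_
  rw [← lintegral_indicator hΩ.measurableSet, ← lintegral_indicator
    (hΩ.measurableSet.inter measurableSet_closedBall)]
  refine lintegral_mono fun x => ?_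
  by_cases hx : x ∈ Ω
  · simp only [Set.indicator_of_mem hx]
    by_cases h0 : bern α x = 0
    · simp [h0]
    · rw [Set.indicator_of_mem (Set.mem_inter hx
        (bern_ne_zero_imp hr hu (subset_closure hx) h0)), enorm_smul]
      refine mul_le_of_le_one_left' ?_
      rw [← ofReal_norm, ENNReal.ofReal_le_one, Real.norm_of_nonneg (bern_nonneg α x)]
      exact bern_le_one α x
  · rw [Set.indicator_of_notMem hx]
    exact zero_le

/-- A bounded number of nodes lies within distance `L h` of a point. -/
theorem card_node_mem_ball_le (hr : 1 ≤ r) (hu : 𝒯.IsUniform K h) {L : ℝ} (hL : 0 ≤ L) (y : E3)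
    [DecidablePred fun β : Idx 𝒯 r => y ∈ Metric.closedBall (node β) (L * h)] :
    ((Finset.univ.filter fun β : Idx 𝒯 r => y ∈ Metric.closedBall (node β) (L * h)).card : ℝ) ≤
      Fintype.card (RefIdx r) * ((L + 1) * K) ^ 3 := by
  classical
  set S := Finset.univ.filter fun β : Idx 𝒯 r => y ∈ Metric.closedBall (node β) (L * h) with hS
  have hmem : ∀ β : Idx 𝒯 r, β ∈ locIdx r β.2.choose := fun β => mem_locIdx.2 β.2.choose_spec.1
  have h1 : S.card ≤ Fintype.card (RefIdx r) * (S.image fun β => β.2.choose).card := by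
    refine Finset.card_le_mul_card_image S _ fun t _ => ?_
    rw [← card_locIdx (r := r) t]
    refine Finset.card_le_card fun β hβ => ?_
    rw [← (Finset.mem_filter.1 hβ).2]
    exact hmem β
  have h2 := hu.card_le (S := S.image fun β => β.2.choose) (y := y) (L := L + 1) (by positivity) ?_
  · calc (S.card : ℝ) ≤ Fintype.card (RefIdx r) * (S.image fun β => β.2.choose).card := by
          exact_mod_cast h1
      _ ≤ _ := by gcongr
  · intro t ht x hx
    obtain ⟨β, hβ, rfl⟩ := Finset.mem_image.1 ht
    have h3 : dist y (node β) ≤ L * h := (Finset.mem_filter.1 hβ).2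
    have h4 := dist_node_le hr hu (hmem β) hx
    rw [Metric.mem_closedBall]
    calc dist x y ≤ dist x (node β) + dist y (node β) := dist_triangle_right _ _ _
      _ ≤ (L + 1) * h := by linarith

/-- If the moments of a finite element function are bounded by local integrals of `f`, then the
function is bounded pointwise by the average of `f`. -/
theorem exists_enorm_feFun_solve_le (hr : 1 ≤ r) (hK : 0 < K) {L : ℝ} (hL : 0 ≤ L) :
    ∃ C : ℝ≥0, ∀ {Ω : Set E3} {𝒯 : Triangulation Ω} {h : ℝ}, BoundedDomain Ω →
      𝒯.IsUniform K h → ∀ {b : Idx 𝒯 r → F} {f : E3 → ℝ≥0∞}, AEMeasurable f (volume.restrict Ω) →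
      (∀ β, ‖b β‖ₑ ≤ ∫⁻ y in Ω ∩ Metric.closedBall (node β) (L * h), f y) →
      ∀ x ∈ closure Ω, ‖feFun (solve b) x‖ₑ ≤ C * avgOp Ω h f x := by
  classical
  obtain ⟨C₀, hC₀, hC⟩ := exists_abs_inv_massMatrix_le hr hK
  set D : ℝ := (Fintype.card (RefIdx r) : ℝ) with hD
  set N : ℝ := D * ((L + 1) * K) ^ 3 with hN
  refine ⟨(D * (C₀ * (2 + L) ^ 4 * N)).toNNReal, fun {Ω 𝒯 h} hΩ hu {b f} hf hb x hx => ?_⟩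
  have hh := hu.pos
  have hD0 : 0 ≤ D := by positivity
  have hN0 : 0 ≤ N := by positivity
  obtain ⟨t, ht⟩ := exists_mem_tet 𝒯 hx
  set k : E3 → ℝ≥0∞ := fun y => decayKernel h (x - y) * f y with hk
  have hkm : AEMeasurable k (volume.restrict Ω) :=
    (((measurable_decayKernel h).comp (measurable_const_sub x)).aemeasurable).mul hf
  have h1 : ∀ α ∈ locIdx r t, ‖solve b α‖ₑ ≤
      ENNReal.ofReal (C₀ * (2 + L) ^ 4 * N) * avgOp Ω h f x := by
    intro α hα
    have hxα : ‖x - node α‖ ≤ h := by rw [← dist_eq_norm]; exact dist_node_le hr hu hα ht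
    have h2 : ∀ β, ‖(massMatrix 𝒯 r)⁻¹ α β • b β‖ₑ ≤ ENNReal.ofReal (C₀ * (2 + L) ^ 4) *
        ∫⁻ y in Ω, (Metric.closedBall (node β) (L * h)).indicator k y := by
      intro β
      rw [setLIntegral_indicator measurableSet_closedBall, Set.inter_comm, enorm_smul,
        ← lintegral_const_mul' _ _ ENNReal.ofReal_ne_top]
      refine (mul_le_mul_right (hb β) _).trans ?_
      rw [← lintegral_const_mul' _ _ enorm_ne_top]
      refine setLIntegral_mono' (hΩ.isOpen.measurableSet.inter measurableSet_closedBall)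
        fun y hy => ?_
      rw [hk, ← mul_assoc, decayKernel, ← ENNReal.ofReal_mul (by positivity), ← ofReal_norm,
        Real.norm_eq_abs]
      refine mul_le_mul_left (ENNReal.ofReal_le_ofReal ((hC hΩ hu α β).trans ?_)) _
      have h3 : ‖y - node β‖ ≤ L * h := by rw [← dist_eq_norm]; exact hy.2
      have h4 : ‖x - y‖ ≤ h + ‖node α - node β‖ + L * h := by
        have e : x - y = (x - node α) + (node α - node β) - (y - node β) := by abel
        rw [e]
        refine (norm_sub_le _ _).trans ?_
        have := norm_add_le (x - node α) (node α - node β)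
        linarith
      have h5 : 1 + ‖x - y‖ / h ≤ (2 + L) * (1 + ‖node α - node β‖ / h) := by
        have h6 : ‖x - y‖ / h ≤ 1 + ‖node α - node β‖ / h + L := by
          rw [div_le_iff₀ hh]
          refine h4.trans_eq ?_
          field_simp
        have h7 : 0 ≤ ‖node α - node β‖ / h := by positivity
        nlinarith [mul_nonneg hL h7]
      have h8 : (1 + ‖x - y‖ / h) ^ 4 ≤ (2 + L) ^ 4 * (1 + ‖node α - node β‖ / h) ^ 4 := by
        rw [← mul_pow]
        exact pow_le_pow_left₀ (by positivity) h5 4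
      have h9 : ((1 + ‖node α - node β‖ / h) ^ 4)⁻¹ ≤
          (2 + L) ^ 4 * ((1 + ‖x - y‖ / h) ^ 4)⁻¹ := by
        rw [← div_eq_mul_inv, inv_eq_one_div, div_le_div_iff₀ (by positivity) (by positivity),
          one_mul]
        exact h8
      calc C₀ * (h⁻¹ ^ 3 * ((1 + ‖node α - node β‖ / h) ^ 4)⁻¹)
          ≤ C₀ * (h⁻¹ ^ 3 * ((2 + L) ^ 4 * ((1 + ‖x - y‖ / h) ^ 4)⁻¹)) := by gcongr
        _ = _ := by ring
    calc ‖solve b α‖ₑ ≤ ∑ β, ‖(massMatrix 𝒯 r)⁻¹ α β • b β‖ₑ := by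
          unfold solve
          convert enorm_sum_le _ _
      _ ≤ ∑ β, ENNReal.ofReal (C₀ * (2 + L) ^ 4) *
          ∫⁻ y in Ω, (Metric.closedBall (node β) (L * h)).indicator k y :=
          Finset.sum_le_sum fun β _ => h2 β
      _ = ENNReal.ofReal (C₀ * (2 + L) ^ 4) *
          ∫⁻ y in Ω, ∑ β : Idx 𝒯 r, (Metric.closedBall (node β) (L * h)).indicator k y := by
          rw [← Finset.mul_sum, lintegral_finsetSum' _ fun β _ =>
            hkm.indicator measurableSet_closedBall]
      _ ≤ ENNReal.ofReal (C₀ * (2 + L) ^ 4) * ∫⁻ y in Ω, ENNReal.ofReal N * k y := by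
          gcongr with y
          simp only [Set.indicator_apply]
          rw [← Finset.sum_filter, Finset.sum_const, nsmul_eq_mul]
          gcongr
          rw [← ENNReal.ofReal_natCast]
          exact ENNReal.ofReal_le_ofReal (card_node_mem_ball_le hr hu hL y)
      _ = _ := by
          rw [lintegral_const_mul' _ _ ENNReal.ofReal_ne_top, ← mul_assoc,
            ← ENNReal.ofReal_mul (by positivity)]
          rfl
  have h2 := ENNReal.ofReal_le_ofReal (norm_feFun_le ht (solve b))
  rw [ofReal_norm, ofReal_sum_norm] at h2
  refine (h2.trans (Finset.sum_le_sum h1)).trans_eq ?_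
  rw [Finset.sum_const, card_locIdx, nsmul_eq_mul, ← mul_assoc, ← ENNReal.ofReal_natCast,
    ← ENNReal.ofReal_mul (by positivity)]
  rfl

/-- The `L²` projection is bounded pointwise by the averaging operator. -/
theorem exists_enorm_feFun_proj_le (hr : 1 ≤ r) (hK : 0 < K) :
    ∃ C : ℝ≥0, ∀ {Ω : Set E3} {𝒯 : Triangulation Ω} {h : ℝ}, BoundedDomain Ω →
      𝒯.IsUniform K h → ∀ {u : E3 → F}, AEStronglyMeasurable u (volume.restrict Ω) →
      ∀ x ∈ closure Ω, ‖feFun (proj 𝒯 r u) x‖ₑ ≤ C * avgOp Ω h (fun y => ‖u y‖ₑ) x := by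
  obtain ⟨C, hC⟩ := exists_enorm_feFun_solve_le (F := F) hr hK zero_le_one
  refine ⟨C, fun {Ω 𝒯 h} hΩ hu {u} hum x hx => ?_⟩
  refine hC hΩ hu hum.enorm (fun β => ?_) x hx
  rw [one_mul]
  exact enorm_integral_bern_smul_le hr hΩ.isOpen hu β u

end MassMatrix

section UnitFields

/-! ### Estimates in `L^p` -/

variable {Ω : Set E3} {𝒯 : Triangulation Ω} {r : ℕ} {K h : ℝ} {p : ℝ≥0∞}
variable {F F' : Type*} [NormedAddCommGroup F] [NormedSpace ℝ F]
variable [NormedAddCommGroup F'] [NormedSpace ℝ F']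

theorem measurable_avgOp {f : E3 → ℝ≥0∞} (hf : AEMeasurable f (volume.restrict Ω)) :
    Measurable (avgOp Ω h f) := by
  have e : avgOp Ω h f = fun x => ∫⁻ y in Ω, decayKernel h (x - y) * hf.mk f y := by
    ext x
    refine lintegral_congr_ae ?_
    filter_upwards [hf.ae_eq_mk] with y hy
    rw [hy]
  rw [e]
  refine Measurable.lintegral_prod_right' (f := fun z : E3 × E3 =>
    decayKernel h (z.1 - z.2) * hf.mk f z.2) ?_
  exact ((measurable_decayKernel h).comp measurable_sub).mul (hf.measurable_mk.comp measurable_snd)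

/-- The norm of the averaging operator in `L^p`. -/
def avgConst : ℝ≥0 := decayMass.toNNReal

theorem eLpNorm_mul_avgOp_le (hh : 0 < h) (hp : 1 ≤ p) {f : E3 → ℝ≥0∞}
    (hf : AEMeasurable f (volume.restrict Ω)) (C : ℝ≥0) :
    eLpNorm (fun x => C * avgOp Ω h f x) p (volume.restrict Ω) ≤
      C * avgConst * eLpNorm f p (volume.restrict Ω) := by
  have h1 : eLpNorm (fun x => C * avgOp Ω h f x) p (volume.restrict Ω) ≤
      C • eLpNorm (avgOp Ω h f) p (volume.restrict Ω) :=
    eLpNorm_le_nnreal_smul_eLpNorm_of_ae_le_mul' (.of_forall fun x => le_of_eq (by simp)) p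
  refine h1.trans ?_
  rw [ENNReal.smul_def, smul_eq_mul, mul_assoc, avgConst,
    ENNReal.coe_toNNReal decayMass_lt_top.ne]
  gcongr
  exact eLpNorm_avgOp_le hh hp hf

theorem eLpNorm_le_of_le_mul_avgOp {F : Type*} [NormedAddCommGroup F] (hh : 0 < h) (hp : 1 ≤ p)
    {f : E3 → ℝ≥0∞} (hf : AEMeasurable f (volume.restrict Ω)) {C : ℝ≥0} {u : E3 → F}
    (hu : ∀ᵐ x ∂(volume.restrict Ω), ‖u x‖ₑ ≤ C * avgOp Ω h f x) :
    eLpNorm u p (volume.restrict Ω) ≤ C * avgConst * eLpNorm f p (volume.restrict Ω) :=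
  (eLpNorm_mono_enorm_ae (by simpa using hu)).trans (eLpNorm_mul_avgOp_le hh hp hf C)

theorem eLpNorm_le_of_le_add_mul_avgOp {F : Type*} [NormedAddCommGroup F] (hh : 0 < h) (hp : 1 ≤ p)
    {f f₀ : E3 → ℝ≥0∞} (hf : AEMeasurable f (volume.restrict Ω))
    (hf₀ : AEMeasurable f₀ (volume.restrict Ω)) {C : ℝ≥0}
    {u : E3 → F} (hu : ∀ᵐ x ∂(volume.restrict Ω), ‖u x‖ₑ ≤ f₀ x + C * avgOp Ω h f x) :
    eLpNorm u p (volume.restrict Ω) ≤ eLpNorm f₀ p (volume.restrict Ω) +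
      C * avgConst * eLpNorm f p (volume.restrict Ω) := by
  refine (eLpNorm_mono_enorm_ae (g := f₀ + fun x => C * avgOp Ω h f x) (by simpa using hu)).trans ?_
  refine (eLpNorm_add_le hf₀.aestronglyMeasurable
    ((measurable_avgOp hf).const_mul _).aestronglyMeasurable hp).trans ?_
  gcongr
  exact eLpNorm_mul_avgOp_le hh hp hf C

theorem eLpNorm_enorm_fun {F : Type*} [NormedAddCommGroup F] (u : E3 → F) (μ : Measure E3) :
    eLpNorm (fun x => ‖u x‖ₑ) p μ = eLpNorm u p μ :=
  eLpNorm_congr_enorm_ae (.of_forall fun x => by simp)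

/-- The inverse estimate in `L^p`. -/
theorem exists_eLpNorm_fderiv_feFun_le (r : ℕ) (K : ℝ) :
    ∃ C : ℝ≥0, ∀ {Ω : Set E3} {𝒯 : Triangulation Ω} {h : ℝ}, BoundedDomain Ω →
      𝒯.IsUniform K h → ∀ {p : ℝ≥0∞}, 1 ≤ p → ∀ c : Idx 𝒯 r → F,
      eLpNorm (fderiv ℝ (feFun c)) p (volume.restrict Ω) ≤
        C * (ENNReal.ofReal h)⁻¹ * eLpNorm (feFun c) p (volume.restrict Ω) := by
  refine ⟨(r * K).toNNReal * coeffConst r K * avgConst, fun {Ω 𝒯 h} hΩ hu {p} hp c => ?_⟩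
  have hh := hu.pos
  have hK := hu.K_pos
  have h1 : ∀ᵐ x ∂(volume.restrict Ω), ‖fderiv ℝ (feFun c) x‖ₑ ≤
      ((r * K / h).toNNReal * coeffConst r K : ℝ≥0) * avgOp Ω h (fun y => ‖feFun c y‖ₑ) x := by
    filter_upwards [ae_exists_mem_interior 𝒯 hΩ.isOpen] with x ⟨t, ht⟩
    refine (enorm_fderiv_feFun_le hΩ hu ht c).trans_eq ?_
    push_cast
    rw [mul_assoc]
    rfl
  refine (eLpNorm_le_of_le_mul_avgOp hh hp (aestronglyMeasurable_feFun hΩ c).enorm h1).trans_eq ?_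
  rw [eLpNorm_enorm_fun]
  have e : (((r * K / h).toNNReal : ℝ≥0) : ℝ≥0∞) =
      ((r * K).toNNReal : ℝ≥0) * (ENNReal.ofReal h)⁻¹ := by
    rw [← ENNReal.ofReal_inv_of_pos hh]
    change ENNReal.ofReal _ = ENNReal.ofReal _ * _
    rw [← ENNReal.ofReal_mul (by positivity)]
    rfl
  push_cast
  rw [e]
  ring

/-- The `L²` projection is bounded in `L^p`. -/
theorem exists_eLpNorm_feFun_proj_le (hr : 1 ≤ r) (hK : 0 < K) :
    ∃ C : ℝ≥0, ∀ {Ω : Set E3} {𝒯 : Triangulation Ω} {h : ℝ}, BoundedDomain Ω →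
      𝒯.IsUniform K h → ∀ {p : ℝ≥0∞}, 1 ≤ p → ∀ {u : E3 → F},
      AEStronglyMeasurable u (volume.restrict Ω) →
      eLpNorm (feFun (proj 𝒯 r u)) p (volume.restrict Ω) ≤
        C * eLpNorm u p (volume.restrict Ω) := by
  obtain ⟨C, hC⟩ := exists_enorm_feFun_proj_le (F := F) hr hK
  refine ⟨C * avgConst, fun {Ω 𝒯 h} hΩ hu {p} hp {u} hum => ?_⟩
  have h1 : ∀ᵐ x ∂(volume.restrict Ω), ‖feFun (proj 𝒯 r u) x‖ₑ ≤
      C * avgOp Ω h (fun y => ‖u y‖ₑ) x := by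
    filter_upwards [ae_restrict_mem hΩ.isOpen.measurableSet] with x hx
    exact hC hΩ hu hum x (subset_closure hx)
  refine (eLpNorm_le_of_le_mul_avgOp hu.pos hp hum.enorm h1).trans_eq ?_
  rw [eLpNorm_enorm_fun]
  push_cast
  rfl

/-! ### Products with a unit vector field -/

/-- `m` is a field of unit vectors on `Ω` with weak derivative `g`, and `g` is bounded by `G`. -/
structure UnitField (Ω : Set E3) (m : E3 → E3) (g : E3 → E3 →L[ℝ] E3) (G : ℝ≥0) : Prop where
  weak : HasWeakFDeriv Ω m g
  norm_eq : ∀ᵐ x ∂(volume.restrict Ω), ‖m x‖ = 1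
  norm_le : ∀ᵐ x ∂(volume.restrict Ω), ‖g x‖ ≤ G

/-- The mean value over a tetrahedron. -/
def tetAvg (w : E3 → E3) (t : 𝒯.elements) : E3 := ⨍ x in interior (tet (t : Finset E3)), w x

/-- The coefficients of the finite element function that replaces the product of `w` with the
finite element function with coefficients `c`: the factor `w` is replaced by its mean value over a
tetrahedron that belongs to the index. -/
def mulCoeff (B : E3 →L[ℝ] F →L[ℝ] F') (w : E3 → E3) (c : Idx 𝒯 r → F) : Idx 𝒯 r → F' :=
  fun α => B (tetAvg w α.2.choose) (c α)

theorem mem_locIdx_choose (α : Idx 𝒯 r) : α ∈ locIdx r α.2.choose :=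
  mem_locIdx.2 α.2.choose_spec.1

theorem integrableOn_of_aestronglyMeasurable_of_norm_le {F : Type*} [NormedAddCommGroup F]
    (hΩ : BoundedDomain Ω) {u : E3 → F} {C : ℝ}
    (hu : AEStronglyMeasurable u (volume.restrict Ω))
    (hC : ∀ᵐ x ∂(volume.restrict Ω), ‖u x‖ ≤ C) : IntegrableOn u Ω :=
  have : IsFiniteMeasure (volume.restrict Ω) :=
    ⟨by rw [Measure.restrict_apply_univ]; exact hΩ.volume_lt_top⟩
  Integrable.of_bound hu C hC

theorem faceConst_nonneg (hK : 0 < K) : 0 ≤ faceConst K := by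
  have := ballVol_pos
  unfold faceConst
  positivity

namespace UnitField

variable {m : E3 → E3} {g : E3 → E3 →L[ℝ] E3} {G : ℝ≥0} (hm : UnitField Ω m g G)
include hm

theorem aestronglyMeasurable : AEStronglyMeasurable m (volume.restrict Ω) :=
  hm.weak.1.aestronglyMeasurable

theorem integrableOn (hΩ : BoundedDomain Ω) : IntegrableOn m Ω :=
  integrableOn_of_aestronglyMeasurable_of_norm_le hΩ hm.aestronglyMeasurable
    (hm.norm_eq.mono fun _ h => h.le)

theorem integrableOn_grad (hΩ : BoundedDomain Ω) : IntegrableOn g Ω :=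
  integrableOn_of_aestronglyMeasurable_of_norm_le hΩ hm.weak.2.1.aestronglyMeasurable hm.norm_le

theorem norm_tetAvg_le (hΩ : BoundedDomain Ω) (hu : 𝒯.IsUniform K h) (t : 𝒯.elements) :
    ‖tetAvg m t‖ ≤ 1 := by
  have h1 : ∀ᵐ x ∂(volume.restrict (interior (tet (t : Finset E3)))),
      m x ∈ Metric.closedBall (0 : E3) 1 := by
    filter_upwards [ae_mono (Measure.restrict_mono (interior_tet_subset hΩ t) le_rfl)
      hm.norm_eq] with x hx
    rw [mem_closedBall_zero_iff, hx]
  have := (convex_closedBall (0 : E3) 1).set_average_mem Metric.isClosed_closedBall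
    (hu.volume_ne_zero t) (hu.volume_ne_top t) h1
    ((hm.integrableOn hΩ).mono_set (interior_tet_subset hΩ t))
  rwa [mem_closedBall_zero_iff] at this

/-- Mean values of a unit field over neighbouring tetrahedra differ by `O(h G)`. -/
theorem norm_tetAvg_sub_le (hr : 1 ≤ r) (hΩ : BoundedDomain Ω) (hu : 𝒯.IsUniform K h)
    {t : 𝒯.elements} {α : Idx 𝒯 r} (hα : α ∈ locIdx r t) :
    ‖tetAvg m t - tetAvg m α.2.choose‖ ≤ K ^ 3 * faceConst K * ballVol * (h * G) := by
  have hh := hu.pos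
  have hK := hu.K_pos
  have hb := ballVol_pos
  have hf := faceConst_nonneg hK
  have h1 := average_sub_average_le_of_vertex hΩ hu hm.weak (hm.integrableOn hΩ)
    (hm.integrableOn_grad hΩ) (node_mem hr hα) (node_mem hr (mem_locIdx_choose α))
  have h2 : ∫⁻ x in Ω ∩ Metric.closedBall (node α) h, ‖g x‖ₑ ≤
      ENNReal.ofReal (G * (h ^ 3 * ballVol)) := by
    rw [ENNReal.ofReal_mul G.coe_nonneg, ← volume_closedBall_eq (node α) hh.le]
    calc ∫⁻ x in Ω ∩ Metric.closedBall (node α) h, ‖g x‖ₑ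
        ≤ ∫⁻ x in Ω ∩ Metric.closedBall (node α) h, ENNReal.ofReal G := by
          refine lintegral_mono_ae ?_
          filter_upwards [ae_mono (Measure.restrict_mono Set.inter_subset_left le_rfl)
            hm.norm_le] with x hx
          rw [← ofReal_norm]
          exact ENNReal.ofReal_le_ofReal hx
      _ ≤ _ := by
          rw [setLIntegral_const]
          gcongr
          exact Set.inter_subset_right
  have h3 := h1.trans (mul_le_mul_right h2 _)
  rw [← ENNReal.ofReal_mul (by positivity), ← ofReal_norm,
    ENNReal.ofReal_le_ofReal_iff (by positivity)] at h3
  refine h3.trans_eq ?_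
  field_simp

/-- A unit field differs from its mean value over a tetrahedron by at most `h G`. -/
theorem ae_norm_sub_tetAvg_le (hΩ : BoundedDomain Ω) (hu : 𝒯.IsUniform K h) :
    ∀ᵐ x ∂(volume.restrict Ω), ∃ t : 𝒯.elements, x ∈ interior (tet (t : Finset E3)) ∧
      ‖m x - tetAvg m t‖ ≤ h * G := by
  have h1 : ∀ t : 𝒯.elements, ∀ᵐ x ∂(volume : Measure E3), x ∈ interior (tet (t : Finset E3)) →
      ‖m x - tetAvg m t‖ ≤ h * G := by
    intro t
    have := hm.weak.ae_norm_sub_average_le hΩ.isOpen (hm.integrableOn hΩ) (hm.integrableOn_grad hΩ)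
      isOpen_interior (interior_tet_subset hΩ t) (convex_tet _).interior
      (fun x hx y hy => by
        rw [← dist_eq_norm]; exact hu.dist_le (interior_subset hx) (interior_subset hy))
      (hu.volume_ne_zero t) (hu.volume_ne_top t) G.coe_nonneg hm.norm_le
    rwa [ae_restrict_iff' isOpen_interior.measurableSet] at this
  filter_upwards [ae_exists_mem_interior 𝒯 hΩ.isOpen, ae_restrict_of_ae (ae_all_iff.2 h1)]
    with x ⟨t, ht⟩ hx
  exact ⟨t, ht, hx t ht⟩

end UnitField

/-- The constant that bounds `(m - m_α) / (h G)`, where `m_α` is the mean value of `m` over a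
tetrahedron nearby. -/
def oscConst (K : ℝ) : ℝ := 1 + K ^ 3 * faceConst K * ballVol

theorem oscConst_nonneg (hK : 0 < K) : 0 ≤ oscConst K := by
  have := ballVol_pos
  have := faceConst_nonneg hK
  unfold oscConst
  positivity

section Product

variable {m : E3 → E3} {g : E3 → E3 →L[ℝ] E3} {G : ℝ≥0} {B : E3 →L[ℝ] F →L[ℝ] F'}

theorem aestronglyMeasurable_product (hΩ : BoundedDomain Ω) (hm : UnitField Ω m g G)
    (c : Idx 𝒯 r → F) :
    AEStronglyMeasurable (fun x => B (m x) (feFun c x)) (volume.restrict Ω) :=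
  B.aestronglyMeasurable_comp₂ hm.aestronglyMeasurable (aestronglyMeasurable_feFun hΩ c)

theorem ae_norm_product_le (hB : ∀ a b, ‖B a b‖ ≤ ‖a‖ * ‖b‖) (hm : UnitField Ω m g G) (u : E3 → F) :
    ∀ᵐ x ∂(volume.restrict Ω), ‖B (m x) (u x)‖ ≤ ‖u x‖ := by
  filter_upwards [hm.norm_eq] with x hx
  refine (hB _ _).trans_eq ?_
  rw [hx, one_mul]

theorem integrableOn_product (hΩ : BoundedDomain Ω) (hB : ∀ a b, ‖B a b‖ ≤ ‖a‖ * ‖b‖)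
    (hm : UnitField Ω m g G) (c : Idx 𝒯 r → F) :
    IntegrableOn (fun x => B (m x) (feFun c x)) Ω :=
  Integrable.mono (integrableOn_feFun hΩ c) (aestronglyMeasurable_product hΩ hm c)
    (ae_norm_product_le hB hm _)

/-- The product differs from its replacement by a finite element function by `O(h G)`. -/
theorem ae_enorm_product_sub_le (hr : 1 ≤ r) (hΩ : BoundedDomain Ω) (hu : 𝒯.IsUniform K h)
    (hB : ∀ a b, ‖B a b‖ ≤ ‖a‖ * ‖b‖) (hm : UnitField Ω m g G) (c : Idx 𝒯 r → F) :
    ∀ᵐ x ∂(volume.restrict Ω), ‖B (m x) (feFun c x) - feFun (mulCoeff B m c) x‖ₑ ≤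
      ((oscConst K * (h * G)).toNNReal * coeffConst r K : ℝ≥0) *
        avgOp Ω h (fun y => ‖feFun c y‖ₑ) x := by
  have hh := hu.pos
  have hK := hu.K_pos
  have ho := oscConst_nonneg hK
  filter_upwards [hm.ae_norm_sub_tetAvg_le hΩ hu] with x ⟨t, ht, hx⟩
  have htx := interior_subset ht
  have h1 : ‖B (m x) (feFun c x) - feFun (mulCoeff B m c) x‖ ≤
      oscConst K * (h * G) * ∑ α ∈ locIdx r t, ‖c α‖ := by
    rw [feFun_eq htx, feFun_eq htx, map_sum, ← Finset.sum_sub_distrib, Finset.mul_sum]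
    refine norm_sum_le_of_le _ fun α hα => ?_
    rw [map_smul, ← smul_sub, mulCoeff, ← sub_apply, ← map_sub, norm_smul,
      ← bern_eq htx, Real.norm_of_nonneg (bern_nonneg α x)]
    refine (mul_le_of_le_one_left (norm_nonneg _) (bern_le_one α x)).trans ((hB _ _).trans ?_)
    gcongr
    have h2 := hm.norm_tetAvg_sub_le hr hΩ hu hα
    have h3 := norm_sub_le_norm_sub_add_norm_sub (m x) (tetAvg m t) (tetAvg m α.2.choose)
    rw [oscConst]
    linarith
  have h2 := ENNReal.ofReal_le_ofReal h1
  rw [ofReal_norm, ENNReal.ofReal_mul (by positivity), ofReal_sum_norm] at h2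
  refine h2.trans ?_
  push_cast
  rw [mul_assoc]
  change ENNReal.ofReal _ * _ ≤ ENNReal.ofReal _ * _
  gcongr
  exact sum_enorm_coeff_le hΩ hu htx c

/-- The gradient of the replacement of a product. On each tetrahedron `w` is close to a constant
of norm at most `1`, so the leading constant is `1`; the inverse estimate for the rest loses a
factor `h⁻¹`, which is made up for by the factor `h G` of the deviation. -/
theorem ae_enorm_fderiv_mulCoeff_le (hr : 1 ≤ r) (hΩ : BoundedDomain Ω) (hu : 𝒯.IsUniform K h)
    (hB : ∀ a b, ‖B a b‖ ≤ ‖a‖ * ‖b‖) (hm : UnitField Ω m g G) (c : Idx 𝒯 r → F) :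
    ∀ᵐ x ∂(volume.restrict Ω), ‖fderiv ℝ (feFun (mulCoeff B m c)) x‖ₑ ≤
      ‖fderiv ℝ (feFun c) x‖ₑ + ((r * K * oscConst K * G).toNNReal * coeffConst r K : ℝ≥0) *
        avgOp Ω h (fun y => ‖feFun c y‖ₑ) x := by
  have hh := hu.pos
  have hK := hu.K_pos
  have ho := oscConst_nonneg hK
  filter_upwards [ae_exists_mem_interior 𝒯 hΩ.isOpen] with x ⟨t, ht⟩
  have htx := interior_subset ht
  set L := B (tetAvg m t) with hL
  have hL1 : ‖L‖ ≤ 1 := ContinuousLinearMap.opNorm_le_bound _ zero_le_one fun b =>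
    (hB _ _).trans (by gcongr; exact hm.norm_tetAvg_le hΩ hu t)
  set d : Idx 𝒯 r → F' := fun α => mulCoeff B m c α - L (c α) with hd
  have e : feFun (mulCoeff B m c) = feFun (fun α => L (c α)) + feFun d := by
    ext y
    rw [Pi.add_apply, ← feFun_add]
    congr 1
    ext α
    simp [hd]
  have h1 : ‖fderiv ℝ (feFun (mulCoeff B m c)) x‖ ≤ ‖fderiv ℝ (feFun c) x‖ +
      r * K * oscConst K * G * ∑ α ∈ locIdx r t, ‖c α‖ := by
    rw [e, fderiv_add (differentiableAt_feFun ht _) (differentiableAt_feFun ht _)]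
    refine (norm_add_le _ _).trans (add_le_add ?_ ?_)
    · rw [fderiv_feFun_comp L ht]
      refine (ContinuousLinearMap.opNorm_comp_le _ _).trans ?_
      exact mul_le_of_le_one_left (norm_nonneg _) hL1
    · refine (norm_fderiv_feFun_le hu ht d).trans ?_
      have h2 : ∑ α ∈ locIdx r t, ‖d α‖ ≤ oscConst K * (h * G) * ∑ α ∈ locIdx r t, ‖c α‖ := by
        rw [Finset.mul_sum]
        refine Finset.sum_le_sum fun α hα => ?_
        change ‖B (tetAvg m α.2.choose) (c α) - B (tetAvg m t) (c α)‖ ≤ _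
        rw [← sub_apply, ← map_sub]
        refine (hB _ _).trans ?_
        gcongr
        rw [norm_sub_rev]
        have := hm.norm_tetAvg_sub_le hr hΩ hu hα
        have : 0 ≤ h * G := mul_nonneg hh.le G.coe_nonneg
        rw [oscConst]
        linarith
      refine (mul_le_mul_of_nonneg_left h2 (by positivity)).trans_eq ?_
      field_simp
  have h2 := ENNReal.ofReal_le_ofReal h1
  rw [ENNReal.ofReal_add (norm_nonneg _) (by positivity), ofReal_norm, ofReal_norm,
    ENNReal.ofReal_mul (by positivity), ofReal_sum_norm] at h2
  refine h2.trans (add_le_add le_rfl ?_)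
  push_cast
  rw [mul_assoc (ENNReal.ofNNReal _)]
  change ENNReal.ofReal _ * _ ≤ ENNReal.ofReal _ * _
  gcongr
  exact sum_enorm_coeff_le hΩ hu htx c

end Product

end UnitFields

section Stability

variable {Ω : Set E3} {𝒯 : Triangulation Ω} {r : ℕ} {K h : ℝ} {p : ℝ≥0∞}
variable {F F' : Type*} [NormedAddCommGroup F] [NormedSpace ℝ F]
variable [NormedAddCommGroup F'] [NormedSpace ℝ F']

theorem eLpNorm_fderiv_feFun_add_le (hΩ : BoundedDomain Ω) [CompleteSpace F]
    [SecondCountableTopology (E3 →L[ℝ] F)] (hp : 1 ≤ p) (c c' : Idx 𝒯 r → F) :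
    eLpNorm (fderiv ℝ (feFun (c + c'))) p (volume.restrict Ω) ≤
      eLpNorm (fderiv ℝ (feFun c)) p (volume.restrict Ω) +
        eLpNorm (fderiv ℝ (feFun c')) p (volume.restrict Ω) := by
  have h1 := eLpNorm_add_le (f := fderiv ℝ (feFun c)) (g := fderiv ℝ (feFun c')) (p := p)
    (μ := volume.restrict Ω) (measurable_fderiv ℝ _).aestronglyMeasurable
    (measurable_fderiv ℝ _).aestronglyMeasurable hp
  refine le_trans (le_of_eq ?_) h1
  refine eLpNorm_congr_ae ?_
  filter_upwards [ae_exists_mem_interior 𝒯 hΩ.isOpen] with x ⟨t, ht⟩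
  rw [Pi.add_apply, ← fderiv_add (differentiableAt_feFun ht c) (differentiableAt_feFun ht c')]
  congr 1
  ext y
  exact feFun_add c c' y

theorem eLpNorm_feFun_add_le (hΩ : BoundedDomain Ω) (hp : 1 ≤ p) (c c' : Idx 𝒯 r → F) :
    eLpNorm (feFun (c + c')) p (volume.restrict Ω) ≤
      eLpNorm (feFun c) p (volume.restrict Ω) + eLpNorm (feFun c') p (volume.restrict Ω) := by
  refine le_trans (le_of_eq ?_) (eLpNorm_add_le (aestronglyMeasurable_feFun hΩ c)
    (aestronglyMeasurable_feFun hΩ c') hp)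
  congr 1
  ext y
  exact feFun_add c c' y

/-- The projection of the product of a unit vector field with a finite element function: it is
bounded in `L^p`, bounded in `W^{1,p}` up to a term of lower order, and close to the product
itself (superapproximation). -/
theorem exists_product_estimates [CompleteSpace F] [CompleteSpace F']
    [SecondCountableTopology (E3 →L[ℝ] F')] (hr : 1 ≤ r) (hK : 0 < K)
    {B : E3 →L[ℝ] F →L[ℝ] F'} (hB : ∀ a b, ‖B a b‖ ≤ ‖a‖ * ‖b‖) :
    ∃ C : ℝ≥0, ∀ {Ω : Set E3} {𝒯 : Triangulation Ω} {h : ℝ}, BoundedDomain Ω →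
      𝒯.IsUniform K h → ∀ {m : E3 → E3} {g : E3 → E3 →L[ℝ] E3} {G : ℝ≥0}, UnitField Ω m g G →
      ∀ {p : ℝ≥0∞}, 1 ≤ p → ∀ c : Idx 𝒯 r → F,
      eLpNorm (feFun (proj 𝒯 r fun x => B (m x) (feFun c x))) p (volume.restrict Ω) ≤
        C * eLpNorm (feFun c) p (volume.restrict Ω) ∧
      eLpNorm (fderiv ℝ (feFun (proj 𝒯 r fun x => B (m x) (feFun c x)))) p (volume.restrict Ω) ≤
        eLpNorm (fderiv ℝ (feFun c)) p (volume.restrict Ω) +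
          C * G * eLpNorm (feFun c) p (volume.restrict Ω) ∧
      eLpNorm (fun x => B (m x) (feFun c x) - feFun (proj 𝒯 r fun x => B (m x) (feFun c x)) x) p
        (volume.restrict Ω) ≤
        C * (ENNReal.ofReal h * G) * eLpNorm (feFun c) p (volume.restrict Ω) := by
  obtain ⟨C₁, hC₁⟩ := exists_eLpNorm_fderiv_feFun_le (F := F') r K
  obtain ⟨C₂, hC₂⟩ := exists_eLpNorm_feFun_proj_le (F := F') hr hK
  set Ce : ℝ≥0 := (oscConst K).toNNReal * coeffConst r K * avgConst with hCe
  set Cd : ℝ≥0 := (r * K * oscConst K).toNNReal * coeffConst r K * avgConst with hCd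
  refine ⟨C₂ + (Cd + C₁ * C₂ * Ce) + (1 + C₂) * Ce, fun {Ω 𝒯 h} hΩ hu {m g G} hm {p} hp c => ?_⟩
  have hh := hu.pos
  have ho := oscConst_nonneg hK
  set μ := volume.restrict Ω with hμ
  set u : E3 → F' := fun x => B (m x) (feFun c x) with hu_def
  set H := ENNReal.ofReal h with hH
  have hH0 : H ≠ 0 := (ENNReal.ofReal_pos.2 hh).ne'
  have hHt : H ≠ ⊤ := ENNReal.ofReal_ne_top
  set N := eLpNorm (feFun c) p μ with hN
  have hum : AEStronglyMeasurable u μ := aestronglyMeasurable_product hΩ hm c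
  have hui : IntegrableOn u Ω := integrableOn_product hΩ hB hm c
  -- projections reproduce finite element functions, so only the small error `e` is projected
  set cJ := mulCoeff B m c with hcJ
  set e : E3 → F' := u - feFun cJ with he
  have hem : AEStronglyMeasurable e μ := hum.sub (aestronglyMeasurable_feFun hΩ cJ)
  have hq : proj 𝒯 r u = cJ + proj 𝒯 r e := by
    rw [he, proj_sub hΩ hui (integrableOn_feFun hΩ cJ), proj_feFun hΩ hu, add_sub_cancel]
  have heN : eLpNorm e p μ ≤ Ce * (H * G) * N := by
    refine (eLpNorm_le_of_le_mul_avgOp hh hp (aestronglyMeasurable_feFun hΩ c).enorm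
      (ae_enorm_product_sub_le hr hΩ hu hB hm c)).trans_eq ?_
    rw [eLpNorm_enorm_fun, hCe, Real.toNNReal_mul ho, Real.toNNReal_mul hh.le, Real.toNNReal_coe]
    push_cast
    change _ = ((oscConst K).toNNReal : ℝ≥0∞) * coeffConst r K * avgConst *
      ((h.toNNReal : ℝ≥0) * G) * N
    ring
  have hpe : eLpNorm (feFun (proj 𝒯 r e)) p μ ≤ C₂ * (Ce * (H * G) * N) :=
    (hC₂ hΩ hu hp hem).trans (by gcongr)
  have hJ : eLpNorm (fderiv ℝ (feFun cJ)) p μ ≤ eLpNorm (fderiv ℝ (feFun c)) p μ + Cd * G * N := by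
    refine (eLpNorm_le_of_le_add_mul_avgOp hh hp (aestronglyMeasurable_feFun hΩ c).enorm
      (measurable_fderiv ℝ _).enorm.aemeasurable
      (ae_enorm_fderiv_mulCoeff_le hr hΩ hu hB hm c)).trans_eq ?_
    rw [eLpNorm_enorm_fun, eLpNorm_enorm_fun, hCd, Real.toNNReal_mul (by positivity),
      Real.toNNReal_coe]
    push_cast
    ring
  refine ⟨?_, ?_, ?_⟩
  · calc eLpNorm (feFun (proj 𝒯 r u)) p μ ≤ C₂ * eLpNorm u p μ := hC₂ hΩ hu hp hum
      _ ≤ C₂ * N := by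
          gcongr
          exact eLpNorm_mono_ae (ae_norm_product_le hB hm _)
      _ ≤ _ := by
          gcongr
          rw [add_assoc]
          exact le_self_add
  · rw [hq]
    refine (eLpNorm_fderiv_feFun_add_le hΩ hp cJ _).trans ?_
    calc _ ≤ eLpNorm (fderiv ℝ (feFun c)) p μ + Cd * G * N +
          C₁ * H⁻¹ * (C₂ * (Ce * (H * G) * N)) := by
          refine add_le_add hJ ((hC₁ hΩ hu hp _).trans ?_)
          gcongr
      _ = eLpNorm (fderiv ℝ (feFun c)) p μ + Cd * G * N +
          C₁ * C₂ * Ce * (H⁻¹ * H) * G * N := by ring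
      _ = eLpNorm (fderiv ℝ (feFun c)) p μ + (Cd + C₁ * C₂ * Ce : ℝ≥0) * G * N := by
          rw [ENNReal.inv_mul_cancel hH0 hHt]
          push_cast
          ring
      _ ≤ _ := by
          refine add_le_add le_rfl
            (mul_le_mul' (mul_le_mul' (ENNReal.coe_le_coe.2 ?_) le_rfl) le_rfl)
          rw [add_comm C₂]
          exact le_self_add.trans le_self_add
  · have e1 : (fun x => u x - feFun (proj 𝒯 r u) x) = e - feFun (proj 𝒯 r e) := by
      ext x
      rw [hq, feFun_add, he, Pi.sub_apply, Pi.sub_apply, sub_sub]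
    rw [e1]
    refine (eLpNorm_sub_le hem (aestronglyMeasurable_feFun hΩ _) hp).trans ?_
    calc _ ≤ Ce * (H * G) * N + C₂ * (Ce * (H * G) * N) := add_le_add heN hpe
      _ = ((1 + C₂) * Ce : ℝ≥0) * (H * G) * N := by push_cast; ring
      _ ≤ _ := by
          gcongr
          exact le_add_self

/-! ### Stability of the `L²` projection in `W^{1,p}` -/

/-- The constant function `1` has bounded coefficients in the Bernstein basis. -/
theorem exists_coeff_one (hr : 1 ≤ r) (hu : 𝒯.IsUniform K h) :
    ∃ c : Idx 𝒯 r → ℝ, (∀ x ∈ closure Ω, feFun c x = 1) ∧ ∀ α, |c α| ≤ locConst r := by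
  obtain ⟨c, hc⟩ := exists_coeff_of_mem_feSpace (𝒯 := 𝒯) (v := fun _ => 1) hr
    ⟨continuousOn_const, fun t _ => ⟨1, by simp, fun x _ => by simp⟩⟩
  refine ⟨c, fun x hx => (hc x hx).symm, fun α => ?_⟩
  set t := α.2.choose
  have h1 := volume_mul_enorm_coeff_le t c (mem_locIdx_choose α)
  have h2 : ∫⁻ x in interior (tet (t : Finset E3)), ‖feFun c x‖ₑ =
      volume (interior (tet (t : Finset E3))) := by
    rw [← setLIntegral_one]
    refine setLIntegral_congr_fun isOpen_interior.measurableSet fun x hx => ?_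
    rw [← hc x (tet_subset_closure t (interior_subset hx)), enorm_one]
  rw [h2, mul_comm, ENNReal.mul_le_mul_iff_left (hu.volume_ne_zero t) (hu.volume_ne_top t),
    ← ofReal_norm, ENNReal.ofReal_le_ofReal_iff (locConst_nonneg r)] at h1
  exact h1

/-- The coefficients of a quasi-interpolant of `w`, built from mean values over tetrahedra, where
`c` holds the coefficients of the constant function `1`. -/
def interpCoeff (c : Idx 𝒯 r → ℝ) (w : E3 → E3) : Idx 𝒯 r → E3 :=
  fun α => c α • tetAvg w α.2.choose

section Interpolation

variable {w : E3 → E3} {g : E3 → E3 →L[ℝ] E3} {c : Idx 𝒯 r → ℝ}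

/-- On a tetrahedron, the quasi-interpolant is the mean value plus a combination of differences of
mean values over neighbouring tetrahedra. -/
theorem feFun_interpCoeff (hc : ∀ x ∈ closure Ω, feFun c x = 1) (t : 𝒯.elements) {x : E3}
    (hx : x ∈ closure Ω) : feFun (interpCoeff c w) x =
      tetAvg w t + feFun (fun α => c α • (tetAvg w α.2.choose - tetAvg w t)) x := by
  have h1 := feFun_comp ((ContinuousLinearMap.id ℝ ℝ).smulRight (tetAvg w t)) c x
  simp only [ContinuousLinearMap.smulRight_apply, ContinuousLinearMap.id_apply, hc x hx,
    one_smul] at h1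
  refine Eq.trans ?_
    (congrArg (· + feFun (fun α => c α • (tetAvg w α.2.choose - tetAvg w t)) x) h1)
  rw [← feFun_add]
  congr 1
  ext1 α
  rw [Pi.add_apply, ← smul_add, add_sub_cancel, interpCoeff]

/-- The constant in `sum_enorm_interpCoeff_sub_le`. -/
def interpConst (r : ℕ) (K : ℝ) : ℝ :=
  Fintype.card (RefIdx r) * (locConst r * (K ^ 3 * faceConst K))

theorem interpConst_nonneg (r : ℕ) (hK : 0 < K) : 0 ≤ interpConst r K := by
  have := locConst_nonneg r
  have := faceConst_nonneg hK
  unfold interpConst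
  positivity

theorem sum_enorm_interpCoeff_sub_le (hr : 1 ≤ r) (hΩ : BoundedDomain Ω) (hu : 𝒯.IsUniform K h)
    (hwg : HasWeakFDeriv Ω w g) (hw : IntegrableOn w Ω) (hg : IntegrableOn g Ω)
    (hc : ∀ α, |c α| ≤ locConst r) {t : 𝒯.elements} {y : E3} (hy : y ∈ tet (t : Finset E3)) :
    ∑ α ∈ locIdx r t, ‖c α • (tetAvg w α.2.choose - tetAvg w t)‖ₑ ≤
      ENNReal.ofReal (interpConst r K / h ^ 2) *
        ∫⁻ x in Ω ∩ Metric.closedBall y (2 * h), ‖g x‖ₑ := by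
  have hK := hu.K_pos
  have hh := hu.pos
  have hl := locConst_nonneg r
  have hf := faceConst_nonneg hK
  have h1 : ∀ α ∈ locIdx r t, ‖c α • (tetAvg w α.2.choose - tetAvg w t)‖ₑ ≤
      ENNReal.ofReal (locConst r * (K ^ 3 * (faceConst K / h ^ 2))) *
        ∫⁻ x in Ω ∩ Metric.closedBall y (2 * h), ‖g x‖ₑ := by
    intro α hα
    rw [enorm_smul, ENNReal.ofReal_mul hl, mul_assoc]
    refine mul_le_mul' ?_ ?_
    · rw [← ofReal_norm]
      exact ENNReal.ofReal_le_ofReal (hc α)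
    · refine (average_sub_average_le_of_vertex hΩ hu hwg hw hg (node_mem hr (mem_locIdx_choose α))
        (node_mem hr hα)).trans ?_
      gcongr
      refine Metric.closedBall_subset_closedBall' ?_
      have := dist_node_le hr hu hα hy
      rw [dist_comm] at this
      linarith
  refine (Finset.sum_le_sum h1).trans_eq ?_
  rw [Finset.sum_const, card_locIdx, nsmul_eq_mul, ← mul_assoc, ← ENNReal.ofReal_natCast,
    ← ENNReal.ofReal_mul (by positivity)]
  congr 2
  rw [interpConst]
  ring

/-- The gradient of the quasi-interpolant is bounded by averages of the gradient of `w`. -/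
theorem ae_enorm_fderiv_interpCoeff_le (hr : 1 ≤ r) (hΩ : BoundedDomain Ω) (hu : 𝒯.IsUniform K h)
    (hwg : HasWeakFDeriv Ω w g) (hw : IntegrableOn w Ω) (hg : IntegrableOn g Ω)
    (hc1 : ∀ x ∈ closure Ω, feFun c x = 1) (hc : ∀ α, |c α| ≤ locConst r) :
    ∀ᵐ x ∂(volume.restrict Ω), ‖fderiv ℝ (feFun (interpCoeff c w)) x‖ₑ ≤
      ((r * K * interpConst r K * 81).toNNReal : ℝ≥0) * avgOp Ω h (fun y => ‖g y‖ₑ) x := by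
  have hK := hu.K_pos
  have hh := hu.pos
  have hi := interpConst_nonneg r hK
  filter_upwards [ae_exists_mem_interior 𝒯 hΩ.isOpen] with x ⟨t, ht⟩
  set d : Idx 𝒯 r → E3 := fun α => c α • (tetAvg w α.2.choose - tetAvg w t) with hd
  have e1 : fderiv ℝ (feFun (interpCoeff c w)) x = fderiv ℝ (feFun d) x := by
    have h1 : feFun (interpCoeff c w) =ᶠ[𝓝 x] fun y => tetAvg w t + feFun d y := by
      filter_upwards [mem_interior_iff_mem_nhds.1 ht] with y hy
      exact feFun_interpCoeff hc1 t (tet_subset_closure t hy)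
    rw [h1.fderiv_eq, fderiv_const_add]
  have h2 := ENNReal.ofReal_le_ofReal (norm_fderiv_feFun_le hu ht d)
  rw [ofReal_norm, ENNReal.ofReal_mul (by positivity), ofReal_sum_norm] at h2
  rw [e1]
  refine h2.trans ?_
  calc _ ≤ ENNReal.ofReal (r * K / h) * (ENNReal.ofReal (interpConst r K / h ^ 2) *
        (ENNReal.ofReal (h ^ 3 * (1 + 2) ^ 4) * avgOp Ω h (fun y => ‖g y‖ₑ) x)) := by
        gcongr
        refine (sum_enorm_interpCoeff_sub_le hr hΩ hu hwg hw hg hc (interior_subset ht)).trans ?_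
        gcongr
        exact setLIntegral_le_avgOp hΩ.isOpen hh zero_le_two Set.inter_subset_left
          Set.inter_subset_right _
    _ = _ := by
        rw [← mul_assoc, ← mul_assoc, ← ENNReal.ofReal_mul (by positivity),
          ← ENNReal.ofReal_mul (by positivity)]
        change _ = ENNReal.ofReal _ * _
        congr 2
        field_simp
        norm_num

/-- The local error of the quasi-interpolant in `L¹` is `O(h)`. -/
theorem lintegral_sub_interpCoeff_le (hr : 1 ≤ r) (hΩ : BoundedDomain Ω) (hu : 𝒯.IsUniform K h)
    (hwg : HasWeakFDeriv Ω w g) (hw : IntegrableOn w Ω) (hg : IntegrableOn g Ω)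
    (hc1 : ∀ x ∈ closure Ω, feFun c x = 1) (hc : ∀ α, |c α| ≤ locConst r) {t : 𝒯.elements} {y : E3}
    (hy : y ∈ tet (t : Finset E3)) :
    ∫⁻ x in interior (tet (t : Finset E3)), ‖w x - feFun (interpCoeff c w) x‖ₑ ≤
      ENNReal.ofReal ((8 + ballVol * interpConst r K) * h) *
        ∫⁻ x in Ω ∩ Metric.closedBall y (2 * h), ‖g x‖ₑ := by
  have hK := hu.K_pos
  have hh := hu.pos
  have hi := interpConst_nonneg r hK
  have hb := ballVol_pos
  have hTΩ := interior_tet_subset hΩ t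
  set T := interior (tet (t : Finset E3)) with hT
  set d : Idx 𝒯 r → E3 := fun α => c α • (tetAvg w α.2.choose - tetAvg w t) with hd
  set I := ∫⁻ x in Ω ∩ Metric.closedBall y (2 * h), ‖g x‖ₑ with hI
  have h1 : ∀ x ∈ T, ‖w x - feFun (interpCoeff c w) x‖ₑ ≤
      ‖w x - tetAvg w t‖ₑ + ENNReal.ofReal (interpConst r K / h ^ 2) * I := by
    intro x hx
    have hxt := interior_subset hx
    rw [feFun_interpCoeff hc1 t (tet_subset_closure t hxt), ← sub_sub]
    refine (enorm_sub_le).trans (add_le_add le_rfl ?_)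
    refine le_trans ?_ (sum_enorm_interpCoeff_sub_le hr hΩ hu hwg hw hg hc hy)
    rw [← ofReal_sum_norm, ← ofReal_norm]
    exact ENNReal.ofReal_le_ofReal (norm_feFun_le hxt d)
  have h2 : ∫⁻ x in T, ‖w x - tetAvg w t‖ₑ ≤ ENNReal.ofReal (8 * h) * I := by
    refine (hwg.lintegral_sub_average_le hΩ.isOpen hw hg isOpen_interior hTΩ
      (convex_tet _).interior (d := h) (fun x hx z hz => by
        rw [← dist_eq_norm]; exact hu.dist_le (interior_subset hx) (interior_subset hz))
      (hu.volume_ne_zero t) (hu.volume_ne_top t)).trans ?_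
    rw [ENNReal.ofReal_mul (by norm_num)]
    have h3 : T ⊆ Ω ∩ Metric.closedBall y (2 * h) := by
      refine Set.subset_inter hTΩ (interior_subset.trans ((hu.tet_subset_closedBall hy).trans ?_))
      exact Metric.closedBall_subset_closedBall (by linarith)
    refine mul_le_mul' (mul_le_mul' (by norm_num) le_rfl) (lintegral_mono_set h3)
  calc ∫⁻ x in T, ‖w x - feFun (interpCoeff c w) x‖ₑ
      ≤ ∫⁻ x in T, (‖w x - tetAvg w t‖ₑ + ENNReal.ofReal (interpConst r K / h ^ 2) * I) :=
        setLIntegral_mono' isOpen_interior.measurableSet h1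
    _ = (∫⁻ x in T, ‖w x - tetAvg w t‖ₑ) + ENNReal.ofReal (interpConst r K / h ^ 2) * I *
        volume T := by
        rw [lintegral_add_right _ measurable_const, setLIntegral_const]
    _ ≤ ENNReal.ofReal (8 * h) * I + ENNReal.ofReal (interpConst r K / h ^ 2) * I *
        ENNReal.ofReal (h ^ 3 * ballVol) := by
        gcongr
        exact hu.volume_le t
    _ = (ENNReal.ofReal (8 * h) + ENNReal.ofReal (interpConst r K / h ^ 2) *
        ENNReal.ofReal (h ^ 3 * ballVol)) * I := by ring
    _ = _ := by
        rw [← ENNReal.ofReal_mul (by positivity), ← ENNReal.ofReal_add (by positivity)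
          (by positivity)]
        congr 2
        field_simp

/-- The moments of the error of the quasi-interpolant. -/
theorem enorm_integral_bern_smul_sub_interpCoeff_le (hr : 1 ≤ r) (hΩ : BoundedDomain Ω)
    (hu : 𝒯.IsUniform K h) (hwg : HasWeakFDeriv Ω w g) (hw : IntegrableOn w Ω)
    (hg : IntegrableOn g Ω) (hc1 : ∀ x ∈ closure Ω, feFun c x = 1)
    (hc : ∀ α, |c α| ≤ locConst r) (β : Idx 𝒯 r) :
    ‖∫ x in Ω, bern β x • (w x - feFun (interpCoeff c w) x)‖ₑ ≤
      ∫⁻ x in Ω ∩ Metric.closedBall (node β) (2 * h),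
        ENNReal.ofReal (K ^ 3 * ((8 + ballVol * interpConst r K) * h)) * ‖g x‖ₑ := by
  classical
  have hK := hu.K_pos
  have hh := hu.pos
  have hi := interpConst_nonneg r hK
  have hb := ballVol_pos
  set A := ENNReal.ofReal ((8 + ballVol * interpConst r K) * h) *
    ∫⁻ x in Ω ∩ Metric.closedBall (node β) (2 * h), ‖g x‖ₑ with hA
  refine (enorm_integral_le_lintegral_enorm _).trans ?_
  rw [lintegral_eq_sum 𝒯 hΩ]
  have h1 : ∀ t : 𝒯.elements, ∫⁻ x in interior (tet (t : Finset E3)),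
      ‖bern β x • (w x - feFun (interpCoeff c w) x)‖ₑ ≤ if β ∈ locIdx r t then A else 0 := by
    intro t
    split_ifs with hβ
    · refine le_trans (lintegral_mono fun x => ?_) (lintegral_sub_interpCoeff_le hr hΩ hu hwg hw hg
        hc1 hc (vertex_mem_tet (node_mem hr hβ)))
      rw [enorm_smul]
      refine mul_le_of_le_one_left' ?_
      rw [← ofReal_norm, ENNReal.ofReal_le_one, Real.norm_of_nonneg (bern_nonneg β x)]
      exact bern_le_one β x
    · rw [nonpos_iff_eq_zero]
      refine (setLIntegral_congr_fun isOpen_interior.measurableSet fun x hx => ?_).trans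
        lintegral_zero
      rw [bern_eq_zero (interior_subset hx) hβ, zero_smul, enorm_zero]
  refine (Finset.sum_le_sum fun t _ => h1 t).trans ?_
  rw [← Finset.sum_filter, Finset.sum_const, nsmul_eq_mul,
    lintegral_const_mul' _ _ ENNReal.ofReal_ne_top, ENNReal.ofReal_mul (by positivity), mul_assoc,
    ← hA]
  gcongr
  rw [← ENNReal.ofReal_natCast]
  exact ENNReal.ofReal_le_ofReal (card_filter_mem_locIdx_le hr hu β)

end Interpolation

/-- The `L²` projection is stable in `W^{1,p}`. -/
theorem exists_eLpNorm_fderiv_proj_le (hr : 1 ≤ r) (hK : 0 < K) :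
    ∃ C : ℝ≥0, ∀ {Ω : Set E3} {𝒯 : Triangulation Ω} {h : ℝ}, BoundedDomain Ω →
      𝒯.IsUniform K h → ∀ {w : E3 → E3} {g : E3 → E3 →L[ℝ] E3}, HasWeakFDeriv Ω w g →
      IntegrableOn w Ω → IntegrableOn g Ω → ∀ {p : ℝ≥0∞}, 1 ≤ p →
      eLpNorm (fderiv ℝ (feFun (proj 𝒯 r w))) p (volume.restrict Ω) ≤
        C * eLpNorm g p (volume.restrict Ω) := by
  obtain ⟨C₁, hC₁⟩ := exists_eLpNorm_fderiv_feFun_le (F := E3) r K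
  obtain ⟨C₂, hC₂⟩ := exists_enorm_feFun_solve_le (F := E3) hr hK zero_le_two
  set A : ℝ := K ^ 3 * (8 + ballVol * interpConst r K) with hA
  refine ⟨(r * K * interpConst r K * 81).toNNReal * avgConst + C₁ * C₂ * avgConst * A.toNNReal,
    fun {Ω 𝒯 h} hΩ hu {w g} hwg hw hg {p} hp => ?_⟩
  have hh := hu.pos
  have hi := interpConst_nonneg r hK
  have hb := ballVol_pos
  have hA0 : 0 ≤ A := by positivity
  set μ := volume.restrict Ω with hμ
  set H := ENNReal.ofReal h with hH
  have hH0 : H ≠ 0 := (ENNReal.ofReal_pos.2 hh).ne'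
  have hHt : H ≠ ⊤ := ENNReal.ofReal_ne_top
  set N := eLpNorm g p μ with hN
  obtain ⟨c, hc1, hc⟩ := exists_coeff_one (𝒯 := 𝒯) hr hu
  -- the error of the quasi-interpolant is `O(h)`, which makes up for the inverse estimate
  set cJ := interpCoeff c w with hcJ
  set e : E3 → E3 := w - feFun cJ with he
  have hq : proj 𝒯 r w = cJ + proj 𝒯 r e := by
    rw [he, proj_sub hΩ hw (integrableOn_feFun hΩ cJ), proj_feFun hΩ hu, add_sub_cancel]
  set f : E3 → ℝ≥0∞ := fun x => ENNReal.ofReal (A * h) * ‖g x‖ₑ with hf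
  have hfm : AEMeasurable f μ := hg.1.enorm.const_mul _
  have hpe : eLpNorm (feFun (proj 𝒯 r e)) p μ ≤ C₂ * avgConst * (A.toNNReal * H * N) := by
    have h1 : ∀ᵐ x ∂μ, ‖feFun (proj 𝒯 r e) x‖ₑ ≤ C₂ * avgOp Ω h f x := by
      filter_upwards [ae_restrict_mem hΩ.isOpen.measurableSet] with x hx
      refine hC₂ hΩ hu hfm (fun β => ?_) x (subset_closure hx)
      have := enorm_integral_bern_smul_sub_interpCoeff_le hr hΩ hu hwg hw hg hc1 hc β
      rw [← mul_assoc] at this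
      exact this
    refine (eLpNorm_le_of_le_mul_avgOp hh hp hfm h1).trans ?_
    gcongr
    have h2 := eLpNorm_le_nnreal_smul_eLpNorm_of_ae_le_mul' (f := f) (g := g)
      (c := (A * h).toNNReal) (μ := μ) (.of_forall fun x => le_of_eq (by simp [hf]; rfl)) p
    refine h2.trans_eq ?_
    rw [ENNReal.smul_def, smul_eq_mul, Real.toNNReal_mul hA0]
    push_cast
    rfl
  have hJ : eLpNorm (fderiv ℝ (feFun cJ)) p μ ≤
      (r * K * interpConst r K * 81).toNNReal * avgConst * N := by
    refine (eLpNorm_le_of_le_mul_avgOp hh hp hg.1.enorm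
      (ae_enorm_fderiv_interpCoeff_le hr hΩ hu hwg hw hg hc1 hc)).trans_eq ?_
    rw [eLpNorm_enorm_fun]
  rw [hq]
  refine (eLpNorm_fderiv_feFun_add_le hΩ hp cJ _).trans ?_
  calc _ ≤ (r * K * interpConst r K * 81).toNNReal * avgConst * N +
        C₁ * H⁻¹ * (C₂ * avgConst * (A.toNNReal * H * N)) := by
        refine add_le_add hJ ((hC₁ hΩ hu hp _).trans ?_)
        gcongr
    _ = (r * K * interpConst r K * 81).toNNReal * avgConst * N +
        C₁ * C₂ * avgConst * A.toNNReal * (H⁻¹ * H) * N := by ring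
    _ = _ := by
        rw [ENNReal.inv_mul_cancel hH0 hHt]
        push_cast
        ring

end Stability

section Multipliers

/-! ### The multiplier of the tangential projection -/

variable {Ω : Set E3} {𝒯 : Triangulation Ω} {r : ℕ} {K h : ℝ} {p : ℝ≥0∞}
variable {F : Type*} [NormedAddCommGroup F] [NormedSpace ℝ F]

/-- The product `(a, b) ↦ b a` of vectors and scalars. -/
def smulMap : E3 →L[ℝ] ℝ →L[ℝ] E3 := (ContinuousLinearMap.lsmul ℝ ℝ).flip

theorem smulMap_apply (a : E3) (b : ℝ) : smulMap a b = b • a := rfl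

/-- The inner product as a continuous bilinear map. -/
def innerMap : E3 →L[ℝ] E3 →L[ℝ] ℝ :=
  LinearMap.mkContinuous₂ (innerₗ E3) 1 fun a b => by
    rw [one_mul]; exact norm_inner_le_norm a b

theorem innerMap_apply (a b : E3) : innerMap a b = inner ℝ a b := rfl

/-- The projection of the product of a scalar finite element function with `m`. -/
def mulProj (m : E3 → E3) (l : Idx 𝒯 r → ℝ) : Idx 𝒯 r → E3 :=
  proj 𝒯 r fun x => smulMap (m x) (feFun l x)

/-- The projection of the inner product of a finite element vector field with `m`. -/
def innerProj (m : E3 → E3) (c : Idx 𝒯 r → E3) : Idx 𝒯 r → ℝ :=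
  proj 𝒯 r fun x => innerMap (m x) (feFun c x)

theorem norm_smulMap_le (a : E3) (b : ℝ) : ‖smulMap a b‖ ≤ ‖a‖ * ‖b‖ := by
  rw [smulMap_apply, norm_smul, mul_comm]

theorem norm_innerMap_le (a b : E3) : ‖innerMap a b‖ ≤ ‖a‖ * ‖b‖ := norm_inner_le_norm a b

theorem feFun_neg (c : Idx 𝒯 r → F) : feFun (-c) = -feFun c := by
  ext x; simp [feFun]

theorem feFun_smul (a : ℝ) (c : Idx 𝒯 r → F) (x : E3) : feFun (a • c) x = a • feFun c x :=
  feFun_comp (a • ContinuousLinearMap.id ℝ F) c x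

theorem eLpNorm_feFun_sub_le (hΩ : BoundedDomain Ω) (hp : 1 ≤ p) (c c' : Idx 𝒯 r → F) :
    eLpNorm (feFun (c - c')) p (volume.restrict Ω) ≤
      eLpNorm (feFun c) p (volume.restrict Ω) + eLpNorm (feFun c') p (volume.restrict Ω) := by
  rw [sub_eq_add_neg]
  refine (eLpNorm_feFun_add_le hΩ hp _ _).trans_eq ?_
  rw [feFun_neg, eLpNorm_neg]

theorem eLpNorm_fderiv_feFun_sub_le (hΩ : BoundedDomain Ω) [CompleteSpace F]
    [SecondCountableTopology (E3 →L[ℝ] F)] (hp : 1 ≤ p) (c c' : Idx 𝒯 r → F) :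
    eLpNorm (fderiv ℝ (feFun (c - c'))) p (volume.restrict Ω) ≤
      eLpNorm (fderiv ℝ (feFun c)) p (volume.restrict Ω) +
        eLpNorm (fderiv ℝ (feFun c')) p (volume.restrict Ω) := by
  rw [sub_eq_add_neg]
  refine (eLpNorm_fderiv_feFun_add_le hΩ hp _ _).trans_eq ?_
  have e : fderiv ℝ (feFun (-c')) = -fderiv ℝ (feFun c') := by
    ext1 x
    rw [feFun_neg, fderiv_neg, Pi.neg_apply]
  rw [e, eLpNorm_neg]

theorem proj_add (hΩ : BoundedDomain Ω) {u v : E3 → F} (hu : IntegrableOn u Ω)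
    (hv : IntegrableOn v Ω) : proj 𝒯 r (u + v) = proj 𝒯 r u + proj 𝒯 r v := by
  rw [← sub_eq_iff_eq_add, ← proj_sub hΩ (hu.add hv) hv, add_sub_cancel_right]

theorem proj_smul (a : ℝ) (u : E3 → F) : proj 𝒯 r (a • u) = a • proj 𝒯 r u := by
  ext α
  simp only [proj, solve, Pi.smul_apply, Finset.smul_sum]
  refine Finset.sum_congr rfl fun β _ => ?_
  rw [smul_comm a, ← integral_smul a]
  exact congrArg _ (integral_congr_ae (.of_forall fun x => smul_comm (bern β x) a (u x)))

theorem memLp_feFun (hΩ : BoundedDomain Ω) (c : Idx 𝒯 r → F) (p : ℝ≥0∞) :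
    MemLp (feFun c) p (volume.restrict Ω) := by
  have : IsFiniteMeasure (volume.restrict Ω) :=
    ⟨by rw [Measure.restrict_apply_univ]; exact hΩ.volume_lt_top⟩
  exact MemLp.of_bound (aestronglyMeasurable_feFun hΩ c) (∑ α, ‖c α‖)
    (.of_forall fun x => norm_feFun_le_sum c x)

section Multiplier

variable {m : E3 → E3} {g : E3 → E3 →L[ℝ] E3} {G : ℝ≥0}

theorem mulProj_add (hΩ : BoundedDomain Ω) (hm : UnitField Ω m g G) (l l' : Idx 𝒯 r → ℝ) :
    mulProj m (l + l') = mulProj m l + mulProj m l' := by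
  rw [mulProj, mulProj, mulProj, ← proj_add hΩ (integrableOn_product hΩ norm_smulMap_le hm l)
    (integrableOn_product hΩ norm_smulMap_le hm l')]
  congr 1
  ext1 x
  rw [Pi.add_apply, feFun_add, map_add]

theorem mulProj_smul (a : ℝ) (l : Idx 𝒯 r → ℝ) : mulProj m (a • l) = a • mulProj m l := by
  rw [mulProj, mulProj, ← proj_smul]
  congr 1
  ext1 x
  rw [Pi.smul_apply, feFun_smul, map_smul]

theorem innerProj_add (hΩ : BoundedDomain Ω) (hm : UnitField Ω m g G) (c c' : Idx 𝒯 r → E3) :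
    innerProj m (c + c') = innerProj m c + innerProj m c' := by
  rw [innerProj, innerProj, innerProj, ← proj_add hΩ (integrableOn_product hΩ norm_innerMap_le hm c)
    (integrableOn_product hΩ norm_innerMap_le hm c')]
  congr 1
  ext1 x
  rw [Pi.add_apply, feFun_add, map_add]

theorem innerProj_smul (a : ℝ) (c : Idx 𝒯 r → E3) : innerProj m (a • c) = a • innerProj m c := by
  rw [innerProj, innerProj, ← proj_smul]
  congr 1
  ext1 x
  rw [Pi.smul_apply, feFun_smul, map_smul]

/-- The Schur complement `l ↦ Π (m · Π (l m))` of the saddle point problem for the tangential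
projection, where `Π` is the `L²` projection onto the finite element space. -/
def schur (hΩ : BoundedDomain Ω) (hm : UnitField Ω m g G) : (Idx 𝒯 r → ℝ) →ₗ[ℝ] (Idx 𝒯 r → ℝ) where
  toFun l := innerProj m (mulProj m l)
  map_add' l l' := by rw [mulProj_add hΩ hm, innerProj_add hΩ hm]
  map_smul' a l := by rw [mulProj_smul, innerProj_smul, RingHom.id_apply]

/-- The Schur complement is a small perturbation of the identity, since `m · m = 1`. -/
theorem exists_eLpNorm_sub_schur_le (hr : 1 ≤ r) (hK : 0 < K) :
    ∃ C : ℝ≥0, ∀ {Ω : Set E3} {𝒯 : Triangulation Ω} {h : ℝ}, BoundedDomain Ω →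
      𝒯.IsUniform K h → ∀ {m : E3 → E3} {g : E3 → E3 →L[ℝ] E3} {G : ℝ≥0}, UnitField Ω m g G →
      ∀ {p : ℝ≥0∞}, 1 ≤ p → ∀ l : Idx 𝒯 r → ℝ,
      eLpNorm (feFun (l - innerProj m (mulProj m l))) p (volume.restrict Ω) ≤
        C * (ENNReal.ofReal h * G) * eLpNorm (feFun l) p (volume.restrict Ω) := by
  obtain ⟨C₁, hC₁⟩ := exists_product_estimates hr hK norm_smulMap_le
  obtain ⟨C₂, hC₂⟩ := exists_eLpNorm_feFun_proj_le (F := ℝ) hr hK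
  refine ⟨C₂ * C₁, fun {Ω 𝒯 h} hΩ hu {m g G} hm {p} hp l => ?_⟩
  have h1 := (hC₁ hΩ hu hm hp l).2.2
  set d : E3 → E3 := fun x => smulMap (m x) (feFun l x) - feFun (mulProj m l) x with hd
  have hdm : AEStronglyMeasurable d (volume.restrict Ω) :=
    (aestronglyMeasurable_product hΩ hm l).sub (aestronglyMeasurable_feFun hΩ _)
  set ρ : E3 → ℝ := fun x => innerMap (m x) (d x) with hρ
  have hρm : AEStronglyMeasurable ρ (volume.restrict Ω) :=
    innerMap.aestronglyMeasurable_comp₂ hm.aestronglyMeasurable hdm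
  -- `l = m · (l m)`, as `m` is a field of unit vectors
  have e1 : l - innerProj m (mulProj m l) = proj 𝒯 r ρ := by
    have h2 : l - innerProj m (mulProj m l) =
        proj 𝒯 r (feFun l) - innerProj m (mulProj m l) := by rw [proj_feFun hΩ hu]
    rw [h2, innerProj, ← proj_sub hΩ (integrableOn_feFun hΩ l)
      (integrableOn_product hΩ norm_innerMap_le hm _)]
    refine proj_congr ?_
    filter_upwards [hm.norm_eq] with x hx
    rw [Pi.sub_apply, hρ, hd]
    simp only
    rw [map_sub, smulMap_apply, map_smul, innerMap_apply (m x) (m x), real_inner_self_eq_norm_sq,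
      hx, one_pow, smul_eq_mul, mul_one]
  rw [e1]
  calc _ ≤ C₂ * eLpNorm ρ p (volume.restrict Ω) := hC₂ hΩ hu hp hρm
    _ ≤ C₂ * eLpNorm d p (volume.restrict Ω) := by
        gcongr
        exact eLpNorm_mono_ae (ae_norm_product_le norm_innerMap_le hm d)
    _ ≤ C₂ * (C₁ * (ENNReal.ofReal h * G) * eLpNorm (feFun l) p (volume.restrict Ω)) := by
        gcongr
        exact h1
    _ = _ := by push_cast; ring

theorem le_two_mul_of_le_add_half {a b : ℝ≥0∞} (ha : a ≠ ⊤) (h : a ≤ b + 2⁻¹ * a) : a ≤ 2 * b := by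
  have h1 : 2⁻¹ * a + 2⁻¹ * a ≤ b + 2⁻¹ * a := by
    rwa [← add_mul, ENNReal.inv_two_add_inv_two, one_mul]
  have h2 : 2⁻¹ * a ≤ b := by
    refine (ENNReal.add_le_add_iff_right ?_).1 h1
    exact ENNReal.mul_ne_top (by simp) ha
  calc a = 2 * (2⁻¹ * a) := by
        rw [← mul_assoc, ENNReal.mul_inv_cancel (by simp) (by simp), one_mul]
    _ ≤ 2 * b := by gcongr

/-- A multiplier is bounded by its image under the Schur complement, if this is close to the
identity. -/
theorem eLpNorm_feFun_le_of_schur (hΩ : BoundedDomain Ω) (hp : 1 ≤ p) {l : Idx 𝒯 r → ℝ}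
    (h : eLpNorm (feFun (l - innerProj m (mulProj m l))) p (volume.restrict Ω) ≤
      2⁻¹ * eLpNorm (feFun l) p (volume.restrict Ω)) :
    eLpNorm (feFun l) p (volume.restrict Ω) ≤
      2 * eLpNorm (feFun (innerProj m (mulProj m l))) p (volume.restrict Ω) := by
  refine le_two_mul_of_le_add_half (memLp_feFun hΩ l p).2.ne ?_
  have h1 := eLpNorm_feFun_add_le hΩ hp (innerProj m (mulProj m l)) (l - innerProj m (mulProj m l))
  rw [add_sub_cancel] at h1
  exact h1.trans (add_le_add le_rfl h)

/-- The Schur complement is injective, hence surjective on a finite-dimensional space. -/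
theorem exists_schur_eq (hΩ : BoundedDomain Ω) (hu : 𝒯.IsUniform K h) (hm : UnitField Ω m g G)
    (hS : ∀ l : Idx 𝒯 r → ℝ,
      eLpNorm (feFun (l - innerProj m (mulProj m l))) 1 (volume.restrict Ω) ≤
        2⁻¹ * eLpNorm (feFun l) 1 (volume.restrict Ω)) (b : Idx 𝒯 r → ℝ) :
    ∃ l, innerProj m (mulProj m l) = b := by
  have hinj : Function.Injective (schur (𝒯 := 𝒯) (r := r) hΩ hm) := by
    rw [injective_iff_map_eq_zero]
    intro l hl
    have hl' : innerProj m (mulProj m l) = 0 := hl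
    have h1 := eLpNorm_feFun_le_of_schur hΩ le_rfl (hS l)
    have h0 : feFun (0 : Idx 𝒯 r → ℝ) = 0 := by ext x; simp [feFun]
    rw [hl', h0, eLpNorm_zero, mul_zero, nonpos_iff_eq_zero,
      eLpNorm_eq_zero_iff (aestronglyMeasurable_feFun hΩ l) one_ne_zero] at h1
    rw [← proj_feFun hΩ hu l, proj_congr h1, ← h0, proj_feFun hΩ hu]
  exact (LinearMap.injective_iff_surjective.1 hinj) b

end Multiplier

/-! ### The tangential projection -/

theorem integral_inner_feFun (hΩ : BoundedDomain Ω) (d : Idx 𝒯 r → E3) {u : E3 → E3}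
    (hu : IntegrableOn u Ω) :
    ∫ x in Ω, inner ℝ (feFun d x) (u x) = ∑ β, inner ℝ (d β) (∫ x in Ω, bern β x • u x) := by
  have e : ∀ x, inner ℝ (feFun d x) (u x) = ∑ β, inner ℝ (d β) (bern β x • u x) := by
    intro x
    rw [feFun, sum_inner]
    refine Finset.sum_congr rfl fun β _ => ?_
    rw [real_inner_smul_left, real_inner_smul_right]
  simp_rw [e]
  rw [integral_finsetSum _ fun β _ => (integrableOn_bern_smul hΩ β hu).const_inner (d β)]
  exact Finset.sum_congr rfl fun β _ => integral_inner (integrableOn_bern_smul hΩ β hu) _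

/-- The error of the projection is orthogonal to the finite element space. -/
theorem integral_inner_feFun_proj (hΩ : BoundedDomain Ω) (hu : 𝒯.IsUniform K h) (d : Idx 𝒯 r → E3)
    {u : E3 → E3} (hui : IntegrableOn u Ω) :
    ∫ x in Ω, inner ℝ (feFun d x) (feFun (proj 𝒯 r u) x) = ∫ x in Ω, inner ℝ (feFun d x) (u x) := by
  rw [integral_inner_feFun hΩ d (integrableOn_feFun hΩ _), integral_inner_feFun hΩ d hui]
  simp only [integral_bern_smul_feFun_proj hΩ hu]

theorem feFun_apply (c : Idx 𝒯 r → E3) (x : E3) (i : Fin 3) :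
    feFun c x i = feFun (fun α => c α i) x :=
  (feFun_comp (EuclideanSpace.proj i : E3 →L[ℝ] ℝ) c x).symm

theorem exists_coeff_of_mem_feSpace3 (hr : 1 ≤ r) (hΩ : BoundedDomain Ω) {f : L2 Ω}
    (hf : f ∈ feSpace3 𝒯 r) : ∃ c : Idx 𝒯 r → E3, f =ᵐ[volume.restrict Ω] feFun c := by
  choose v hv hfv using hf
  choose c hc using fun i => exists_coeff_of_mem_feSpace hr (hv i)
  refine ⟨fun α => WithLp.toLp 2 fun i => c i α, ?_⟩
  filter_upwards [ae_all_iff.2 hfv, ae_restrict_mem hΩ.isOpen.measurableSet] with x hx hxΩ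
  ext i
  rw [hx i, hc i x (subset_closure hxΩ), feFun_apply]

/-- A finite element vector field as an element of `L²(Ω)³`. -/
def feL2 (hΩ : BoundedDomain Ω) (c : Idx 𝒯 r → E3) : L2 Ω := (memLp_feFun hΩ c 2).toLp (feFun c)

theorem coeFn_feL2 (hΩ : BoundedDomain Ω) (c : Idx 𝒯 r → E3) :
    feL2 hΩ c =ᵐ[volume.restrict Ω] feFun c := MemLp.coeFn_toLp _

theorem feL2_mem (hΩ : BoundedDomain Ω) (c : Idx 𝒯 r → E3) : feL2 hΩ c ∈ feSpace3 𝒯 r := by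
  intro i
  refine ⟨feFun fun α => c α i, feFun_mem_feSpace _, ?_⟩
  filter_upwards [coeFn_feL2 hΩ c] with x hx
  rw [hx, feFun_apply]

section Projection

variable {m : E3 → E3} {g : E3 → E3 →L[ℝ] E3} {G : ℝ≥0}

/-- A finite element field with `Π (m · c) = 0` belongs to the discrete tangent space. -/
theorem feL2_mem_tangentSpace (hr : 1 ≤ r) (hΩ : BoundedDomain Ω) (hu : 𝒯.IsUniform K h)
    (hm : UnitField Ω m g G) {c : Idx 𝒯 r → E3} (hc : innerProj m c = 0) :
    feL2 hΩ c ∈ tangentSpace 𝒯 r m := by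
  refine ⟨feL2_mem hΩ c, fun v hv => ?_⟩
  obtain ⟨b, hb⟩ := exists_coeff_of_mem_feSpace hr hv
  have hi := integrableOn_product hΩ norm_innerMap_le hm c
  have e : (fun x => ∑ β, b β * (bern β x • innerMap (m x) (feFun c x))) =ᵐ[volume.restrict Ω]
      fun x => inner ℝ (m x) (feL2 hΩ c x) * v x := by
    filter_upwards [coeFn_feL2 hΩ c, ae_restrict_mem hΩ.isOpen.measurableSet] with x hx hxΩ
    rw [hx, hb x (subset_closure hxΩ), innerMap_apply,
      show feFun b x = ∑ β, bern β x • b β from rfl, Finset.mul_sum]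
    refine Finset.sum_congr rfl fun β _ => ?_
    simp only [smul_eq_mul]
    ring
  have hs : ∀ β ∈ Finset.univ, Integrable
      (fun x => b β * (bern β x • innerMap (m x) (feFun c x))) (volume.restrict Ω) :=
    fun β _ => (integrableOn_bern_smul hΩ β hi).const_mul _
  refine ⟨(integrable_finsetSum _ hs).congr e, ?_⟩
  rw [← integral_congr_ae e, integral_finsetSum _ hs]
  refine Finset.sum_eq_zero fun β _ => ?_
  have h1 := integral_bern_smul_feFun_proj hΩ hu (fun x => innerMap (m x) (feFun c x)) β
  have h2 : proj 𝒯 r (fun x => innerMap (m x) (feFun c x)) = 0 := hc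
  rw [h2] at h1
  rw [integral_const_mul, ← h1]
  simp [feFun]

/-- The tangential projection subtracts `Π (l m)`, where the multiplier `l` solves the equation of
the Schur complement. The difference is orthogonal to the discrete tangent space, since `(ψ, Π (l
m)) = (m · ψ, l)` for finite element fields `ψ`. -/
theorem tangentProj_eq (hr : 1 ≤ r) (hΩ : BoundedDomain Ω) (hu : 𝒯.IsUniform K h)
    (hm : UnitField Ω m g G) {c : Idx 𝒯 r → E3} {l : Idx 𝒯 r → ℝ}
    (hl : innerProj m (mulProj m l) = innerProj m c) {f : L2 Ω}
    (hf : f =ᵐ[volume.restrict Ω] feFun c) :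
    tangentProj 𝒯 r m f = feL2 hΩ (c - mulProj m l) := by
  refine Submodule.eq_starProjection_of_mem_orthogonal ?_ ?_
  · refine feL2_mem_tangentSpace hr hΩ hu hm ?_
    have h1 := innerProj_add hΩ hm (c - mulProj m l) (mulProj m l)
    rw [sub_add_cancel, hl] at h1
    exact left_eq_add.1 (h1.trans (add_comm _ _))
  · rw [Submodule.mem_orthogonal]
    intro ψ hψ
    obtain ⟨d, hd⟩ := exists_coeff_of_mem_feSpace3 hr hΩ hψ.1
    rw [L2.inner_def]
    have h1 : ∫ x in Ω, inner ℝ (ψ x) ((f - feL2 hΩ (c - mulProj m l) : L2 Ω) x) =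
        ∫ x in Ω, inner ℝ (feFun d x) (feFun (mulProj m l) x) := by
      refine integral_congr_ae ?_
      filter_upwards [hd, hf, coeFn_feL2 hΩ (c - mulProj m l),
        Lp.coeFn_sub f (feL2 hΩ (c - mulProj m l))] with x h1 h2 h3 h4
      rw [h4, Pi.sub_apply, h1, h2, h3, feFun_sub, sub_sub_cancel]
    rw [h1, mulProj, integral_inner_feFun_proj hΩ hu d
      (integrableOn_product hΩ norm_smulMap_le hm l), ← (hψ.2 _ (feFun_mem_feSpace l)).2]
    refine integral_congr_ae ?_
    filter_upwards [hd] with x hx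
    rw [hx, smulMap_apply, real_inner_smul_right, real_inner_comm, mul_comm]

end Projection

end Multipliers

section TangentialProjection

/-! ### Bounds of the tangential projection -/

variable {Ω : Set E3} {𝒯 : Triangulation Ω} {r : ℕ} {K h : ℝ} {p : ℝ≥0∞}

/-- The tangential projection is bounded in `L^p`, and in `W^{1,p}` with a constant that grows
linearly with the gradient of the unit vector field. -/
theorem exists_tangentProj_estimates (hr : 1 ≤ r) (hK : 0 < K) :
    ∃ C D : ℝ≥0, ∀ {Ω : Set E3} {𝒯 : Triangulation Ω} {h : ℝ} (hΩ : BoundedDomain Ω),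
      𝒯.IsUniform K h → ∀ {m : E3 → E3} {g : E3 → E3 →L[ℝ] E3} {G : ℝ≥0}, UnitField Ω m g G →
      (D : ℝ≥0∞) * (ENNReal.ofReal h * G) ≤ 2⁻¹ → ∀ c : Idx 𝒯 r → E3, ∃ d : Idx 𝒯 r → E3,
      (∀ f : L2 Ω, f =ᵐ[volume.restrict Ω] feFun c → tangentProj 𝒯 r m f = feL2 hΩ d) ∧
      ∀ {p : ℝ≥0∞}, 1 ≤ p →
        eLpNorm (feFun d) p (volume.restrict Ω) ≤ C * eLpNorm (feFun c) p (volume.restrict Ω) ∧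
        eLpNorm (fderiv ℝ (feFun d)) p (volume.restrict Ω) ≤
          C * (eLpNorm (fderiv ℝ (feFun c)) p (volume.restrict Ω) +
            G * eLpNorm (feFun c) p (volume.restrict Ω)) := by
  obtain ⟨C₁, hC₁⟩ := exists_eLpNorm_fderiv_feFun_le (F := ℝ) r K
  obtain ⟨Cm, hCm⟩ := exists_product_estimates hr hK norm_smulMap_le
  obtain ⟨Ci, hCi⟩ := exists_product_estimates hr hK norm_innerMap_le
  obtain ⟨D, hD⟩ := exists_eLpNorm_sub_schur_le hr hK
  refine ⟨2 + 2 * Cm * Ci + (Ci + 2 * Ci * (C₁ * D + Cm)), D,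
    fun {Ω 𝒯 h} hΩ hu {m g G} hm hsmall c => ?_⟩
  set C : ℝ≥0 := 2 + 2 * Cm * Ci + (Ci + 2 * Ci * (C₁ * D + Cm)) with hC
  have hh := hu.pos
  set μ := volume.restrict Ω with hμ
  set H := ENNReal.ofReal h with hH
  have hH0 : H ≠ 0 := (ENNReal.ofReal_pos.2 hh).ne'
  have hHt : H ≠ ⊤ := ENNReal.ofReal_ne_top
  have hS : ∀ {p : ℝ≥0∞}, 1 ≤ p → ∀ l : Idx 𝒯 r → ℝ,
      eLpNorm (feFun (l - innerProj m (mulProj m l))) p μ ≤ 2⁻¹ * eLpNorm (feFun l) p μ :=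
    fun hp l => (hD hΩ hu hm hp l).trans (by gcongr)
  obtain ⟨l, hl⟩ := exists_schur_eq hΩ hu hm (hS le_rfl) (innerProj m c)
  refine ⟨c - mulProj m l, fun f hf => tangentProj_eq hr hΩ hu hm hl hf, fun {p} hp => ?_⟩
  set N := eLpNorm (feFun c) p μ with hN
  set N' := eLpNorm (fderiv ℝ (feFun c)) p μ with hN'
  set L := eLpNorm (feFun l) p μ with hL
  have hLN : L ≤ 2 * (Ci * N) := by
    refine (eLpNorm_feFun_le_of_schur hΩ hp (hS hp l)).trans ?_
    rw [hl]
    gcongr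
    exact (hCi hΩ hu hm hp c).1
  -- `l = Π (m · v) + (l - S l)`: the second term is `O(h G)`, so that the inverse estimate applies
  have hL' : eLpNorm (fderiv ℝ (feFun l)) p μ ≤ N' + Ci * G * N + C₁ * D * G * L := by
    have h1 := eLpNorm_fderiv_feFun_add_le hΩ hp (innerProj m c) (l - innerProj m c)
    rw [add_sub_cancel] at h1
    refine h1.trans (add_le_add (hCi hΩ hu hm hp c).2.1 ((hC₁ hΩ hu hp _).trans ?_))
    have h2 := hD hΩ hu hm hp l
    rw [hl] at h2
    calc C₁ * H⁻¹ * eLpNorm (feFun (l - innerProj m c)) p μ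
        ≤ C₁ * H⁻¹ * (D * (H * G) * L) := by gcongr
      _ = C₁ * D * G * L * (H⁻¹ * H) := by ring
      _ = _ := by rw [ENNReal.inv_mul_cancel hH0 hHt, mul_one]
  constructor
  · refine (eLpNorm_feFun_sub_le hΩ hp _ _).trans ?_
    calc _ ≤ N + Cm * (2 * (Ci * N)) := by
          gcongr
          exact (hCm hΩ hu hm hp l).1.trans (by gcongr)
      _ = (1 + 2 * Cm * Ci : ℝ≥0) * N := by push_cast; ring
      _ ≤ C * N := by
          refine mul_le_mul' (ENNReal.coe_le_coe.2 ?_) le_rfl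
          refine le_trans ?_ le_self_add
          exact add_le_add one_le_two le_rfl
  · refine (eLpNorm_fderiv_feFun_sub_le hΩ hp _ _).trans ?_
    calc _ ≤ N' + (N' + Ci * G * N + C₁ * D * G * L + Cm * G * L) := by
          gcongr
          exact (hCm hΩ hu hm hp l).2.1.trans (add_le_add hL' le_rfl)
      _ ≤ N' + (N' + Ci * G * N + C₁ * D * G * (2 * (Ci * N)) + Cm * G * (2 * (Ci * N))) := by
          gcongr
      _ = (2 : ℝ≥0) * N' + (Ci + 2 * Ci * (C₁ * D + Cm) : ℝ≥0) * (G * N) := by push_cast; ring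
      _ ≤ C * N' + C * (G * N) := by
          refine add_le_add (mul_le_mul' (ENNReal.coe_le_coe.2 ?_) le_rfl)
            (mul_le_mul' (ENNReal.coe_le_coe.2 ?_) le_rfl)
          · rw [hC, add_assoc]
            exact le_self_add
          · exact le_add_self
      _ = _ := by ring

/-! ### Duality -/

theorem one_le_conjExponent (p : ℝ≥0∞) : 1 ≤ p.conjExponent := le_self_add

/-- The pairing is bounded by the dual norm. This includes the case that `z` vanishes almost
everywhere, in which the quotient in the definition of the dual norm is `0 / 0`. -/
theorem enorm_integral_inner_le_normWneg1 (hΩ : IsOpen Ω) {u z : E3 → E3} {g : E3 → E3 →L[ℝ] E3}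
    (hz : HasWeakFDeriv Ω z g) (hfin : normW1 Ω p.conjExponent z < ⊤) :
    ‖∫ x in Ω, inner ℝ (u x) (z x)‖ₑ ≤ normWneg1 Ω p u * normW1 Ω p.conjExponent z := by
  rcases eq_or_ne (normW1 Ω p.conjExponent z) 0 with h0 | h0
  · rw [hz.normW1_eq hΩ, add_eq_zero] at h0
    have h1 := (eLpNorm_eq_zero_iff hz.1.aestronglyMeasurable
      (zero_lt_one.trans_le (one_le_conjExponent p)).ne').1 h0.1
    have h2 : ∫ x in Ω, inner ℝ (u x) (z x) = 0 := by
      rw [← integral_zero E3 ℝ (μ := volume.restrict Ω)]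
      refine integral_congr_ae ?_
      filter_upwards [h1] with x hx
      rw [hx, Pi.zero_apply, inner_zero_right]
    rw [h2, enorm_zero]
    exact zero_le
  · rw [← ENNReal.div_le_iff h0 hfin.ne]
    exact le_iSup₂_of_le (f := fun (w : E3 → E3) (_ : normW1 Ω p.conjExponent w < ⊤) =>
      ‖∫ x in Ω, inner ℝ (u x) (w x)‖ₑ / normW1 Ω p.conjExponent w) z hfin le_rfl

theorem normW1_feFun_lt_top (hΩ : BoundedDomain Ω) (hu : 𝒯.IsUniform K h) (c : Idx 𝒯 r → E3)
    (p : ℝ≥0∞) : normW1 Ω p (feFun c) < ⊤ := by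
  have hK := hu.K_pos
  have hh := hu.pos
  have : IsFiniteMeasure (volume.restrict Ω) :=
    ⟨by rw [Measure.restrict_apply_univ]; exact hΩ.volume_lt_top⟩
  rw [normW1_feFun hΩ hu]
  refine ENNReal.add_lt_top.2 ⟨(memLp_feFun hΩ c p).2, ?_⟩
  refine (MemLp.of_bound (C := r * K / h * ∑ α, ‖c α‖)
    (measurable_fderiv ℝ _).aestronglyMeasurable ?_).2
  filter_upwards [ae_exists_mem_interior 𝒯 hΩ.isOpen] with x ⟨t, ht⟩
  refine (norm_fderiv_feFun_le hu ht c).trans ?_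
  gcongr
  exact Finset.subset_univ _

/-- The `L²` projection is bounded in the norm of `W^{1,p}`. -/
theorem exists_normW1_feFun_proj_le (hr : 1 ≤ r) (hK : 0 < K) :
    ∃ C : ℝ≥0, ∀ {Ω : Set E3} {𝒯 : Triangulation Ω} {h : ℝ}, BoundedDomain Ω →
      𝒯.IsUniform K h → ∀ {p : ℝ≥0∞}, 1 ≤ p → ∀ {w : E3 → E3}, normW1 Ω p w < ⊤ →
      IntegrableOn w Ω ∧ normW1 Ω p (feFun (proj 𝒯 r w)) ≤ C * normW1 Ω p w := by
  obtain ⟨C₁, hC₁⟩ := exists_eLpNorm_feFun_proj_le (F := E3) hr hK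
  obtain ⟨C₂, hC₂⟩ := exists_eLpNorm_fderiv_proj_le hr hK
  refine ⟨C₁ + C₂, fun {Ω 𝒯 h} hΩ hu {p} hp {w} hw => ?_⟩
  have : IsFiniteMeasure (volume.restrict Ω) :=
    ⟨by rw [Measure.restrict_apply_univ]; exact hΩ.volume_lt_top⟩
  obtain ⟨g, hwg⟩ := exists_of_normW1_lt_top hw
  have e := hwg.normW1_eq hΩ.isOpen p
  rw [e, ENNReal.add_lt_top] at hw
  have hwm := hwg.1.aestronglyMeasurable
  have hwi : IntegrableOn w Ω := (MemLp.integrable hp ⟨hwm, hw.1⟩)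
  have hgi : IntegrableOn g Ω := (MemLp.integrable hp ⟨hwg.2.1.aestronglyMeasurable, hw.2⟩)
  refine ⟨hwi, ?_⟩
  rw [normW1_feFun hΩ hu, e, mul_add]
  refine add_le_add ((hC₁ hΩ hu hp hwm).trans ?_) ((hC₂ hΩ hu hwg hwi hgi hp).trans ?_)
  · gcongr
    exact le_self_add
  · gcongr
    exact le_add_self

/-- The tangential projection is bounded in `W^{s,p}` for `s ∈ {-1, 0, 1}`. The case `s = -1`
follows from the case `s = 1` by duality, since the projection is self-adjoint. -/
theorem exists_normW_tangentProj_le (hr : 1 ≤ r) (hK : 0 < K) :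
    ∃ C D : ℝ≥0, ∀ {Ω : Set E3} {𝒯 : Triangulation Ω} {h : ℝ}, BoundedDomain Ω →
      𝒯.IsUniform K h → ∀ {m : E3 → E3} {g : E3 → E3 →L[ℝ] E3} {G : ℝ≥0}, UnitField Ω m g G →
      (D : ℝ≥0∞) * (ENNReal.ofReal h * G) ≤ 2⁻¹ → ∀ {p : ℝ≥0∞}, 1 ≤ p → ∀ s : SignType,
      ∀ f ∈ feSpace3 𝒯 r, normW Ω s p (tangentProj 𝒯 r m f) ≤ C * (1 + G) * normW Ω s p f := by
  obtain ⟨C, D, hCD⟩ := exists_tangentProj_estimates hr hK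
  obtain ⟨C', hC'⟩ := exists_normW1_feFun_proj_le hr hK
  refine ⟨C * (1 + C'), D, fun {Ω 𝒯 h} hΩ hu {m g G} hm hsmall {p} hp s f hf => ?_⟩
  have h1G : (1 : ℝ≥0∞) ≤ 1 + G := le_self_add
  have hone : ∀ {q : ℝ≥0∞}, 1 ≤ q → ∀ c d : Idx 𝒯 r → E3, (∀ {p : ℝ≥0∞}, 1 ≤ p →
        eLpNorm (feFun d) p (volume.restrict Ω) ≤ C * eLpNorm (feFun c) p (volume.restrict Ω) ∧
        eLpNorm (fderiv ℝ (feFun d)) p (volume.restrict Ω) ≤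
          C * (eLpNorm (fderiv ℝ (feFun c)) p (volume.restrict Ω) +
            G * eLpNorm (feFun c) p (volume.restrict Ω))) →
      normW1 Ω q (feFun d) ≤ C * (1 + G) * normW1 Ω q (feFun c) := by
    intro q hq c d hcd
    rw [normW1_feFun hΩ hu, normW1_feFun hΩ hu]
    refine (add_le_add (hcd hq).1 (hcd hq).2).trans ?_
    set N := eLpNorm (feFun c) q (volume.restrict Ω)
    set N' := eLpNorm (fderiv ℝ (feFun c)) q (volume.restrict Ω)
    calc C * N + C * (N' + G * N) = C * ((1 + G) * N + 1 * N') := by ring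
      _ ≤ C * ((1 + G) * N + (1 + G) * N') := by gcongr
      _ = _ := by ring
  have hCC : (C : ℝ≥0∞) ≤ (C * (1 + C') : ℝ≥0) := by
    rw [mul_add, mul_one]
    exact ENNReal.coe_le_coe.2 le_self_add
  obtain ⟨c, hc⟩ := exists_coeff_of_mem_feSpace3 hr hΩ hf
  obtain ⟨d, hd, hcd⟩ := hCD hΩ hu hm hsmall c
  have hd' : tangentProj 𝒯 r m f =ᵐ[volume.restrict Ω] feFun d := by
    rw [hd f hc]; exact coeFn_feL2 hΩ d
  cases s with
  | zero =>
    change eLpNorm _ _ _ ≤ _ * eLpNorm _ _ _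
    rw [eLpNorm_congr_ae hc, eLpNorm_congr_ae hd']
    refine (hcd hp).1.trans (mul_le_mul' ?_ le_rfl)
    exact hCC.trans (le_mul_of_one_le_right' h1G)
  | pos =>
    change normW1 _ _ _ ≤ _ * normW1 _ _ _
    rw [normW1_congr hc, normW1_congr hd']
    exact (hone hp c d hcd).trans (by gcongr)
  | neg =>
    change normWneg1 _ _ _ ≤ _ * normWneg1 _ _ _
    refine iSup₂_le fun w hw => ENNReal.div_le_of_le_mul ?_
    have hq := one_le_conjExponent p
    obtain ⟨hwi, hwC⟩ := hC' hΩ hu hq hw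
    obtain ⟨z, hz, hcz⟩ := hCD hΩ hu hm hsmall (proj 𝒯 r w)
    -- move `Π` and the tangential projection to the other side of the pairing
    have h1 : ∫ x in Ω, inner ℝ (tangentProj 𝒯 r m f x) (w x) =
        ∫ x in Ω, inner ℝ (f x) (feFun z x) := by
      calc ∫ x in Ω, inner ℝ (tangentProj 𝒯 r m f x) (w x)
          = ∫ x in Ω, inner ℝ (feFun d x) (w x) := by
            refine integral_congr_ae ?_
            filter_upwards [hd'] with x hx
            rw [hx]
        _ = ∫ x in Ω, inner ℝ (feFun d x) (feFun (proj 𝒯 r w) x) :=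
            (integral_inner_feFun_proj hΩ hu d hwi).symm
        _ = inner ℝ (tangentProj 𝒯 r m f) (feL2 hΩ (proj 𝒯 r w)) := by
            rw [L2.inner_def]
            refine integral_congr_ae ?_
            filter_upwards [hd', coeFn_feL2 hΩ (proj 𝒯 r w)] with x h1 h2
            rw [h1, h2]
        _ = inner ℝ f (tangentProj 𝒯 r m (feL2 hΩ (proj 𝒯 r w))) :=
            Submodule.inner_starProjection_left_eq_right _ _ _
        _ = _ := by
            rw [hz _ (coeFn_feL2 hΩ _), L2.inner_def]
            refine integral_congr_ae ?_
            filter_upwards [coeFn_feL2 hΩ z] with x h1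
            rw [h1]
    rw [h1]
    refine (enorm_integral_inner_le_normWneg1 (p := p) hΩ.isOpen (hasWeakFDeriv_feFun hΩ hu z)
      (normW1_feFun_lt_top hΩ hu z _)).trans ?_
    calc _ ≤ normWneg1 Ω p f * (C * (1 + G) * (C' * normW1 Ω p.conjExponent w)) := by
          gcongr
          exact (hone hq _ z hcz).trans (by gcongr)
      _ = (C * C' : ℝ≥0) * (1 + G) * normWneg1 Ω p f * normW1 Ω p.conjExponent w := by
          push_cast
          ring
      _ ≤ _ := by
          gcongr
          exact le_add_self

/-! ### Shape-regular and quasi-uniform triangulations -/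

/-- The meshwidth is positive because a triangulation of a nonempty set has a tetrahedron. -/
theorem Triangulation.isUniform (𝒯 : Triangulation Ω) (hΩ : Ω.Nonempty) {σ τ : ℝ}
    (hσ : 𝒯.ShapeRegular σ) (hτ : 𝒯.QuasiUniform τ) :
    𝒯.IsUniform (max (σ * τ) 1) 𝒯.meshWidth := by
  have hbdd : BddAbove ((fun t => Metric.diam (tet t)) '' 𝒯.elements) := by
    refine Set.Finite.bddAbove (Set.Finite.image _ ?_)
    exact 𝒯.finite_faces.subset fun _ h => h.1
  have hle : ∀ t : 𝒯.elements, Metric.diam (tet (t : Finset E3)) ≤ 𝒯.meshWidth := fun t =>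
    le_csSup hbdd (Set.mem_image_of_mem _ t.2)
  have hpos : ∀ t : 𝒯.elements, 0 < Metric.diam (tet (t : Finset E3)) := by
    intro t
    obtain ⟨c, ρ, hρ, hc, -⟩ := hσ t t.2
    have h1 : c + EuclideanSpace.single 0 ρ ∈ Metric.closedBall c ρ := by
      rw [Metric.mem_closedBall, dist_eq_norm, add_sub_cancel_left, PiLp.norm_single,
        Real.norm_of_nonneg hρ.le]
    have h2 := Metric.dist_le_diam_of_mem (isCompact_tet (t : Finset E3)).isBounded (hc h1)
      (hc (Metric.mem_closedBall_self hρ.le))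
    rw [dist_eq_norm, add_sub_cancel_left, PiLp.norm_single,
      Real.norm_of_nonneg hρ.le] at h2
    exact hρ.trans_le h2
  obtain ⟨x, hx⟩ := hΩ
  obtain ⟨t₀, -⟩ := exists_mem_tet 𝒯 (subset_closure hx)
  have hh : 0 < 𝒯.meshWidth := (hpos t₀).trans_le (hle t₀)
  refine ⟨le_max_right _ _, hh, hle, fun t => ?_⟩
  obtain ⟨c, ρ, hρ, hc, hd⟩ := hσ t t.2
  refine ⟨c, (Metric.closedBall_subset_closedBall ?_).trans hc⟩
  have h1 := hτ t t.2
  have hτ0 : 0 < τ := by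
    by_contra! h0
    have := mul_nonpos_of_nonpos_of_nonneg h0 (hpos t).le
    linarith
  rw [div_le_iff₀ (by positivity)]
  calc 𝒯.meshWidth ≤ τ * (σ * ρ) := h1.trans (by gcongr)
    _ = ρ * (σ * τ) := by ring
    _ ≤ ρ * max (σ * τ) 1 := by gcongr; exact le_max_left _ _

/-- For a unit field, `‖m‖_{W^{1,∞}} = 1 + ‖∇m‖_∞`. -/
theorem exists_unitField (hΩ : BoundedDomain Ω) {m : E3 → E3}
    (hm : ∀ᵐ x ∂(volume.restrict Ω), ‖m x‖ = 1) (hfin : normW1 Ω ⊤ m < ⊤) :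
    ∃ (g : E3 → E3 →L[ℝ] E3) (G : ℝ≥0), UnitField Ω m g G ∧ normW1 Ω ⊤ m = 1 + G := by
  obtain ⟨g, hmg⟩ := exists_of_normW1_lt_top hfin
  have e := hmg.normW1_eq hΩ.isOpen ⊤
  have hne : volume.restrict Ω ≠ 0 := by
    rw [ne_eq, Measure.restrict_eq_zero]
    exact (hΩ.isOpen.measure_pos _ hΩ.isConnected.nonempty).ne'
  have h1 : eLpNorm m ⊤ (volume.restrict Ω) = 1 := by
    have h2 : eLpNorm m ⊤ (volume.restrict Ω) =
        eLpNorm (fun _ : E3 => (1 : ℝ)) ⊤ (volume.restrict Ω) := by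
      refine eLpNorm_congr_norm_ae ?_
      filter_upwards [hm] with x hx
      rw [hx, norm_one]
    rw [h2, eLpNorm_const _ ENNReal.top_ne_zero hne]
    simp
  have hg : eLpNorm g ⊤ (volume.restrict Ω) ≠ ⊤ := by
    rw [e] at hfin
    exact (ENNReal.add_lt_top.1 hfin).2.ne
  refine ⟨g, (eLpNorm g ⊤ (volume.restrict Ω)).toNNReal, ⟨hmg, hm, ?_⟩, ?_⟩
  · filter_upwards [ae_le_eLpNormEssSup (f := g) (μ := volume.restrict Ω)] with x hx
    rw [← eLpNorm_exponent_top] at hx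
    exact ENNReal.toReal_mono hg hx
  · rw [e, h1, ENNReal.coe_toNNReal hg]

end TangentialProjection

end FEM

end

open MeasureTheory FEM in
theorem lemma5p3 (r : ℕ) (hr : 1 ≤ r) (σ τ : ℝ) :
    ∃ C : ENNReal → NNReal, ∀ R : NNReal, ∃ hR : ℝ, 0 < hR ∧
      ∀ (Ω : Set E3), BoundedDomain Ω →
      ∀ 𝒯 : Triangulation Ω, 𝒯.ShapeRegular σ → 𝒯.QuasiUniform τ → 𝒯.meshWidth ≤ hR →
      ∀ m : E3 → E3, (∀ᵐ x ∂(volume.restrict Ω), ‖m x‖ = 1) → normW1 Ω ⊤ m ≤ R →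
      ∀ (p : ENNReal), 1 ≤ p → ∀ (s : SignType), ∀ v ∈ feSpace3 𝒯 r,
        normW Ω s p (tangentProj 𝒯 r m v) ≤ C p * normW1 Ω ⊤ m ^ 2 * normW Ω s p v := by
  have hK : 0 < max (σ * τ) 1 := by positivity
  obtain ⟨C, D, hCD⟩ := exists_normW_tangentProj_le hr hK
  -- the choice of `hR` gives `D h ‖∇m‖_∞ ≤ 1 / 2`; the constant does not depend on `p`
  refine ⟨fun _ => C, fun R => ⟨1 / (2 * (D + 1) * (R + 1)), by positivity, ?_⟩⟩
  intro Ω hΩ 𝒯 hσ hτ hh m hm hmR p hp s v hv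
  have hu := 𝒯.isUniform hΩ.isConnected.nonempty hσ hτ
  obtain ⟨g, G, hmG, hM⟩ := exists_unitField hΩ hm (hmR.trans_lt ENNReal.coe_lt_top)
  have hGR : (G : ℝ) ≤ R := by
    have h1 : (G : ENNReal) ≤ R := le_add_self.trans (hM.symm.trans_le hmR)
    exact_mod_cast h1
  have hsmall : (D : ENNReal) * (ENNReal.ofReal 𝒯.meshWidth * G) ≤ 2⁻¹ := by
    have h1 : (D : ℝ) * (𝒯.meshWidth * G) ≤ 2⁻¹ := by
      calc (D : ℝ) * (𝒯.meshWidth * G)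
          ≤ (D + 1) * (1 / (2 * (D + 1) * (R + 1)) * (R + 1)) := by
            have := hu.pos
            gcongr <;> linarith
        _ = 2⁻¹ := by field_simp
    have h2 := ENNReal.ofReal_le_ofReal h1
    rw [ENNReal.ofReal_mul D.coe_nonneg, ENNReal.ofReal_mul hu.pos.le, ENNReal.ofReal_coe_nnreal,
      ENNReal.ofReal_coe_nnreal, ENNReal.ofReal_inv_of_pos two_pos, ENNReal.ofReal_ofNat] at h2
    exact h2
  refine (hCD hΩ hu hmG hsmall hp s v hv).trans ?_
  rw [hM]
  gcongr
  exact le_self_pow (le_self_add : (1 : ENNReal) ≤ 1 + G) two_ne_zero
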